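/- **Setting.** Consider the coupled nonlinear Schrödinger equation $\mathrm i\mathbf q_t+\tfrac12\mathbf q_{xx}+\mathbf q\mathbf q^\dagger\mathbf q=0$ for $\mathbf q=(q_1,q_2)^T$, and the plane wave $q^{[0]}_n=\exp\big(\mathrm i(b_nx+(2-\tfrac12 b_n^2)t)\big)$, $b_1=-b_2=b>0$, $b\neq\frac12$. For $l=1,2$ let $\chi_l$ be a root of $1+\sum_{i=1}^2(\chi+b_i)^{-2}=0$ (all four roots are nonreal and simple), with $\chi_1,\chi_2$ from the two different complex conjugate pairs, i.e. $\chi_2\ne\chi_1,\chi_1^*$. Let $\lambda_l(\varepsilon)=\lambda_l+\lambda_l^{[2]}\varepsilon^2$, $\lambda_l^{[2]}\neq0$, and $\chi_l(\varepsilon)=\chi_l+\sum_{i\ge1}\chi_l^{[i]}\varepsilon^i$ satisfy, identically in $\varepsilon$, the characteristic equation $\big(\chi-2\lambda-\sum_{i}\frac1{\chi+b_i}\big)\prod_{i}(\chi+b_i)=0$. Define $S_j$ by $\sum_{j\ge0}S_j(\mathbf z)\varepsilon^j=\exp\big(\sum_{j\ge1}z_j\varepsilon^j\big)$, $\mathbf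 z=(z_1,z_2,\dots)$, and put $C_{lm}=\chi_l^{[1]}/(\chi_l-\chi_m^*)$. Let $$\mathrm i(\chi_l(\varepsilon)-\lambda_l(\varepsilon))=\sum_j\alpha_{l,j}\varepsilon^j,\qquad \tfrac12\chi_l(\varepsilon)^2-\lambda_l(\varepsilon)^2-2=\sum_j\beta_{l,j}\varepsilon^j,$$ $$\ln\frac{\chi_l-\chi_m^*}{\chi_l(\varepsilon)-\chi_m^*}=\sum_{j\ge1}h^{[l,m]}_{1,j}\varepsilon^j,\quad \ln\Big(\frac{\chi_l-\chi_m^*}{\chi_l^{[1]}\varepsilon}\,\frac{\chi_l(\varepsilon)-\chi_l}{\chi_l(\varepsilon)-\chi_m^*}\Big)=\sum_{j\ge1}h^{[l,m]}_{2,j}\varepsilon^j,\quad \ln\frac{\chi_l+b_m}{\chi_l(\varepsilon)+b_m}=\sum_{j\ge1}h^{[l,m]}_{3,j}\varepsilon^j,$$ $\mathbf h_r^{[l,m]}=(h^{[l,m]}_{r,1},h^{[l,m]}_{r,2},\dots)$, $\mathbf h_3^{[l,0]}=0$. For complex parameters $d_{l,j}$ let $\mathbf x_l^+=(x^+_{l,1},x^+_{l,2},\dots)$,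 $x^+_{l,j}=\alpha_{l,j}x+\mathrm i\beta_{l,j}t+d_{l,j}$, $\mathbf x_l^-=(\mathbf x_l^+)^*$. For integers $N_1,N_2\ge0$ and $k=0,1,2$ let $\tau^{(k)}$ be the determinant of the $2\times2$ block matrix with blocks $\big(\tau^{(k,l,m)}_{2i-1,2j-1}\big)_{1\le i\le N_l,\,1\le j\le N_m}$, $l,m=1,2$, $$\tau^{(k,l,m)}_{i,j}=\frac1{\chi_l^*-\chi_m}\sum_{v=0}^{\min(i,j)}(C_{lm}^*C_{ml})^v\,S_{i-v}\big(\mathbf x_l^-+(\mathbf h_1^{[l,m]})^*+v(\mathbf h_2^{[l,m]})^*-(\mathbf h_3^{[l,k]})^*\big)\,S_{j-v}\big(\mathbf x_m^++\mathbf h_1^{[m,l]}+v\mathbf h_2^{[m,l]}+\mathbf h_3^{[m,k]}\big).$$ The $[N_1,N_2]$ vector rogue wave is $q_n^{[N_1,N_2]}=q_n^{[0]}\,\tau^{(n)}/\tau^{(0)}$, $n=1,2$. The first-order profile of type $l$ is $$\hat q_{n,l}(x,t)=1+\frac{2\mathrm i}{|\chi_l+b_n|^2}\;\frac{(\Re\chi_l+b_n)(x+t\,\Re\chi_l)-(\Im\chi_l)^2t+\frac{\mathrm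 i}2}{(x+t\,\Re\chi_l)^2+(\Im\chi_l)^2t^2+\frac1{4(\Im\chi_l)^2}} .$$ The Adler–Moser polynomial is $\Theta_N(z,\boldsymbol\kappa)=\prod_{k=1}^N(2k-1)!!\,\det(\varphi_{2i-j})_{1\le i,j\le N}$ with $\sum_k\varphi_k\epsilon^k=\exp\big(z\epsilon+\sum_{j\ge1}\kappa_{2j+1}\epsilon^{2j+1}\big)$ and $\varphi_k=0$ for $k<0$. Let $\mathbf P$ be the $2\times2$ block matrix with entries, $i,j\ge0$, in block $(l,m)$, $$\frac1{\chi_l^*-\chi_m}\sum_{v=0}^{\min(i,j)}\big(C_{lm}^v S_{i-v}(\mathbf h_1^{[l,m]}+v\mathbf h_2^{[l,m]})\big)^*\,C_{ml}^v S_{j-v}(\mathbf h_1^{[m,l]}+v\mathbf h_2^{[m,l]}).$$ Let $P_0$ be its minor with row and column indices $0,\dots,N_1-1$ in the first block and $0,\dots,N_2-1$ in the second, and let $P_l$ be the minor in which the last column index $N_l-1$ of block $l$ is replaced by $N_l$. Put $\Delta_l=P_l/P_0$ (where $P_0\neq 0$), a constant independent of $A$. **Theorem.** Let $\kappa_{l,2j+1}\in\mathbb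 C$ and take $d_{l,2j+1}=\kappa_{l,2j+1}A^{2j+1}$, $d_{l,2j}=0$ with $A>0$; let $\boldsymbol\kappa_l=(\kappa_{l,3},\kappa_{l,5},\dots)$. Suppose that for $l=1,2$ all roots of $\Theta_{N_l}(z,\boldsymbol\kappa_l)$ are simple. Let $B_l=B_l(A)\subset\mathbb R^2$ be the set of points $(x,t)$ for which $\kappa_{l,1}+\mathrm i\chi_l^{[1]}(x+\chi_lt)A^{-1}$ is a root of $\Theta_{N_l}(\cdot,\boldsymbol\kappa_l)$, and suppose that there is a constant $c>0$ such that, for all large $A$, every point of $B_1$ has Euclidean distance at least $c$ from every point of $B_2$. For a root $z_{l,0}$ of $\Theta_{N_l}(\cdot,\boldsymbol\kappa_l)$ define its position $(x_{l,0},t_{l,0})\in\mathbb R^2$ by $$\mathrm i\chi_l^{[1]}(x_{l,0}+\chi_lt_{l,0})+\Delta_l=(z_{l,0}-\kappa_{l,1})A .$$ This determines $(x_{l,0},t_{l,0})$ uniquely, and the following hold. 1. For $l=1,2$ there are exactly $N_l(N_l+1)/2$ roots $z_{l,0}$. The distance between any two of the $\frac{N_1(N_1+1)}2+\frac{N_2(N_2+1)}2$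 positions is at least $c'A$ for all large $A$, with a constant $c'>0$. Each component splits into the corresponding first-order rogue waves: $\tau^{(0)}$ has no zero in the plane for large $A$, and, as $A\to\infty$, for $n=1,2$, $$q_n^{[N_1,N_2]}(x,t)=q_n^{[0]}(x,t)\Big(1+\sum_{l=1}^2\sum_{z_{l,0}}\big(\hat q_{n,l}(x-x_{l,0},t-t_{l,0})-1\big)\Big)+o(1)\quad\text{uniformly in }(x,t)\in\mathbb R^2 .$$ 2. For every root $z_{l,0}$ and every $R>0$, $$q_n^{[N_1,N_2]}(x,t)=\hat q_{n,l}(x-x_{l,0},t-t_{l,0})\,q_n^{[0]}(x,t)+\mathcal O(A^{-1}),\quad n=1,2,$$ as $A\to\infty$, uniformly for $\sqrt{(x-x_{l,0})^2+(t-t_{l,0})^2}\le R$. 3. Away from all the positions the solution tends to the plane wave background: for every $\epsilon>0$ there is an $R$ such that, for all sufficiently large $A$, $|q_n^{[N_1,N_2]}(x,t)-q_n^{[0]}(x,t)|\le\epsilon$, $n=1,2$, at all points $(x,t)$ whose distance from every position is at least $R$. -/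

import Mathlib

open scoped ComplexConjugate
open Filter

namespace CNLS

noncomputable section

/-! ### Schur polynomials and Adler-Moser polynomials -/

/-- The elementary Schur polynomial `S_j(z)`, `z = (z 1, z 2, …)`: the coefficient of `ε ^ j` in
`exp (∑_{i ≥ 1} z i * ε ^ i)` (the value `z 0` is not used). -/
def schur {R : Type*} [CommRing R] [Algebra ℚ R] (z : ℕ → R) (j : ℕ) : R :=
  PowerSeries.coeff j
    ((PowerSeries.exp R).subst (PowerSeries.mk fun i => if i = 0 then 0 else z i))

/-- The variables `(z, 0, κ₃, 0, κ₅, 0, …)` with `z` the polynomial variable; `κ j` stands for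
`κ_{2j+1}`, and `κ 0` is not used. -/
def adlerMoserVars (κ : ℕ → ℂ) (i : ℕ) : Polynomial ℂ :=
  if i = 1 then Polynomial.X else if Odd i then Polynomial.C (κ (i / 2)) else 0

/-- The Adler-Moser polynomial
`Θ_N(z, κ) = c_N * det (φ_{2i-j}(z, κ))_{1 ≤ i, j ≤ N}`, `c_N = ∏_{k=1}^{N} (2k-1)!!`,
where `φ_k = 0` for `k < 0`. The indices below start at `0`. -/
def adlerMoser (κ : ℕ → ℂ) (N : ℕ) : Polynomial ℂ :=
  Polynomial.C (∏ k ∈ Finset.range N, ((Nat.doubleFactorial (2 * k + 1) : ℕ) : ℂ)) *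
    Matrix.det (Matrix.of fun i j : Fin N =>
      if (j : ℕ) ≤ 2 * (i : ℕ) + 1 then
        schur (adlerMoserVars κ) (2 * (i : ℕ) + 1 - (j : ℕ)) else 0)

/-- The set of (distinct) complex roots of `Θ_N(z, κ)`. -/
def rootSet (κ : ℕ → ℂ) (N : ℕ) : Finset ℂ := (adlerMoser κ N).roots.toFinset

/-! ### Plane wave, characteristic equation, perturbed double roots -/

/-- The wave numbers `b₁ = b`, `b₂ = -b`. -/
def waveNumber (b : ℝ) : Fin 2 → ℝ := ![b, -b]

/-- The plane wave `q_n^{[0]} = exp (i (b_n x + (2 - b_n ^ 2 / 2) t))` (amplitudes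
`a₁ = a₂ = 1`). -/
def planeWave (b : ℝ) (n : Fin 2) (x t : ℝ) : ℂ :=
  Complex.exp (Complex.I *
    ((waveNumber b n : ℂ) * x + (2 - (waveNumber b n : ℂ) ^ 2 / 2) * t))

/-- The left-hand side
`(χ - 2 λ - ∑ i, 1 / (χ + b_i)) * ∏ i, (χ + b_i)` of the characteristic equation, for formal power
series `χ`, `λ` in `ε`. -/
def charFun (b : ℝ) (χ lam : PowerSeries ℂ) : PowerSeries ℂ :=
  (χ - 2 * lam - ∑ i, (χ + PowerSeries.C (waveNumber b i : ℂ))⁻¹) *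
    ∏ i, (χ + PowerSeries.C (waveNumber b i : ℂ))

/-- The spectral data of the rogue waves: a wave number `0 < b ≠ 1/2`; for `l = 1, 2` (here `0, 1`)
a double root `χ_l` of the characteristic equation at `λ = λ_l`, taken from the two different pairs
of complex conjugate double roots, and a perturbation
`λ_l(ε) = λ_l + λ_l^{[2]} ε ^ 2`, `χ_l(ε) = χ_l + ∑_{i ≥ 1} χ_l^{[i]} ε ^ i`, `λ_l^{[2]} ≠ 0`,
that satisfies the characteristic equation identically in `ε`. -/
structure SpectralData where
  /-- the wave number `b₁ = -b₂` -/
  b : ℝ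
  b_pos : 0 < b
  b_ne : b ≠ 1 / 2
  /-- the series `χ_l(ε)` -/
  chiSeries : Fin 2 → PowerSeries ℂ
  /-- the numbers `λ_l` -/
  lam : Fin 2 → ℂ
  /-- the numbers `λ_l^{[2]}` -/
  lamTwo : Fin 2 → ℂ
  lamTwo_ne : ∀ l, lamTwo l ≠ 0
  char_eq : ∀ l, charFun b (chiSeries l)
    (PowerSeries.C (lam l) + PowerSeries.C (lamTwo l) * PowerSeries.X ^ 2) = 0
  double_root : ∀ l,
    1 + ∑ i, 1 / (PowerSeries.constantCoeff (chiSeries l) + (waveNumber b i : ℂ)) ^ 2 = 0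
  chi_ne : PowerSeries.constantCoeff (chiSeries 1) ≠ PowerSeries.constantCoeff (chiSeries 0)
  chi_ne_conj :
    PowerSeries.constantCoeff (chiSeries 1) ≠ conj (PowerSeries.constantCoeff (chiSeries 0))

namespace SpectralData

variable (D : SpectralData)

/-- `χ_l`. -/
def chi (l : Fin 2) : ℂ := PowerSeries.constantCoeff (D.chiSeries l)

/-- `χ_l^{[1]}`. -/
def chiOne (l : Fin 2) : ℂ := PowerSeries.coeff 1 (D.chiSeries l)

/-- `λ_l(ε) = λ_l + λ_l^{[2]} ε ^ 2`. -/
def lamSeries (l : Fin 2) : PowerSeries ℂ :=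
  PowerSeries.C (D.lam l) + PowerSeries.C (D.lamTwo l) * PowerSeries.X ^ 2

/-! ### The determinant formula of the vector rogue waves -/

/-- `α_{l,j}`: the coefficients of `i (χ_l(ε) - λ_l(ε))`. -/
def alpha (l : Fin 2) (j : ℕ) : ℂ :=
  PowerSeries.coeff j (PowerSeries.C Complex.I * (D.chiSeries l - D.lamSeries l))

/-- `β_{l,j}`: the coefficients of `χ_l(ε) ^ 2 / 2 - λ_l(ε) ^ 2 - 2`. -/
def beta (l : Fin 2) (j : ℕ) : ℂ :=
  PowerSeries.coeff j
    (PowerSeries.C (1 / 2 : ℂ) * D.chiSeries l ^ 2 - D.lamSeries l ^ 2 - 2)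

/-- `x_{l,j}^+ = α_{l,j} x + β_{l,j} i t + d_{l,j}`; note `x_{l,j}^- = conj x_{l,j}^+`. -/
def xPlus (d : Fin 2 → ℕ → ℂ) (l : Fin 2) (x t : ℝ) (j : ℕ) : ℂ :=
  D.alpha l j * x + D.beta l j * Complex.I * t + d l j

/-- `h_1^{[l,m]}`: the coefficients of `log ((χ_l - χ_m^*) / (χ_l(ε) - χ_m^*))`. -/
def hOne (l m : Fin 2) (j : ℕ) : ℂ :=
  PowerSeries.coeff j (PowerSeries.logOf
    (PowerSeries.C (D.chi l - conj (D.chi m)) *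
      (D.chiSeries l - PowerSeries.C (conj (D.chi m)))⁻¹))

/-- `h_2^{[l,m]}`: the coefficients of
`log ((χ_l - χ_m^*) / (χ_l^{[1]} ε) * (χ_l(ε) - χ_l) / (χ_l(ε) - χ_m^*))`. The power series with
coefficients `coeff (i + 1) χ_l(ε)` is `(χ_l(ε) - χ_l) / ε`. -/
def hTwo (l m : Fin 2) (j : ℕ) : ℂ :=
  PowerSeries.coeff j (PowerSeries.logOf
    (PowerSeries.C ((D.chi l - conj (D.chi m)) / D.chiOne l) *
      (PowerSeries.mk fun i => PowerSeries.coeff (i + 1) (D.chiSeries l)) *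
      (D.chiSeries l - PowerSeries.C (conj (D.chi m)))⁻¹))

/-- `h_3^{[l,k]}`: zero for `k = 0` (here `none`), and for `k = n ∈ {1, 2}` the coefficients of
`log ((χ_l + b_n) / (χ_l(ε) + b_n))`. -/
def hThree (l : Fin 2) : Option (Fin 2) → ℕ → ℂ
  | none, _ => 0
  | some n, j =>
      PowerSeries.coeff j (PowerSeries.logOf
        (PowerSeries.C (D.chi l + (waveNumber D.b n : ℂ)) *
          (D.chiSeries l + PowerSeries.C (waveNumber D.b n : ℂ))⁻¹))

/-- `C_{lm} = χ_l^{[1]} / (χ_l - χ_m^*)`. -/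
def coupling (l m : Fin 2) : ℂ := D.chiOne l / (D.chi l - conj (D.chi m))

/-- The element `τ_{i,j}^{(k,l,m)}`. -/
def tauEntry (d : Fin 2 → ℕ → ℂ) (k : Option (Fin 2)) (x t : ℝ) (l m : Fin 2) (i j : ℕ) : ℂ :=
  1 / (conj (D.chi l) - D.chi m) *
    ∑ v ∈ Finset.range (min i j + 1),
      (conj (D.coupling l m) * D.coupling m l) ^ v *
        schur (fun s => conj (D.xPlus d l x t s) + conj (D.hOne l m s)
          + (v : ℂ) * conj (D.hTwo l m s) - conj (D.hThree l k s)) (i - v) *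
        schur (fun s => D.xPlus d m x t s + D.hOne m l s
          + (v : ℂ) * D.hTwo m l s + D.hThree m k s) (j - v)

/-- `τ^{(k)}`: the determinant of the `2 × 2` block matrix with blocks
`(τ_{2i-1,2j-1}^{(k,l,m)})_{1 ≤ i ≤ N_l, 1 ≤ j ≤ N_m}`; `none` is `k = 0`. -/
def tau (N : Fin 2 → ℕ) (d : Fin 2 → ℕ → ℂ) (k : Option (Fin 2)) (x t : ℝ) : ℂ :=
  Matrix.det (Matrix.of fun p q : (l : Fin 2) × Fin (N l) =>
    D.tauEntry d k x t p.1 q.1 (2 * (p.2 : ℕ) + 1) (2 * (q.2 : ℕ) + 1))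

/-- The `n`-th component `q_n^{[N₁,N₂]} = q_n^{[0]} τ^{(n)} / τ^{(0)}` of the vector rogue wave with
internal parameters `d_{l,j}`. -/
def rogueWave (N : Fin 2 → ℕ) (d : Fin 2 → ℕ → ℂ) (n : Fin 2) (x t : ℝ) : ℂ :=
  planeWave D.b n x t * (D.tau N d (some n) x t / D.tau N d none x t)

/-- The profile `q̂_{n,l}(x, t)` of the first-order rogue wave of type `l`, centred at the origin. -/
def firstOrder (n l : Fin 2) (x t : ℝ) : ℂ :=
  1 + 2 * Complex.I / ((‖D.chi l + (waveNumber D.b n : ℂ)‖ ^ 2 : ℝ) : ℂ) *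
    (((((D.chi l).re + waveNumber D.b n) * (x + (D.chi l).re * t)
        - (D.chi l).im ^ 2 * t : ℝ) : ℂ) + Complex.I / 2) /
    (((x + (D.chi l).re * t) ^ 2 + (D.chi l).im ^ 2 * t ^ 2
        + 1 / (4 * (D.chi l).im ^ 2) : ℝ) : ℂ)

/-! ### Positions of the first-order rogue waves -/

/-- The map `ψ_l(x, t) = κ_{l,1} + i χ_l^{[1]} (x + χ_l t) / A`. -/
def psi (κ : Fin 2 → ℕ → ℂ) (A : ℝ) (l : Fin 2) (x t : ℝ) : ℂ :=
  κ l 0 + Complex.I * D.chiOne l * (x + D.chi l * t) / A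

/-- The `(i, j)` entry (indices from `0`) of the block `(l, m)` of the matrix `𝐏`, that is
`(χ_l^* - χ_m)⁻¹ (𝐏_{lm}^† 𝐏_{ml})_{ij}` with
`(𝐏_{ml})_{vj} = C_{ml}^v S_{j-v}(h_1^{[m,l]} + v h_2^{[m,l]})`. -/
def pEntry (l m : Fin 2) (i j : ℕ) : ℂ :=
  1 / (conj (D.chi l) - D.chi m) *
    ∑ v ∈ Finset.range (min i j + 1),
      conj (D.coupling l m ^ v * schur (fun s => D.hOne l m s + (v : ℂ) * D.hTwo l m s) (i - v)) *
        (D.coupling m l ^ v * schur (fun s => D.hOne m l s + (v : ℂ) * D.hTwo m l s) (j - v))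

/-- The minor `|𝐏[r, s]|` with row indices `r` and column indices `s` (indices from `0`, separately
in each of the two blocks). -/
def pMinor (N : Fin 2 → ℕ) (r s : (l : Fin 2) × Fin (N l) → ℕ) : ℂ :=
  Matrix.det (Matrix.of fun p q : (l : Fin 2) × Fin (N l) => D.pEntry p.1 q.1 (r p) (s q))

/-- The index vector `(1, …, N_l - 1, N_l)` in both blocks. -/
def stdIndex (N : Fin 2 → ℕ) (p : (l : Fin 2) × Fin (N l)) : ℕ := p.2

/-- The index vector `(1, …, N_l - 1, N_l + 1)` in the block `l`, and `(1, …, N_m)` in the other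
one. -/
def shiftIndex (N : Fin 2 → ℕ) (l : Fin 2) (p : (l : Fin 2) × Fin (N l)) : ℕ :=
  if p.1 = l ∧ (p.2 : ℕ) + 1 = N p.1 then (p.2 : ℕ) + 1 else p.2

/-- The constant `Δ_l`, a quotient of two minors of `𝐏`. -/
def shift (N : Fin 2 → ℕ) (l : Fin 2) : ℂ :=
  D.pMinor N (stdIndex N) (shiftIndex N l) / D.pMinor N (stdIndex N) (stdIndex N)

/-- The point `(x, t)` of the real plane with `x + c t = w`, for nonreal `c`. -/
def planePoint (c w : ℂ) : ℝ × ℝ := (w.re - c.re * (w.im / c.im), w.im / c.im)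

/-- The position `(x_{l,0}, t_{l,0})` that belongs to the root `z` of `Θ_{N_l}(z, κ_l)`: the solution
of `i χ_l^{[1]} (x + χ_l t) + Δ_l = (z - κ_{l,1}) A`. -/
def center (N : Fin 2 → ℕ) (κ : Fin 2 → ℕ → ℂ) (A : ℝ) (l : Fin 2) (z : ℂ) : ℝ × ℝ :=
  planePoint (D.chi l) (((z - κ l 0) * A - D.shift N l) / (Complex.I * D.chiOne l))

end SpectralData

/-- The large internal parameters `d_{l,2j+1} = κ_{l,2j+1} A ^ (2j+1)`, `d_{l,2j} = 0`; `κ l j`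
stands for `κ_{l,2j+1}`. -/
def largeParams (κ : Fin 2 → ℕ → ℂ) (A : ℝ) (l : Fin 2) (j : ℕ) : ℂ :=
  if Odd j then κ l (j / 2) * (A : ℂ) ^ j else 0

/-- The Euclidean distance in the `(x, t)`-plane. -/
def planeDist (p q : ℝ × ℝ) : ℝ := Real.sqrt ((p.1 - q.1) ^ 2 + (p.2 - q.2) ^ 2)

end

end CNLS

/-! By the addition formula for Schur polynomials, every `τ^{(k)}` is a determinant `|Y^† 𝐏 Z|` with
a constant matrix `𝐏` and block diagonal `Y`, `Z` whose rows are `S_{2i+1-r}` at the variables `x^+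
- h_3` and `x^+ + h_3` (`tau_eq_sandwichDet`). Instead of expanding by Cauchy-Binet, choose pivot
columns in each block: Cramer's rule pulls the pivot minors out of both sides and leaves rows of
quotients of minors (`tau_eq_mul_sandwichDet`). The limits of these rows then determine the limit of
`τ^{(k)}`, divided by a normalization that does not depend on `k` and so cancels in `τ^{(n)} /
τ^{(0)}`.

The Schur minors do not see the even variables (`schurMinor_oddPart`), they are weighted
homogeneous, and their odd variables are `κ_{2j+1} A^{2j+1}` up to `O(1 + |x| + |t|)`. Hence the
minor on the first `N` columns is, to leading order and up to a constant, `A^{N(N+1)/2} Θ_N(ψ)`, and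
shifting its last column replaces `Θ_N` by `Θ_N'` and loses one power of `A`.

Far from the positions, `|Θ_N(ψ)|` is bounded below (`exists_le_norm_schurMinor`), the rows become
unit rows, and every normalized `τ^{(k)}` tends to the same `P_0`, so the quotient tends to 1 with
error `O(1/R)` (`closeTo_tau_div_far`). Near a position that belongs to a simple root `z` of
`Θ_{N_l}`, the pivot of block `l` is the shifted minor, governed by `Θ'(z) ≠ 0`. The unshifted minor
is then of the same order and contributes `A(ψ - z)` with the correction `h_3`. The other block is
in the far regime because positions separate linearly in `A`. The limit is a minor of `𝐏` whose last
row and column in block `l` are combined with the next ones (`closeTo_tau_div_near`).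

This bordered minor is computed exactly. `𝐏` consists of the Taylor coefficients of the Cauchy
kernels `1 / (χ_l(ε₁)^* - χ_m(ε₂))` (`coeffTwo_cauchyKernel`), and Gaussian elimination turns a
Cauchy kernel into itself times a row factor and a column factor. This gives `P_0 ≠ 0`
(`kernelDet_ne_zero`) and a quadratic relation between three consecutive sizes
(`kernelDet_mul_kernelDet`). Together they yield the value `P_0 ((a + Δ^*)(b + Δ) + |C_{ll}|²)`
(`borderDet_eq`), and the quotient of two such values is the first-order profile (`firstOrder_eq`),
with `Δ` absorbed in the position (`psi_sub_eq`).

The near and far regions, for a fixed large `R`, cover the plane. As the profiles decay and the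
positions are at distance at least `cA` from each other, at most one profile matters at each point,
which gives the uniform statement. -/

namespace CNLS

noncomputable section

/-! ### Schur polynomials -/

section Schur

variable {R : Type*} [CommRing R]

/-- The exponent `∑_{i ≥ 1} z i * ε ^ i` in the generating function of the Schur polynomials. -/
def schurExponent (z : ℕ → R) : PowerSeries R := PowerSeries.mk fun i => if i = 0 then 0 else z i

theorem constantCoeff_schurExponent (z : ℕ → R) :
    PowerSeries.constantCoeff (schurExponent z) = 0 := by
  simp [schurExponent, ← PowerSeries.coeff_zero_eq_constantCoeff_apply]

theorem hasSubst_schurExponent (z : ℕ → R) : PowerSeries.HasSubst (schurExponent z) :=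
  PowerSeries.HasSubst.of_constantCoeff_zero' (constantCoeff_schurExponent z)

variable [Algebra ℚ R]

/-- The generating function of the Schur polynomials. -/
def schurSeries (z : ℕ → R) : PowerSeries R := (PowerSeries.exp R).subst (schurExponent z)

theorem coeff_schurSeries (z : ℕ → R) (j : ℕ) :
    PowerSeries.coeff j (schurSeries z) = schur z j := rfl

theorem derivative_schurSeries (z : ℕ → R) :
    PowerSeries.derivative R (schurSeries z) =
      PowerSeries.derivative R (schurExponent z) * schurSeries z := by
  rw [schurSeries, PowerSeries.derivative_subst (hasSubst_schurExponent z),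
    PowerSeries.derivative_exp, mul_comm]

theorem constantCoeff_schurSeries (z : ℕ → R) :
    PowerSeries.constantCoeff (schurSeries z) = 1 := by
  have h := PowerSeries.exp R
  have h1 : PowerSeries.exp R = 1 + (PowerSeries.exp R - 1) := by ring
  rw [schurSeries, h1, PowerSeries.subst_add (hasSubst_schurExponent z)]
  have h2 : (1 : PowerSeries R).subst (schurExponent z) = (1 : PowerSeries R) := by
    rw [← PowerSeries.coe_substAlgHom (hasSubst_schurExponent z), map_one]
  rw [h2, map_add, map_one]
  have h3 := PowerSeries.constantCoeff_subst_eq_zero (R := R) (S := R)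
    (a := schurExponent z) (constantCoeff_schurExponent z) (PowerSeries.exp R - 1) (by simp)
  change PowerSeries.constantCoeff _ = 0 at h3
  rw [h3, add_zero]

theorem schur_zero (z : ℕ → R) : schur z 0 = 1 := by
  rw [← coeff_schurSeries, PowerSeries.coeff_zero_eq_constantCoeff_apply,
    constantCoeff_schurSeries]

/-- Coefficients of `f' = g' f` for `f = exp g`. Most later facts on `schur` are inductions along
this recurrence, with no substitution of power series involved. -/
theorem schur_succ (z : ℕ → R) (n : ℕ) :
    ((n : R) + 1) * schur z (n + 1) =
      ∑ p ∈ Finset.HasAntidiagonal.antidiagonal n, ((p.1 : R) + 1) * z (p.1 + 1) * schur z p.2 := by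
  have h := congrArg (PowerSeries.coeff n) (derivative_schurSeries z)
  rw [PowerSeries.coeff_derivative, PowerSeries.coeff_mul, coeff_schurSeries] at h
  rw [mul_comm, h]
  refine Finset.sum_congr rfl fun p _ => ?_
  rw [PowerSeries.coeff_derivative, coeff_schurSeries, schurExponent, PowerSeries.coeff_mk,
    if_neg (Nat.succ_ne_zero _)]
  ring

theorem natCast_succ_mul_cancel (n : ℕ) {a b : R} (h : ((n : R) + 1) * a = ((n : R) + 1) * b) :
    a = b := by
  have hu : IsUnit ((n : R) + 1) := by
    have := (IsUnit.mk0 ((n : ℚ) + 1) (by positivity)).map (algebraMap ℚ R)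
    simpa using this
  exact hu.mul_left_cancel h

/-- The recurrence of the Schur polynomials determines them. -/
theorem eq_schur_of_recurrence (z : ℕ → R) (f : ℕ → R) (h0 : f 0 = 1)
    (hf : ∀ n : ℕ, ((n : R) + 1) * f (n + 1) =
      ∑ p ∈ Finset.HasAntidiagonal.antidiagonal n, ((p.1 : R) + 1) * z (p.1 + 1) * f p.2) (n : ℕ) :
    f n = schur z n := by
  induction n using Nat.strong_induction_on with
  | _ n ih =>
    cases n with
    | zero => rw [h0, schur_zero]
    | succ n =>
      apply natCast_succ_mul_cancel n
      rw [hf, schur_succ]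
      refine Finset.sum_congr rfl fun p hp => ?_
      rw [ih p.2 (by have := Finset.HasAntidiagonal.mem_antidiagonal.mp hp; omega)]

/-- The equation `f' = g' f` with `f(0) = 1` has only one solution, since `n + 1` is invertible in a
`ℚ`-algebra. Exponentials are identified below by checking this equation. -/
theorem schurSeries_eq_of_derivative (z : ℕ → R) (f : PowerSeries R)
    (h0 : PowerSeries.constantCoeff f = 1)
    (hf : PowerSeries.derivative R f = PowerSeries.derivative R (schurExponent z) * f) :
    schurSeries z = f := by
  ext n
  rw [coeff_schurSeries]
  refine (eq_schur_of_recurrence z (fun n => PowerSeries.coeff n f) ?_ (fun n => ?_) n).symm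
  · simpa using h0
  · have h := congrArg (PowerSeries.coeff n) hf
    rw [PowerSeries.coeff_derivative, PowerSeries.coeff_mul] at h
    rw [mul_comm, h]
    refine Finset.sum_congr rfl fun p _ => ?_
    rw [PowerSeries.coeff_derivative, schurExponent, PowerSeries.coeff_mk,
      if_neg (Nat.succ_ne_zero _)]
    ring

theorem schurSeries_add (z w : ℕ → R) :
    schurSeries (fun j => z j + w j) = schurSeries z * schurSeries w := by
  apply schurSeries_eq_of_derivative
  · rw [map_mul, constantCoeff_schurSeries, constantCoeff_schurSeries, one_mul]
  · have h : schurExponent (fun j => z j + w j) = schurExponent z + schurExponent w := by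
      ext n
      by_cases hn : n = 0 <;> simp [schurExponent, hn]
    rw [h, map_add, Derivation.leibniz, derivative_schurSeries, derivative_schurSeries, smul_eq_mul,
      smul_eq_mul]
    ring

theorem schur_add (z w : ℕ → R) (n : ℕ) :
    schur (fun j => z j + w j) n =
      ∑ p ∈ Finset.HasAntidiagonal.antidiagonal n, schur z p.1 * schur w p.2 := by
  rw [← coeff_schurSeries, schurSeries_add, PowerSeries.coeff_mul]
  rfl

theorem schurSeries_zero : schurSeries (fun _ => (0 : R)) = 1 := by
  apply schurSeries_eq_of_derivative
  · simp
  · have h : schurExponent (fun _ => (0 : R)) = 0 := by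
      ext n
      simp [schurExponent]
    rw [h, map_zero, zero_mul, PowerSeries.derivative_one]

theorem schurSeries_natCast_mul (z : ℕ → R) (v : ℕ) :
    schurSeries (fun j => (v : R) * z j) = schurSeries z ^ v := by
  induction v with
  | zero => simpa using schurSeries_zero
  | succ v ih =>
    rw [pow_succ, ← ih, ← schurSeries_add]
    congr 1
    ext j
    push_cast
    ring

theorem map_schur {S : Type*} [CommRing S] [Algebra ℚ S] (f : R →+* S) (z : ℕ → R) (n : ℕ) :
    f (schur z n) = schur (fun j => f (z j)) n := by
  refine eq_schur_of_recurrence _ (fun n => f (schur z n)) (by simp [schur_zero]) (fun n => ?_) n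
  have h := congrArg f (schur_succ z n)
  simpa using h

/-- Weighted homogeneity: scaling the variable of index `j` by `a ^ j` amounts to replacing `ε` by
`a ε`. -/
theorem schur_scale (a : R) (z : ℕ → R) (n : ℕ) :
    schur (fun j => a ^ j * z j) n = a ^ n * schur z n := by
  refine (eq_schur_of_recurrence _ (fun n => a ^ n * schur z n) (by simp [schur_zero])
    (fun n => ?_) n).symm
  have h := schur_succ z n
  calc ((n : R) + 1) * (a ^ (n + 1) * schur z (n + 1))
      = a ^ (n + 1) * (((n : R) + 1) * schur z (n + 1)) := by ring
    _ = _ := by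
      rw [h, Finset.mul_sum]
      refine Finset.sum_congr rfl fun p hp => ?_
      rw [← Finset.HasAntidiagonal.mem_antidiagonal.mp hp]
      ring

/-- If only the even variables are nonzero, the odd Schur polynomials vanish. -/
theorem schur_odd_eq_zero {z : ℕ → R} (hz : ∀ j, Odd j → z j = 0) {n : ℕ} (hn : Odd n) :
    schur z n = 0 := by
  induction n using Nat.strong_induction_on with
  | _ n ih =>
    cases n with
    | zero => simp at hn
    | succ n =>
      apply natCast_succ_mul_cancel n
      rw [schur_succ, mul_zero]
      refine Finset.sum_eq_zero fun p hp => ?_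
      have hp' := Finset.HasAntidiagonal.mem_antidiagonal.mp hp
      rcases Nat.even_or_odd (p.1 + 1) with h | h
      · rw [ih p.2 (by omega) (by grind), mul_zero]
      · rw [hz _ h, mul_zero, zero_mul]

end Schur

/-- `f` solves `f' = (log f)' f`. The vectors `h_r` are defined by logarithms; this turns their
Schur polynomials back into coefficients of explicit series. -/
theorem schurSeries_logOf {f : PowerSeries ℂ} (hf : PowerSeries.constantCoeff f = 1) :
    schurSeries (fun j => PowerSeries.coeff j (PowerSeries.logOf f)) = f := by
  apply schurSeries_eq_of_derivative _ _ hf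
  have h : schurExponent (fun j => PowerSeries.coeff j (PowerSeries.logOf f)) =
      PowerSeries.logOf f := by
    ext n
    by_cases hn : n = 0
    · subst hn
      simp [schurExponent, PowerSeries.constantCoeff_logOf hf]
    · simp [schurExponent, hn]
  have hs : PowerSeries.HasSubst (f - 1) :=
    PowerSeries.HasSubst.of_constantCoeff_zero' (by simp [hf])
  -- The derivative of `log(1 + X)` is the inverse of `1 + X`; substituting `f - 1` gives `(log f)'
  -- = f' / f` without division.
  have hlog : PowerSeries.derivative ℂ (PowerSeries.log ℂ) * (1 + PowerSeries.X) = 1 := by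
    rw [PowerSeries.deriv_log]
    ext n
    cases n with
    | zero => simp [mul_add]
    | succ n => simp [mul_add, PowerSeries.coeff_succ_mul_X, pow_succ, PowerSeries.coeff_one]
  have hsub := congrArg (PowerSeries.subst (f - 1)) hlog
  rw [PowerSeries.subst_mul hs, PowerSeries.subst_add hs, PowerSeries.subst_X hs,
    ← PowerSeries.coe_substAlgHom hs, map_one, PowerSeries.coe_substAlgHom hs,
    add_sub_cancel] at hsub
  rw [h, PowerSeries.logOf_eq, PowerSeries.derivative_subst hs, map_sub,
    PowerSeries.derivative_one, sub_zero, mul_right_comm, hsub, one_mul]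

theorem conj_schur (z : ℕ → ℂ) (n : ℕ) : conj (schur z n) = schur (fun j => conj (z j)) n :=
  map_schur (starRingEnd ℂ) z n

end

end CNLS

namespace CNLS

noncomputable section

/-! ### Block matrices -/

section Block

variable {ι : Type*} [Fintype ι] [DecidableEq ι] {α : Type*} [CommRing α]

theorem blockDiagonal'_mul_apply {m n : ι → Type*} [∀ l, Fintype (n l)] {κ : Type*}
    (B : ∀ l, Matrix (m l) (n l) α) (M : Matrix ((l : ι) × n l) κ α) (p : (l : ι) × m l) (y : κ) :
    (Matrix.blockDiagonal' B * M) p y = ∑ a, B p.1 p.2 a * M ⟨p.1, a⟩ y := by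
  obtain ⟨l, i⟩ := p
  rw [Matrix.mul_apply, Fintype.sum_sigma, Finset.sum_eq_single l]
  · refine Finset.sum_congr rfl fun a _ => ?_
    rw [Matrix.blockDiagonal'_apply_eq]
  · intro b _ hb
    refine Finset.sum_eq_zero fun a _ => ?_
    rw [Matrix.blockDiagonal'_apply_ne _ _ _ hb.symm, zero_mul]
  · intro h
    exact absurd (Finset.mem_univ _) h

theorem mul_blockDiagonal'_transpose_apply {m n : ι → Type*} [∀ l, Fintype (n l)] {κ : Type*}
    (B : ∀ l, Matrix (m l) (n l) α) (M : Matrix κ ((l : ι) × n l) α) (x : κ) (p : (l : ι) × m l) :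
    (M * (Matrix.blockDiagonal' B).transpose) x p = ∑ a, B p.1 p.2 a * M x ⟨p.1, a⟩ := by
  have h := blockDiagonal'_mul_apply B M.transpose p x
  rw [← Matrix.transpose_apply (_ * _), Matrix.transpose_mul, Matrix.transpose_transpose]
  exact h

theorem det_blockDiagonal' {κ : Type*} [Fintype κ] [LinearOrder κ] {m : κ → Type*}
    [∀ l, Fintype (m l)] [∀ l, DecidableEq (m l)] (B : ∀ l, Matrix (m l) (m l) α) :
    (Matrix.blockDiagonal' B).det = ∏ l, (B l).det := by
  rw [(Matrix.blockTriangular_blockDiagonal' B).det_fintype]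
  refine Finset.prod_congr rfl fun l _ => ?_
  rw [← Matrix.det_submatrix_equiv_self (Equiv.sigmaSubtype l).symm]
  congr 1
  ext i j
  exact Matrix.blockDiagonal'_apply_eq B l i j

end Block

/-! ### Coefficients of power series in two variables -/

/-- The coefficient of `ε₁ ^ i * ε₂ ^ j`. -/
def coeffTwo (i j : ℕ) (F : PowerSeries (PowerSeries ℂ)) : ℂ :=
  PowerSeries.coeff j (PowerSeries.coeff i F)

/-- A power series in the first variable. -/
def rowSeries : PowerSeries ℂ →+* PowerSeries (PowerSeries ℂ) := PowerSeries.map PowerSeries.C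

/-- A power series in the second variable. -/
def colSeries : PowerSeries ℂ →+* PowerSeries (PowerSeries ℂ) := PowerSeries.C

theorem constantCoeff_rowSeries (f : PowerSeries ℂ) :
    PowerSeries.constantCoeff (rowSeries f) = PowerSeries.C (PowerSeries.constantCoeff f) := by
  rw [rowSeries, ← PowerSeries.coeff_zero_eq_constantCoeff_apply, PowerSeries.coeff_map,
    PowerSeries.coeff_zero_eq_constantCoeff_apply]

theorem coeffTwo_add (i j : ℕ) (F G : PowerSeries (PowerSeries ℂ)) :
    coeffTwo i j (F + G) = coeffTwo i j F + coeffTwo i j G := by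
  simp [coeffTwo]

theorem coeffTwo_sum {κ : Type*} (s : Finset κ) (i j : ℕ) (F : κ → PowerSeries (PowerSeries ℂ)) :
    coeffTwo i j (∑ k ∈ s, F k) = ∑ k ∈ s, coeffTwo i j (F k) := by
  simp [coeffTwo]

theorem coeffTwo_rowSeries_mul (i j : ℕ) (f : PowerSeries ℂ) (F : PowerSeries (PowerSeries ℂ)) :
    coeffTwo i j (rowSeries f * F) =
      ∑ p ∈ Finset.HasAntidiagonal.antidiagonal i,
        PowerSeries.coeff p.1 f * coeffTwo p.2 j F := by
  simp [coeffTwo, rowSeries, PowerSeries.coeff_mul i, PowerSeries.coeff_C_mul]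

theorem coeffTwo_colSeries_mul (i j : ℕ) (f : PowerSeries ℂ) (F : PowerSeries (PowerSeries ℂ)) :
    coeffTwo i j (colSeries f * F) =
      ∑ p ∈ Finset.HasAntidiagonal.antidiagonal j,
        PowerSeries.coeff p.1 f * coeffTwo i p.2 F := by
  simp [coeffTwo, colSeries, PowerSeries.coeff_C_mul, PowerSeries.coeff_mul j]

theorem coeffTwo_rowSeries_mul_colSeries (i j : ℕ) (f g : PowerSeries ℂ) :
    coeffTwo i j (rowSeries f * colSeries g) = PowerSeries.coeff i f * PowerSeries.coeff j g := by
  simp [coeffTwo, rowSeries, colSeries, PowerSeries.coeff_mul_C, PowerSeries.coeff_C_mul]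

theorem rowSeries_X : rowSeries PowerSeries.X = PowerSeries.X := by simp [rowSeries]

theorem coeffTwo_succ_rowSeries_X_mul (i j : ℕ) (F : PowerSeries (PowerSeries ℂ)) :
    coeffTwo (i + 1) j (rowSeries PowerSeries.X * F) = coeffTwo i j F := by
  rw [rowSeries_X, coeffTwo, PowerSeries.coeff_succ_X_mul]
  rfl

theorem coeffTwo_succ_colSeries_X_mul (i j : ℕ) (F : PowerSeries (PowerSeries ℂ)) :
    coeffTwo i (j + 1) (colSeries PowerSeries.X * F) = coeffTwo i j F := by
  rw [colSeries, coeffTwo, PowerSeries.coeff_C_mul, PowerSeries.coeff_succ_X_mul]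
  rfl

theorem coeffTwo_rowSeries_C_mul (i j : ℕ) (c : ℂ) (F : PowerSeries (PowerSeries ℂ)) :
    coeffTwo i j (rowSeries (PowerSeries.C c) * F) = c * coeffTwo i j F := by
  simp [coeffTwo, rowSeries, PowerSeries.coeff_C_mul]

theorem rowSeries_C (c : ℂ) : rowSeries (PowerSeries.C c) = colSeries (PowerSeries.C c) := by
  simp [rowSeries, colSeries]

/-- A convolution at index `i` involves only indices up to `i`, so truncation to size `n` leaves an
exact matrix product. -/
theorem sum_antidiagonal_eq_sum_fin (n : ℕ) (i : Fin n) (f g : ℕ → ℂ) :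
    ∑ p ∈ Finset.HasAntidiagonal.antidiagonal (i : ℕ), f p.1 * g p.2 =
      ∑ a : Fin n, (if (a : ℕ) ≤ i then f (i - a) else 0) * g a := by
  rw [← Finset.sum_range (fun a => (if a ≤ (i : ℕ) then f (i - a) else 0) * g a),
    ← Finset.Nat.sum_antidiagonal_swap, Finset.Nat.sum_antidiagonal_eq_sum_range_succ_mk]
  have hsub : Finset.range ((i : ℕ) + 1) ⊆ Finset.range n :=
    Finset.range_subset_range.mpr i.2
  rw [← Finset.sum_subset hsub]
  · refine Finset.sum_congr rfl fun a ha => ?_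
    rw [if_pos (Nat.lt_succ_iff.mp (Finset.mem_range.mp ha))]
    rfl
  · intro a _ ha
    rw [if_neg (by simpa using ha), zero_mul]

section Kernel

variable {ι : Type*} [Fintype ι] [LinearOrder ι]

/-- The lower triangular Toeplitz matrix of a power series. -/
def toeplitz (n : ℕ) (f : PowerSeries ℂ) : Matrix (Fin n) (Fin n) ℂ :=
  Matrix.of fun i a => if (a : ℕ) ≤ i then PowerSeries.coeff (i - a) f else 0

theorem det_toeplitz (n : ℕ) (f : PowerSeries ℂ) :
    (toeplitz n f).det = PowerSeries.constantCoeff f ^ n := by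
  rw [Matrix.det_of_isLowerTriangular]
  · simp [toeplitz]
  · intro i j hij
    have h : i < j := hij
    exact if_neg (by simpa using h)

/-- The block matrix of the coefficients of a family of power series in two variables. -/
def coeffMatrix (N : ι → ℕ) (F : ι → ι → PowerSeries (PowerSeries ℂ)) :
    Matrix ((l : ι) × Fin (N l)) ((l : ι) × Fin (N l)) ℂ :=
  Matrix.of fun p q => coeffTwo p.2 q.2 (F p.1 q.1)

/-- A factor in `ε₁` convolves the row index alone: it acts from the left by block diagonal lower
triangular Toeplitz matrices, whose diagonals carry the constant term. -/
theorem det_coeffMatrix_rowSeries_mul (N : ι → ℕ) (f : ι → PowerSeries ℂ)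
    (F : ι → ι → PowerSeries (PowerSeries ℂ)) :
    (coeffMatrix N fun l m => rowSeries (f l) * F l m).det =
      (∏ l, PowerSeries.constantCoeff (f l) ^ N l) * (coeffMatrix N F).det := by
  have h : coeffMatrix N (fun l m => rowSeries (f l) * F l m) =
      Matrix.blockDiagonal' (fun l => toeplitz (N l) (f l)) * coeffMatrix N F := by
    ext p q
    rw [blockDiagonal'_mul_apply]
    simp only [coeffMatrix, Matrix.of_apply, coeffTwo_rowSeries_mul]
    exact sum_antidiagonal_eq_sum_fin _ p.2 (fun a => PowerSeries.coeff a (f p.1))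
      (fun b => coeffTwo b q.2 (F p.1 q.1))
  rw [h, Matrix.det_mul, det_blockDiagonal']
  simp only [det_toeplitz]

theorem det_coeffMatrix_colSeries_mul (N : ι → ℕ) (f : ι → PowerSeries ℂ)
    (F : ι → ι → PowerSeries (PowerSeries ℂ)) :
    (coeffMatrix N fun l m => colSeries (f m) * F l m).det =
      (∏ l, PowerSeries.constantCoeff (f l) ^ N l) * (coeffMatrix N F).det := by
  have h : coeffMatrix N (fun l m => colSeries (f m) * F l m) =
      coeffMatrix N F *
        (Matrix.blockDiagonal' (fun l => toeplitz (N l) (f l))).transpose := by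
    ext p q
    rw [mul_blockDiagonal'_transpose_apply]
    simp only [coeffMatrix, Matrix.of_apply, coeffTwo_colSeries_mul]
    exact sum_antidiagonal_eq_sum_fin _ q.2 (fun a => PowerSeries.coeff a (f q.1))
      (fun b => coeffTwo p.2 b (F p.1 q.1))
  rw [h, Matrix.det_mul, Matrix.det_transpose, det_blockDiagonal']
  simp only [det_toeplitz, mul_comm]

/-- The Cauchy kernel `1 / (q(ε₁) - p(ε₂))`. -/
def cauchyKernel (q p : PowerSeries ℂ) : PowerSeries (PowerSeries ℂ) :=
  Ring.inverse (rowSeries q - colSeries p)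

theorem cauchyKernel_mul {q p : PowerSeries ℂ}
    (h : PowerSeries.constantCoeff q ≠ PowerSeries.constantCoeff p) :
    cauchyKernel q p * (rowSeries q - colSeries p) = 1 := by
  apply Ring.inverse_mul_cancel
  rw [PowerSeries.isUnit_iff_constantCoeff, PowerSeries.isUnit_iff_constantCoeff]
  simpa [constantCoeff_rowSeries, colSeries, sub_eq_zero] using h

theorem coeffTwo_zero_zero (F : PowerSeries (PowerSeries ℂ)) :
    coeffTwo 0 0 F = PowerSeries.constantCoeff (PowerSeries.constantCoeff F) := by
  simp [coeffTwo]

theorem coeffTwo_zero_left (j : ℕ) (F : PowerSeries (PowerSeries ℂ)) :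
    coeffTwo 0 j F = PowerSeries.coeff j (PowerSeries.constantCoeff F) := by
  simp [coeffTwo]

theorem coeffTwo_zero_right (i : ℕ) (F : PowerSeries (PowerSeries ℂ)) :
    coeffTwo i 0 F = PowerSeries.coeff i (PowerSeries.map PowerSeries.constantCoeff F) := by
  simp [coeffTwo]

theorem sub_C_mul_inv {f : PowerSeries ℂ} {c : ℂ} (h : PowerSeries.constantCoeff f ≠ c) :
    (f - PowerSeries.C c) * (f - PowerSeries.C c)⁻¹ = 1 :=
  PowerSeries.mul_inv_cancel _ (by simpa [sub_eq_zero] using h)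

theorem constantCoeff_cauchyKernel {q p : PowerSeries ℂ}
    (h : PowerSeries.constantCoeff q ≠ PowerSeries.constantCoeff p) :
    PowerSeries.constantCoeff (cauchyKernel q p) =
      -(p - PowerSeries.C (PowerSeries.constantCoeff q))⁻¹ := by
  have h1 := congrArg PowerSeries.constantCoeff (cauchyKernel_mul h)
  rw [map_mul, map_one] at h1
  have h2 : PowerSeries.constantCoeff (rowSeries q - colSeries p) =
      PowerSeries.C (PowerSeries.constantCoeff q) - p := by
    simp [constantCoeff_rowSeries, colSeries]
  rw [h2] at h1
  have h3 := sub_C_mul_inv h.symm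
  linear_combination (-(p - PowerSeries.C (PowerSeries.constantCoeff q))⁻¹) * h1 -
    PowerSeries.constantCoeff (cauchyKernel q p) * h3

theorem map_constantCoeff_cauchyKernel {q p : PowerSeries ℂ}
    (h : PowerSeries.constantCoeff q ≠ PowerSeries.constantCoeff p) :
    PowerSeries.map PowerSeries.constantCoeff (cauchyKernel q p) =
      (q - PowerSeries.C (PowerSeries.constantCoeff p))⁻¹ := by
  have h1 := congrArg (PowerSeries.map PowerSeries.constantCoeff) (cauchyKernel_mul h)
  rw [map_mul, map_one] at h1
  have h2 : PowerSeries.map PowerSeries.constantCoeff (rowSeries q - colSeries p) =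
      q - PowerSeries.C (PowerSeries.constantCoeff p) := by
    ext n
    simp [rowSeries, colSeries, PowerSeries.coeff_C]
  rw [h2] at h1
  have h3 := sub_C_mul_inv h
  linear_combination ((q - PowerSeries.C (PowerSeries.constantCoeff p))⁻¹) * h1 -
    PowerSeries.map PowerSeries.constantCoeff (cauchyKernel q p) * h3

end Kernel

end

end CNLS

namespace CNLS

noncomputable section

/-! ### Determinants of coefficients of Cauchy kernels -/

theorem sigma_fin_ext {ι : Type*} {N : ι → ℕ} {p q : (l : ι) × Fin (N l)} (h1 : p.1 = q.1)
    (h2 : (p.2 : ℕ) = q.2) : p = q := by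
  obtain ⟨l, i⟩ := p
  obtain ⟨m, j⟩ := q
  simp only at h1 h2
  subst h1
  rw [Fin.ext h2]

section Index

variable {ι : Type*} [Fintype ι] [DecidableEq ι]

theorem sum_eq_add_of_eq_except {N N' : ι → ℕ} {l : ι} {k : ℕ} (hl : N' l = N l + k)
    (hN : ∀ a, a ≠ l → N' a = N a) : ∑ a, N' a = ∑ a, N a + k := by
  rw [← Finset.add_sum_erase _ _ (Finset.mem_univ l),
    ← Finset.add_sum_erase _ N (Finset.mem_univ l), hl,
    Finset.sum_congr rfl fun a ha => hN a (Finset.ne_of_mem_erase ha)]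
  ring

/-- Appending `k` indices at the end of the block `l`. -/
def appendEquiv {N N' : ι → ℕ} {l : ι} {k : ℕ} (hl : N' l = N l + k)
    (hN : ∀ a, a ≠ l → N' a = N a) :
    ((a : ι) × Fin (N a)) ⊕ Fin k ≃ (a : ι) × Fin (N' a) :=
  Equiv.ofBijective
    (Sum.elim
      (fun p => ⟨p.1, ⟨p.2, by
        have := p.2.2
        by_cases h : p.1 = l
        · have h1 := congrArg N h
          have h2 := congrArg N' h
          omega
        · rw [hN _ h]; exact this⟩⟩)
      (fun i => ⟨l, ⟨N l + i, by omega⟩⟩))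
    (by
      rw [Fintype.bijective_iff_injective_and_card]
      constructor
      · rintro (p | i) (q | j) h
        · simp only [Sum.elim_inl] at h
          have h1 := congrArg Sigma.fst h
          have h2 := congrArg (fun s : (a : ι) × Fin (N' a) => (s.2 : ℕ)) h
          exact congrArg _ (sigma_fin_ext h1 h2)
        · exfalso
          simp only [Sum.elim_inl, Sum.elim_inr] at h
          have h1 := congrArg Sigma.fst h
          have h2 := congrArg (fun s : (a : ι) × Fin (N' a) => (s.2 : ℕ)) h
          have h3 := p.2.2
          simp only at h1 h2
          have h4 := congrArg N h1
          omega
        · exfalso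
          simp only [Sum.elim_inl, Sum.elim_inr] at h
          have h1 := congrArg Sigma.fst h
          have h2 := congrArg (fun s : (a : ι) × Fin (N' a) => (s.2 : ℕ)) h
          have h3 := q.2.2
          simp only at h1 h2
          have h4 := congrArg N h1
          omega
        · simp only [Sum.elim_inr] at h
          have h2 := congrArg (fun s : (a : ι) × Fin (N' a) => (s.2 : ℕ)) h
          simp only at h2
          exact congrArg _ (Fin.ext (by omega))
      · simp [sum_eq_add_of_eq_except hl hN])

/-- Inserting an index at the beginning of the block `l`. -/
def prependEquiv {N N' : ι → ℕ} {l : ι} (hl : N' l = N l + 1)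
    (hN : ∀ a, a ≠ l → N' a = N a) :
    Unit ⊕ ((a : ι) × Fin (N a)) ≃ (a : ι) × Fin (N' a) :=
  Equiv.ofBijective
    (Sum.elim
      (fun _ => ⟨l, ⟨0, by omega⟩⟩)
      (fun p => ⟨p.1, ⟨if p.1 = l then p.2 + 1 else p.2, by
        have := p.2.2
        by_cases h : p.1 = l
        · have h1 := congrArg N h
          have h2 := congrArg N' h
          rw [if_pos h]
          omega
        · rw [if_neg h, hN _ h]; exact this⟩⟩))
    (by
      rw [Fintype.bijective_iff_injective_and_card]
      constructor
      · rintro (p | p) (q | q) h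
        · rfl
        · exfalso
          simp only [Sum.elim_inl, Sum.elim_inr] at h
          have h1 := congrArg Sigma.fst h
          have h2 := congrArg (fun s : (a : ι) × Fin (N' a) => (s.2 : ℕ)) h
          simp only at h1 h2
          rw [if_pos h1.symm] at h2
          omega
        · exfalso
          simp only [Sum.elim_inl, Sum.elim_inr] at h
          have h1 := congrArg Sigma.fst h
          have h2 := congrArg (fun s : (a : ι) × Fin (N' a) => (s.2 : ℕ)) h
          simp only at h1 h2
          rw [if_pos h1] at h2
          omega
        · simp only [Sum.elim_inr] at h
          have h1 := congrArg Sigma.fst h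
          have h2 := congrArg (fun s : (a : ι) × Fin (N' a) => (s.2 : ℕ)) h
          simp only at h1 h2
          refine congrArg _ (sigma_fin_ext h1 ?_)
          by_cases hp : p.1 = l
          · rw [if_pos hp, if_pos (h1 ▸ hp)] at h2
            omega
          · rwa [if_neg hp, if_neg (h1 ▸ hp)] at h2
      · simp [sum_eq_add_of_eq_except hl hN, add_comm])

end Index

section Recursion

variable {ι : Type*} [LinearOrder ι]

/-- The power series `(f(ε) - f(0)) / ε`. -/
def shiftSeries (f : PowerSeries ℂ) : PowerSeries ℂ :=
  PowerSeries.mk fun i => PowerSeries.coeff (i + 1) f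

theorem X_mul_shiftSeries (f : PowerSeries ℂ) :
    PowerSeries.X * shiftSeries f = f - PowerSeries.C (PowerSeries.constantCoeff f) := by
  rw [eq_sub_iff_add_eq, mul_comm]
  exact (PowerSeries.eq_shift_mul_X_add_const f).symm

/-- The factor picked up in one step of the elimination in a Cauchy kernel. -/
def pivotFactor (q : ι → PowerSeries ℂ) (c : ℂ) (l a : ι) : PowerSeries ℂ :=
  (if a = l then shiftSeries (q l) else q a - PowerSeries.C (PowerSeries.constantCoeff (q l))) *
    (q a - PowerSeries.C c)⁻¹

/-- The left side is the Schur complement `K(ε₁,ε₂) - K(ε₁,0) K(0,ε₂) / K(0,0)`, where `K(ε₁,0) =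
1/(q - p0)`, `K(0,ε₂) = -1/(p - q0)` and `K(0,0) = 1/(q0 - p0)` when the pivot series have constant
terms `q0`, `p0`. One step of Gaussian elimination thus reproduces the kernel up to a row factor and
a column factor. -/
theorem cauchyKernel_elimination {q p : PowerSeries ℂ} {q0 p0 : ℂ}
    (h : PowerSeries.constantCoeff q ≠ PowerSeries.constantCoeff p)
    (hq : PowerSeries.constantCoeff q ≠ p0) (hp : PowerSeries.constantCoeff p ≠ q0) :
    cauchyKernel q p + rowSeries (PowerSeries.C (q0 - p0)) *
        (rowSeries (q - PowerSeries.C p0)⁻¹ * colSeries (p - PowerSeries.C q0)⁻¹) =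
      rowSeries ((q - PowerSeries.C q0) * (q - PowerSeries.C p0)⁻¹) *
        (colSeries ((p - PowerSeries.C p0) * (p - PowerSeries.C q0)⁻¹) * cauchyKernel q p) := by
  have h0 := cauchyKernel_mul h
  have h1 := congrArg rowSeries (sub_C_mul_inv hq)
  have h2 := congrArg colSeries (sub_C_mul_inv hp)
  simp only [map_mul, map_sub, map_one] at h1 h2 ⊢
  rw [rowSeries_C] at h1
  rw [rowSeries_C, rowSeries_C]
  set r := rowSeries (q - PowerSeries.C p0)⁻¹
  set c := colSeries (p - PowerSeries.C q0)⁻¹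
  set Q := rowSeries q
  set P := colSeries p
  set K := cauchyKernel q p
  set a := colSeries (PowerSeries.C p0)
  set b := colSeries (PowerSeries.C q0)
  linear_combination (-K * (P - b) * c) * h1 - K * h2 + (-(b - a) * r * c) * h0

/-- In the pivot block the factor `q(ε) - q(0)` is divisible by `ε`, which absorbs the index shift
caused by deleting the first row or column. In the other blocks the indices do not move and the
factor stays as it is. -/
theorem coeffTwo_pivotFactor {q p : ι → PowerSeries ℂ} (l a b : ι) (c c' : ℂ) (i j : ℕ)
    (F : PowerSeries (PowerSeries ℂ)) :
    coeffTwo (if a = l then i + 1 else i) (if b = l then j + 1 else j)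
        (rowSeries ((q a - PowerSeries.C (PowerSeries.constantCoeff (q l))) *
            (q a - PowerSeries.C c)⁻¹) *
          (colSeries ((p b - PowerSeries.C (PowerSeries.constantCoeff (p l))) *
            (p b - PowerSeries.C c')⁻¹) * F)) =
      coeffTwo i j (rowSeries (pivotFactor q c l a) * (colSeries (pivotFactor p c' l b) * F)) := by
  have hcol : ∀ i (G : PowerSeries (PowerSeries ℂ)),
      coeffTwo i (if b = l then j + 1 else j)
        (colSeries ((p b - PowerSeries.C (PowerSeries.constantCoeff (p l))) *
            (p b - PowerSeries.C c')⁻¹) * G) =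
      coeffTwo i j (colSeries (pivotFactor p c' l b) * G) := by
    intro i G
    by_cases hb : b = l
    · subst hb
      rw [if_pos rfl, pivotFactor, if_pos rfl, ← X_mul_shiftSeries, mul_assoc, map_mul, mul_assoc,
        coeffTwo_succ_colSeries_X_mul]
    · rw [if_neg hb, pivotFactor, if_neg hb]
  have hrow : ∀ j (G : PowerSeries (PowerSeries ℂ)),
      coeffTwo (if a = l then i + 1 else i) j
        (rowSeries ((q a - PowerSeries.C (PowerSeries.constantCoeff (q l))) *
            (q a - PowerSeries.C c)⁻¹) * G) =
      coeffTwo i j (rowSeries (pivotFactor q c l a) * G) := by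
    intro j G
    by_cases ha : a = l
    · subst ha
      rw [if_pos rfl, pivotFactor, if_pos rfl, ← X_mul_shiftSeries, mul_assoc, map_mul, mul_assoc,
        coeffTwo_succ_rowSeries_X_mul]
    · rw [if_neg ha, pivotFactor, if_neg ha]
  rw [hrow, mul_left_comm, hcol, mul_left_comm]

theorem constantCoeff_shiftSeries (f : PowerSeries ℂ) :
    PowerSeries.constantCoeff (shiftSeries f) = PowerSeries.coeff 1 f := by
  rw [← PowerSeries.coeff_zero_eq_constantCoeff_apply, shiftSeries, PowerSeries.coeff_mk]

theorem constantCoeff_pivotFactor_self (q : ι → PowerSeries ℂ) (c : ℂ) (l : ι) :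
    PowerSeries.constantCoeff (pivotFactor q c l l) =
      PowerSeries.coeff 1 (q l) / (PowerSeries.constantCoeff (q l) - c) := by
  rw [pivotFactor, if_pos rfl, map_mul, PowerSeries.constantCoeff_inv, constantCoeff_shiftSeries,
    map_sub, PowerSeries.constantCoeff_C, div_eq_mul_inv]

theorem constantCoeff_pivotFactor_ne_zero {q : ι → PowerSeries ℂ} {c : ℂ} {l : ι}
    (hc : ∀ a, PowerSeries.constantCoeff (q a) ≠ c)
    (hq : ∀ a, a ≠ l → PowerSeries.constantCoeff (q a) ≠ PowerSeries.constantCoeff (q l))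
    (h1 : PowerSeries.coeff 1 (q l) ≠ 0) (a : ι) :
    PowerSeries.constantCoeff (pivotFactor q c l a) ≠ 0 := by
  by_cases ha : a = l
  · subst ha
    rw [constantCoeff_pivotFactor_self]
    exact div_ne_zero h1 (sub_ne_zero.mpr (hc a))
  · rw [pivotFactor, if_neg ha, map_mul, PowerSeries.constantCoeff_inv, map_sub, map_sub,
      PowerSeries.constantCoeff_C, PowerSeries.constantCoeff_C]
    exact mul_ne_zero (sub_ne_zero.mpr (hq a ha)) (inv_ne_zero (sub_ne_zero.mpr (hc a)))

variable [Fintype ι]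

/-- The determinant of coefficients of Cauchy kernels (a confluent Cauchy determinant). -/
def kernelDet (N : ι → ℕ) (q p : ι → PowerSeries ℂ) : ℂ :=
  (coeffMatrix N fun l m => cauchyKernel (q l) (p m)).det

/-- Elimination of row and column 0 of block `l`. The row and column factors it produces leave the
determinant through their constant terms. -/
theorem kernelDet_succ {q p : ι → PowerSeries ℂ}
    (hqp : ∀ a b, PowerSeries.constantCoeff (q a) ≠ PowerSeries.constantCoeff (p b))
    {N N' : ι → ℕ} {l : ι} (hl : N' l = N l + 1) (hN : ∀ a, a ≠ l → N' a = N a) :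
    kernelDet N' q p =
      (PowerSeries.constantCoeff (q l) - PowerSeries.constantCoeff (p l))⁻¹ *
        ((∏ a, PowerSeries.constantCoeff
            (pivotFactor q (PowerSeries.constantCoeff (p l)) l a) ^ N a) *
          ((∏ a, PowerSeries.constantCoeff
            (pivotFactor p (PowerSeries.constantCoeff (q l)) l a) ^ N a) * kernelDet N q p)) := by
  set q0 := PowerSeries.constantCoeff (q l) with hq0
  set p0 := PowerSeries.constantCoeff (p l) with hp0
  have hc : q0 - p0 ≠ 0 := sub_ne_zero.mpr (hqp l l)
  have hc' : p0 - q0 ≠ 0 := sub_ne_zero.mpr (hqp l l).symm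
  have hpiv : coeffTwo 0 0 (cauchyKernel (q l) (p l)) = (q0 - p0)⁻¹ := by
    rw [coeffTwo_zero_zero, constantCoeff_cauchyKernel (hqp l l), map_neg,
      PowerSeries.constantCoeff_inv, map_sub, PowerSeries.constantCoeff_C, ← hq0, ← hp0]
    field_simp
    ring
  let A : Matrix Unit Unit ℂ := Matrix.of fun _ _ => (q0 - p0)⁻¹
  have hAinv : A * (Matrix.of fun _ _ => q0 - p0) = 1 := by
    ext i j
    simp [A, Matrix.mul_apply, inv_mul_cancel₀ hc]
  let _ : Invertible A := invertibleOfRightInverse _ _ hAinv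
  have hinv : ⅟A = Matrix.of fun _ _ => q0 - p0 := invOf_eq_right_inv hAinv
  have hblocks : (coeffMatrix N' fun l m => cauchyKernel (q l) (p m)).submatrix
      (prependEquiv hl hN) (prependEquiv hl hN) =
      Matrix.fromBlocks A
        (Matrix.of fun _ y => coeffTwo 0 (if y.1 = l then y.2 + 1 else y.2)
          (cauchyKernel (q l) (p y.1)))
        (Matrix.of fun x _ => coeffTwo (if x.1 = l then x.2 + 1 else x.2) 0
          (cauchyKernel (q x.1) (p l)))
        (Matrix.of fun x y => coeffTwo (if x.1 = l then x.2 + 1 else x.2)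
          (if y.1 = l then y.2 + 1 else y.2) (cauchyKernel (q x.1) (p y.1))) := by
    ext (x | x) (y | y)
    · exact hpiv
    · rfl
    · rfl
    · rfl
  have hschur : ∀ B : Matrix Unit ((a : ι) × Fin (N a)) ℂ, ∀ C : Matrix ((a : ι) × Fin (N a)) Unit ℂ,
      ∀ x y, (C * ⅟A * B) x y = (q0 - p0) * (C x () * B () y) := by
    intro B C x y
    rw [hinv, Matrix.mul_apply, Fintype.sum_unique, Matrix.mul_apply, Fintype.sum_unique]
    simp only [Matrix.of_apply]
    change C x () * (q0 - p0) * B () y = _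
    ring
  rw [kernelDet, ← Matrix.det_submatrix_equiv_self (prependEquiv hl hN), hblocks,
    Matrix.det_fromBlocks₁₁, Matrix.det_unique]
  change (q0 - p0)⁻¹ * _ = _
  congr 1
  rw [kernelDet, ← det_coeffMatrix_colSeries_mul, ← det_coeffMatrix_rowSeries_mul]
  congr 1
  ext x y
  rw [Matrix.sub_apply, hschur]
  simp only [coeffMatrix, Matrix.of_apply]
  rw [← coeffTwo_pivotFactor, ← hq0, ← hp0,
    ← cauchyKernel_elimination (hqp x.1 y.1) (hqp x.1 l) (hqp l y.1).symm, coeffTwo_add,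
    coeffTwo_rowSeries_C_mul, coeffTwo_rowSeries_mul_colSeries, coeffTwo_zero_left,
    constantCoeff_cauchyKernel (hqp l y.1), coeffTwo_zero_right,
    map_constantCoeff_cauchyKernel (hqp x.1 l), map_neg]
  ring

/-- Induction on the total size: each elimination step multiplies by nonzero constants, because all
the nodes are distinct and the first-order coefficients do not vanish. -/
theorem kernelDet_ne_zero {q p : ι → PowerSeries ℂ}
    (hqp : ∀ a b, PowerSeries.constantCoeff (q a) ≠ PowerSeries.constantCoeff (p b))
    (hq : ∀ a b, a ≠ b → PowerSeries.constantCoeff (q a) ≠ PowerSeries.constantCoeff (q b))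
    (hp : ∀ a b, a ≠ b → PowerSeries.constantCoeff (p a) ≠ PowerSeries.constantCoeff (p b))
    (hq1 : ∀ a, PowerSeries.coeff 1 (q a) ≠ 0) (hp1 : ∀ a, PowerSeries.coeff 1 (p a) ≠ 0)
    (N : ι → ℕ) : kernelDet N q p ≠ 0 := by
  induction h : ∑ a, N a generalizing N with
  | zero =>
    have h0 : ∀ a, N a = 0 := fun a => by
      simpa using (Finset.sum_eq_zero_iff.mp h) a (Finset.mem_univ a)
    have : IsEmpty ((l : ι) × Fin (N l)) :=
      ⟨fun x => by have := x.2.2; have := h0 x.1; omega⟩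
    rw [kernelDet, Matrix.det_isEmpty]
    exact one_ne_zero
  | succ n ih =>
    obtain ⟨l, hl⟩ : ∃ l, N l ≠ 0 := by
      by_contra! hcon
      simp [hcon] at h
    have hl' : N l = Function.update N l (N l - 1) l + 1 := by
      rw [Function.update_self]; omega
    have hN : ∀ a, a ≠ l → N a = Function.update N l (N l - 1) a := fun a ha => by
      rw [Function.update_of_ne ha]
    have hsum := sum_eq_add_of_eq_except hl' hN
    rw [kernelDet_succ hqp hl' hN]
    refine mul_ne_zero (inv_ne_zero (sub_ne_zero.mpr (hqp l l))) (mul_ne_zero ?_ (mul_ne_zero ?_ ?_))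
    · exact Finset.prod_ne_zero_iff.mpr fun a _ => pow_ne_zero _
        (constantCoeff_pivotFactor_ne_zero (fun a => hqp a l) (fun a ha => hq a l ha) (hq1 l) a)
    · exact Finset.prod_ne_zero_iff.mpr fun a _ => pow_ne_zero _
        (constantCoeff_pivotFactor_ne_zero (fun a => (hqp l a).symm) (fun a ha => hp a l ha)
          (hp1 l) a)
    · exact ih _ (by omega)

/-- The factor gained in one step depends on the sizes only through exponents. Two consecutive
growths of block `l` therefore have ratios that differ exactly by the row and column factors of
block `l` itself. -/
theorem kernelDet_mul_kernelDet {q p : ι → PowerSeries ℂ}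
    (hqp : ∀ a b, PowerSeries.constantCoeff (q a) ≠ PowerSeries.constantCoeff (p b))
    {N₀ N₁ N₂ : ι → ℕ} {l : ι} (hl : N₁ l = N₀ l + 1) (hN : ∀ a, a ≠ l → N₁ a = N₀ a)
    (hl' : N₂ l = N₁ l + 1) (hN' : ∀ a, a ≠ l → N₂ a = N₁ a) :
    kernelDet N₀ q p * kernelDet N₂ q p =
      (PowerSeries.coeff 1 (q l) /
          (PowerSeries.constantCoeff (q l) - PowerSeries.constantCoeff (p l)) *
        (PowerSeries.coeff 1 (p l) /
          (PowerSeries.constantCoeff (p l) - PowerSeries.constantCoeff (q l)))) *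
        kernelDet N₁ q p ^ 2 := by
  have hprod : ∀ f : ι → ℂ, ∏ a, f a ^ N₁ a = f l * ∏ a, f a ^ N₀ a := by
    intro f
    rw [← Finset.mul_prod_erase _ _ (Finset.mem_univ l),
      ← Finset.mul_prod_erase _ (fun a => f a ^ N₀ a) (Finset.mem_univ l), hl,
      Finset.prod_congr rfl fun a ha => by rw [hN a (Finset.ne_of_mem_erase ha)]]
    ring
  have h1 := kernelDet_succ hqp hl hN
  have h2 := kernelDet_succ hqp hl' hN'
  rw [hprod, hprod, constantCoeff_pivotFactor_self, constantCoeff_pivotFactor_self] at h2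
  set Q := ∏ a, PowerSeries.constantCoeff
    (pivotFactor q (PowerSeries.constantCoeff (p l)) l a) ^ N₀ a
  set P := ∏ a, PowerSeries.constantCoeff
    (pivotFactor p (PowerSeries.constantCoeff (q l)) l a) ^ N₀ a
  rw [h2, pow_two]
  nth_rewrite 3 [h1]
  ring

end Recursion

end

end CNLS

/-! ### Bordered determinants, the Cauchy expansion, and `𝐏` for the given spectral data -/

namespace CNLS

noncomputable section

/-- The effect of the Schur complement on linear combinations of the bordering rows and columns. -/
theorem det_fromBlocks_border {m n k : Type*} [Fintype m] [DecidableEq m] [Fintype n]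
    [Fintype k] [DecidableEq k] (M : Matrix m m ℂ) (B : Matrix m n ℂ) (C : Matrix n m ℂ)
    (E : Matrix n n ℂ) (hM : M.det ≠ 0) (a : Matrix k n ℂ) (b : Matrix n k ℂ) :
    (Matrix.fromBlocks M (B * b) (a * C) (a * E * b)).det =
      M.det * (a * (E - C * M⁻¹ * B) * b).det := by
  let _ : Invertible M := Matrix.invertibleOfIsUnitDet M (isUnit_iff_ne_zero.mpr hM)
  rw [Matrix.det_fromBlocks₁₁, Matrix.invOf_eq_nonsing_inv]
  congr 2
  simp only [Matrix.mul_sub, Matrix.sub_mul, Matrix.mul_assoc]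

/-- The expansion of the Cauchy kernel `1 / (Q - P)` in powers of
`(Q - q) (P - p) / ((Q - p) (P - q))`, with remainder. -/
theorem cauchy_eq_geom_sum {S : Type*} [CommRing S] {Q P q p r c e K : S} (hr : (Q - p) * r = 1)
    (hc : (P - q) * c = 1) (he : e * (q - p) = 1) (hK : K * (Q - P) = 1) (M : ℕ) :
    K = e * (∑ v ∈ Finset.range M,
        (q - p) * r * ((Q - q) * r) ^ v * ((p - q) * c * ((P - p) * c) ^ v)) +
      K * ((Q - q) * r * ((P - p) * c)) ^ M := by
  have h1 : ∑ v ∈ Finset.range M,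
        (q - p) * r * ((Q - q) * r) ^ v * ((p - q) * c * ((P - p) * c) ^ v) =
      (q - p) * r * ((p - q) * c) *
        ∑ v ∈ Finset.range M, ((Q - q) * r * ((P - p) * c)) ^ v := by
    rw [Finset.mul_sum]
    refine Finset.sum_congr rfl fun v _ => ?_
    rw [mul_pow (((Q - q) * r))]
    ring
  -- The cross-ratio identity `(Q - p)(P - q) - (Q - q)(P - p) = (p - q)(Q - P)`.
  have h2 : e * ((q - p) * r * ((p - q) * c)) * (Q - P) = 1 - (Q - q) * r * ((P - p) * c) := by
    linear_combination ((Q - P) * (p - q) * r * c) * he + hr + ((Q - p) * r) * hc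
  have h3 := geom_sum_mul_neg ((Q - q) * r * ((P - p) * c)) M
  rw [h1]
  linear_combination (e * ((q - p) * r * ((p - q) * c)) *
    ∑ v ∈ Finset.range M, ((Q - q) * r * ((P - p) * c)) ^ v) * hK - K * h3 -
    K * (∑ v ∈ Finset.range M, ((Q - q) * r * ((P - p) * c)) ^ v) * h2

namespace SpectralData

variable (D : SpectralData)

/-! ### The double roots -/

/-- At a real `χ` the double-root equation would read `1 + (sum of squares) = 0`. -/
theorem chi_im_ne_zero (l : Fin 2) : (D.chi l).im ≠ 0 := by
  intro h
  have hd := D.double_root l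
  have hreal : D.chi l = ((D.chi l).re : ℂ) := by
    apply Complex.ext <;> simp [h]
  change 1 + ∑ i, 1 / (D.chi l + (waveNumber D.b i : ℂ)) ^ 2 = 0 at hd
  rw [hreal] at hd
  have h2 : (1 + ∑ i, 1 / ((D.chi l).re + waveNumber D.b i) ^ 2 : ℝ) = 0 := by
    exact_mod_cast hd
  have h3 : 0 ≤ ∑ i, 1 / ((D.chi l).re + waveNumber D.b i) ^ 2 :=
    Finset.sum_nonneg fun i _ => by positivity
  linarith

theorem chi_add_real_ne_zero (l : Fin 2) (r : ℝ) : D.chi l + (r : ℂ) ≠ 0 := by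
  intro h
  have := congrArg Complex.im h
  simp at this
  exact D.chi_im_ne_zero l this

theorem chi_injective {l m : Fin 2} (h : l ≠ m) : D.chi l ≠ D.chi m := by
  have h1 : D.chi 1 ≠ D.chi 0 := D.chi_ne
  fin_cases l <;> fin_cases m <;> simp at h ⊢
  · exact h1.symm
  · exact h1

theorem chi_ne_conj_chi (l m : Fin 2) : D.chi l ≠ conj (D.chi m) := by
  have h1 : D.chi 1 ≠ conj (D.chi 0) := D.chi_ne_conj
  have h2 : ∀ l, D.chi l ≠ conj (D.chi l) := by
    intro l h
    have := congrArg Complex.im h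
    simp at this
    exact D.chi_im_ne_zero l (by linarith)
  fin_cases l <;> fin_cases m <;> simp only [Fin.zero_eta, Fin.mk_one]
  · exact h2 0
  · intro h
    apply h1
    rw [h, Complex.conj_conj]
  · exact h1
  · exact h2 1

/-- If `χ^{[1]} = 0`, the coefficient of `ε²` in the characteristic equation is `χ^{[2]} (1 + ∑ (χ +
b_i)^{-2}) - 2 λ^{[2]}`. The double-root condition kills the first term, which forces `λ^{[2]} = 0`.
-/
theorem chiOne_ne_zero (l : Fin 2) : D.chiOne l ≠ 0 := by
  intro h1
  have hb : ∀ i, D.chiSeries l + PowerSeries.C (waveNumber D.b i : ℂ) ≠ 0 := by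
    intro i h
    have := congrArg PowerSeries.constantCoeff h
    simp at this
    exact D.chi_add_real_ne_zero l _ this
  have hchar := (mul_eq_zero.mp (D.char_eq l)).resolve_right
    (Finset.prod_ne_zero_iff.mpr fun i _ => hb i)
  have hinv : ∀ i, PowerSeries.coeff 2
      (D.chiSeries l + PowerSeries.C (waveNumber D.b i : ℂ))⁻¹ =
      -(PowerSeries.coeff 2 (D.chiSeries l)) * (1 / (D.chi l + (waveNumber D.b i : ℂ)) ^ 2) := by
    intro i
    have ha := D.chi_add_real_ne_zero l (waveNumber D.b i)
    have hm := PowerSeries.mul_inv_cancel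
      (D.chiSeries l + PowerSeries.C (waveNumber D.b i : ℂ)) (by rw [map_add, PowerSeries.constantCoeff_C]; exact ha)
    set r := (D.chiSeries l + PowerSeries.C (waveNumber D.b i : ℂ))⁻¹
    have c0 : PowerSeries.coeff 0 (D.chiSeries l + PowerSeries.C (waveNumber D.b i : ℂ)) =
        D.chi l + (waveNumber D.b i : ℂ) := by simp [chi]
    have c1 : PowerSeries.coeff 1 (D.chiSeries l + PowerSeries.C (waveNumber D.b i : ℂ)) = 0 := by
      rw [map_add, PowerSeries.coeff_C, if_neg one_ne_zero, add_zero]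
      exact h1
    have c2 : PowerSeries.coeff 2 (D.chiSeries l + PowerSeries.C (waveNumber D.b i : ℂ)) =
        PowerSeries.coeff 2 (D.chiSeries l) := by
      simp
    have m0 := congrArg (PowerSeries.coeff 0) hm
    have m2 := congrArg (PowerSeries.coeff 2) hm
    rw [PowerSeries.coeff_mul, Finset.Nat.sum_antidiagonal_eq_sum_range_succ_mk] at m0 m2
    simp only [Finset.sum_range_succ, Finset.sum_range_zero, Nat.sub_self, Nat.sub_zero, c0, c1, c2,
      PowerSeries.coeff_one] at m0 m2
    simp at m0 m2
    have hr : PowerSeries.constantCoeff r = (D.chi l + (waveNumber D.b i : ℂ))⁻¹ :=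
      eq_inv_of_mul_eq_one_right m0
    rw [hr] at m2
    field_simp at m2 ⊢
    linear_combination m2
  have hc := congrArg (PowerSeries.coeff 2) hchar
  rw [map_sub, map_sub, map_sum, Finset.sum_congr rfl fun i _ => hinv i, ← Finset.mul_sum] at hc
  have hl : PowerSeries.coeff 2 (2 * (PowerSeries.C (D.lam l) +
      PowerSeries.C (D.lamTwo l) * PowerSeries.X ^ 2)) = 2 * D.lamTwo l := by
    rw [two_mul]
    simp [PowerSeries.coeff_C_mul, PowerSeries.coeff_X_pow]
    ring
  rw [hl, map_zero] at hc
  have hd : 1 + ∑ i, 1 / (D.chi l + (waveNumber D.b i : ℂ)) ^ 2 = 0 := D.double_root l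
  apply D.lamTwo_ne l
  linear_combination (-1 / 2) * hc + (1 / 2) * PowerSeries.coeff 2 (D.chiSeries l) * hd

/-! ### The matrix `𝐏` as a matrix of coefficients of Cauchy kernels -/

/-- The power series `χ_l(ε)^*`, for real `ε`. -/
def conjSeries (l : Fin 2) : PowerSeries ℂ := PowerSeries.map (starRingEnd ℂ) (D.chiSeries l)

theorem constantCoeff_conjSeries (l : Fin 2) :
    PowerSeries.constantCoeff (D.conjSeries l) = conj (D.chi l) := by
  rw [conjSeries, ← PowerSeries.coeff_zero_eq_constantCoeff_apply, PowerSeries.coeff_map,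
    PowerSeries.coeff_zero_eq_constantCoeff_apply]
  rfl

theorem coeff_one_conjSeries (l : Fin 2) :
    PowerSeries.coeff 1 (D.conjSeries l) = conj (D.chiOne l) := by
  rw [conjSeries, PowerSeries.coeff_map]
  rfl

/-- The generating function of `S_j(h_1^{[l,m]})`. -/
def hOneSeries (l m : Fin 2) : PowerSeries ℂ :=
  PowerSeries.C (D.chi l - conj (D.chi m)) *
    (D.chiSeries l - PowerSeries.C (conj (D.chi m)))⁻¹

/-- The power series `(χ_l(ε) - χ_l) / (χ_l(ε) - χ_m^*)`. -/
def couplingSeries (l m : Fin 2) : PowerSeries ℂ :=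
  (D.chiSeries l - PowerSeries.C (D.chi l)) *
    (D.chiSeries l - PowerSeries.C (conj (D.chi m)))⁻¹

theorem couplingSeries_eq (l m : Fin 2) :
    D.couplingSeries l m = PowerSeries.X * (shiftSeries (D.chiSeries l) *
      (D.chiSeries l - PowerSeries.C (conj (D.chi m)))⁻¹) := by
  rw [← mul_assoc, X_mul_shiftSeries]
  rfl

/-- The logarithms `h_1`, `h_2` are normalized so that `(C ε)^v exp(h_1 + v h_2)` is this product of
explicit series; the factor `ε^v` accounts for the index `i - v`. -/
theorem coeff_hOneSeries_mul_couplingSeries_pow (l m : Fin 2) {i v : ℕ} (hv : v ≤ i) :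
    PowerSeries.coeff i (D.hOneSeries l m * D.couplingSeries l m ^ v) =
      D.coupling l m ^ v * schur (fun s => D.hOne l m s + (v : ℂ) * D.hTwo l m s) (i - v) := by
  have hc : D.chi l - conj (D.chi m) ≠ 0 := sub_ne_zero.mpr (D.chi_ne_conj_chi l m)
  have h1 := D.chiOne_ne_zero l
  have e1 : schurSeries (fun s => D.hOne l m s) = D.hOneSeries l m := by
    apply schurSeries_logOf
    rw [map_mul, PowerSeries.constantCoeff_inv, PowerSeries.constantCoeff_C, map_sub,
      PowerSeries.constantCoeff_C]
    exact mul_inv_cancel₀ hc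
  have e2 : schurSeries (fun s => D.hTwo l m s) =
      PowerSeries.C ((D.chi l - conj (D.chi m)) / D.chiOne l) * shiftSeries (D.chiSeries l) *
        (D.chiSeries l - PowerSeries.C (conj (D.chi m)))⁻¹ := by
    apply schurSeries_logOf
    have h2 : PowerSeries.constantCoeff (PowerSeries.mk fun i =>
        PowerSeries.coeff (i + 1) (D.chiSeries l)) = D.chiOne l :=
      constantCoeff_shiftSeries (D.chiSeries l)
    rw [map_mul, map_mul, PowerSeries.constantCoeff_inv, map_sub, PowerSeries.constantCoeff_C,
      PowerSeries.constantCoeff_C, h2]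
    change (D.chi l - conj (D.chi m)) / D.chiOne l * D.chiOne l * (D.chi l - conj (D.chi m))⁻¹ = 1
    field_simp
  have e3 : D.hOneSeries l m * D.couplingSeries l m ^ v = PowerSeries.X ^ v *
      (PowerSeries.C (D.coupling l m ^ v) *
        schurSeries (fun s => D.hOne l m s + (v : ℂ) * D.hTwo l m s)) := by
    have e4 : PowerSeries.C (D.coupling l m) *
        PowerSeries.C ((D.chi l - conj (D.chi m)) / D.chiOne l) = 1 := by
      rw [← map_mul, coupling, ← map_one (PowerSeries.C (R := ℂ))]
      congr 1
      field_simp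
    rw [schurSeries_add, schurSeries_natCast_mul, e1, e2, couplingSeries_eq, map_pow, mul_pow,
      mul_pow, mul_pow]
    have e5 := congrArg (· ^ v) e4
    simp only [mul_pow, one_pow] at e5
    linear_combination (-(D.hOneSeries l m * PowerSeries.X ^ v *
      shiftSeries (D.chiSeries l) ^ v *
      ((D.chiSeries l - PowerSeries.C (conj (D.chi m)))⁻¹) ^ v)) * e5
  rw [e3, PowerSeries.coeff_X_pow_mul', if_pos hv, PowerSeries.coeff_C_mul]
  rfl

theorem constantCoeff_conjSeries_ne (l m : Fin 2) :
    PowerSeries.constantCoeff (D.conjSeries l) ≠ PowerSeries.constantCoeff (D.chiSeries m) := by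
  rw [constantCoeff_conjSeries]
  exact (D.chi_ne_conj_chi m l).symm

/-- Expand `1 / (χ_l(ε₁)^* - χ_m(ε₂))` in powers of the product of the two coupling series. Each of
them is divisible by its own variable, so only the powers `v ≤ min i j` reach the coefficient of
`ε₁^i ε₂^j`. -/
theorem coeffTwo_cauchyKernel (l m : Fin 2) (i j : ℕ) :
    coeffTwo i j (cauchyKernel (D.conjSeries l) (D.chiSeries m)) = D.pEntry l m i j := by
  have hml : conj (D.chi l) - D.chi m ≠ 0 := sub_ne_zero.mpr (D.chi_ne_conj_chi m l).symm
  have hCmap : ∀ z : ℂ, PowerSeries.map (starRingEnd ℂ) (PowerSeries.C z) =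
      PowerSeries.C (conj z) := fun z => PowerSeries.map_C _ z
  have hr := congrArg (fun f => rowSeries (PowerSeries.map (starRingEnd ℂ) f))
    (sub_C_mul_inv (f := D.chiSeries l) (D.chi_ne_conj_chi l m))
  have hc := congrArg colSeries (sub_C_mul_inv (f := D.chiSeries m) (D.chi_ne_conj_chi m l))
  simp only [map_mul, map_sub, map_one, hCmap, Complex.conj_conj, rowSeries_C] at hr hc
  have he : colSeries (PowerSeries.C (1 / (conj (D.chi l) - D.chi m))) *
      (colSeries (PowerSeries.C (conj (D.chi l))) - colSeries (PowerSeries.C (D.chi m))) = 1 := by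
    rw [← map_sub, ← map_sub, ← map_mul, ← map_mul, one_div, inv_mul_cancel₀ hml, map_one, map_one]
  have hK := cauchy_eq_geom_sum hr hc he
    (cauchyKernel_mul (D.constantCoeff_conjSeries_ne l m)) (min i j + 1)
  have eTr : rowSeries (PowerSeries.map (starRingEnd ℂ) (D.couplingSeries l m)) =
      (rowSeries (D.conjSeries l) - colSeries (PowerSeries.C (conj (D.chi l)))) *
        rowSeries (PowerSeries.map (starRingEnd ℂ)
          (D.chiSeries l - PowerSeries.C (conj (D.chi m)))⁻¹) := by
    rw [couplingSeries, map_mul, map_mul, map_sub, map_sub, hCmap, rowSeries_C]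
    rfl
  have eTc : colSeries (D.couplingSeries m l) =
      (colSeries (D.chiSeries m) - colSeries (PowerSeries.C (D.chi m))) *
        colSeries (D.chiSeries m - PowerSeries.C (conj (D.chi l)))⁻¹ := by
    rw [couplingSeries, map_mul, map_sub]
  have eHr : rowSeries (PowerSeries.map (starRingEnd ℂ) (D.hOneSeries l m)) =
      (colSeries (PowerSeries.C (conj (D.chi l))) - colSeries (PowerSeries.C (D.chi m))) *
        rowSeries (PowerSeries.map (starRingEnd ℂ)
          (D.chiSeries l - PowerSeries.C (conj (D.chi m)))⁻¹) := by
    rw [hOneSeries, map_mul, map_mul, hCmap, rowSeries_C, map_sub, Complex.conj_conj, map_sub,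
      map_sub]
  have eHc : colSeries (D.hOneSeries m l) =
      (colSeries (PowerSeries.C (D.chi m)) - colSeries (PowerSeries.C (conj (D.chi l)))) *
        colSeries (D.chiSeries m - PowerSeries.C (conj (D.chi l)))⁻¹ := by
    rw [hOneSeries, map_mul, map_sub, map_sub]
  have hrest : coeffTwo i j (cauchyKernel (D.conjSeries l) (D.chiSeries m) *
      (rowSeries (PowerSeries.map (starRingEnd ℂ) (D.couplingSeries l m)) *
        colSeries (D.couplingSeries m l)) ^ (min i j + 1)) = 0 := by
    rcases le_total i j with hij | hij
    · rw [couplingSeries_eq, map_mul (PowerSeries.map (starRingEnd ℂ)),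
        map_mul rowSeries, PowerSeries.map_X, rowSeries_X, min_eq_left hij, mul_assoc, mul_pow,
        mul_left_comm, coeffTwo, PowerSeries.coeff_X_pow_mul', if_neg (by omega), map_zero]
    · rw [couplingSeries_eq D m l, map_mul colSeries, min_eq_right hij, mul_left_comm, mul_pow,
        mul_left_comm, ← map_pow, coeffTwo, colSeries, PowerSeries.coeff_C_mul,
        PowerSeries.coeff_X_pow_mul', if_neg (by omega)]
  change cauchyKernel _ _ = _ * (∑ v ∈ _, _ * ((rowSeries (D.conjSeries l) - _) * _) ^ v * _) +
    _ * ((rowSeries (D.conjSeries l) - _) * _ * _) ^ _ at hK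
  have hcs : PowerSeries.map (starRingEnd ℂ) (D.chiSeries l) = D.conjSeries l := rfl
  rw [← eTr, ← eTc, ← eHr, ← eHc, hcs] at hK
  rw [hK, coeffTwo_add, hrest, add_zero, ← rowSeries_C, coeffTwo_rowSeries_C_mul,
    coeffTwo_sum, pEntry]
  congr 1
  refine Finset.sum_congr rfl fun v hv => ?_
  have hv' : v ≤ min i j := Nat.lt_succ_iff.mp (Finset.mem_range.mp hv)
  rw [← map_pow, ← map_pow, ← map_pow, ← map_mul, ← map_mul, ← map_mul,
    coeffTwo_rowSeries_mul_colSeries, PowerSeries.coeff_map,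
    D.coeff_hOneSeries_mul_couplingSeries_pow l m (hv'.trans (min_le_left _ _)),
    D.coeff_hOneSeries_mul_couplingSeries_pow m l (hv'.trans (min_le_right _ _))]

/-- `𝐏` is anti-Hermitian, because `(χ_l^* - χ_m)^* = -(χ_m^* - χ_l)`. -/
theorem conj_pEntry (l m : Fin 2) (i j : ℕ) : conj (D.pEntry l m i j) = -D.pEntry m l j i := by
  rw [pEntry, pEntry, map_mul, map_sum, min_comm, ← neg_mul]
  congr 1
  · rw [map_div₀, map_one, map_sub, Complex.conj_conj, ← div_neg, neg_sub]
  · refine Finset.sum_congr rfl fun v _ => ?_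
    rw [map_mul, Complex.conj_conj, mul_comm]

/-! ### Minors of `𝐏` -/

variable (N : Fin 2 → ℕ)

theorem pMinor_std_eq_kernelDet :
    D.pMinor N (stdIndex N) (stdIndex N) = kernelDet N D.conjSeries D.chiSeries := by
  rw [pMinor, kernelDet]
  congr 1
  ext p q
  exact (D.coeffTwo_cauchyKernel _ _ _ _).symm

theorem pMinor_std_ne_zero : D.pMinor N (stdIndex N) (stdIndex N) ≠ 0 := by
  rw [pMinor_std_eq_kernelDet]
  apply kernelDet_ne_zero D.constantCoeff_conjSeries_ne
  · intro a b h
    rw [constantCoeff_conjSeries, constantCoeff_conjSeries]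
    exact fun h' => D.chi_injective h ((starRingEnd ℂ).injective h')
  · exact fun a b h => D.chi_injective h
  · intro a
    rw [coeff_one_conjSeries]
    simpa using D.chiOne_ne_zero a
  · exact D.chiOne_ne_zero

theorem conj_pMinor (r s : (l : Fin 2) × Fin (N l) → ℕ) :
    conj (D.pMinor N r s) =
      (-1) ^ Fintype.card ((l : Fin 2) × Fin (N l)) * D.pMinor N s r := by
  rw [pMinor, RingHom.map_det, pMinor, ← Matrix.det_neg, ← Matrix.det_transpose]
  congr 1
  ext p q
  exact D.conj_pEntry _ _ _ _

/-- Conjugation transposes minors up to a sign that depends only on their size and cancels in the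
quotient. The conjugate shift thus belongs to a shifted row. -/
theorem conj_shift (l : Fin 2) :
    conj (D.shift N l) = D.pMinor N (shiftIndex N l) (stdIndex N) /
      D.pMinor N (stdIndex N) (stdIndex N) := by
  rw [shift, map_div₀, conj_pMinor, conj_pMinor]
  exact mul_div_mul_left _ _ (pow_ne_zero _ (by norm_num))

/-- The weights of the indices `N_l` and `N_l + 1` in the last row of the block `l`. -/
def borderWeight (l : Fin 2) (a : Fin 2 → ℂ) (p : (l : Fin 2) × Fin (N l)) (k : Fin 2) : ℂ :=
  if p.1 = l ∧ (p.2 : ℕ) + 1 = N p.1 then a k else if k = 0 then 1 else 0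

/-- The index that belongs to `borderWeight`. -/
def borderIndex (l : Fin 2) (p : (l : Fin 2) × Fin (N l)) (k : Fin 2) : ℕ :=
  if p.1 = l ∧ (p.2 : ℕ) + 1 = N p.1 then p.2 + k else p.2

/-- The determinant of `𝐏` in which the last row and the last column of the block `l` are linear
combinations of the ones with indices `N_l` and `N_l + 1`. -/
def borderDet (l : Fin 2) (a b : Fin 2 → ℂ) : ℂ :=
  Matrix.det (Matrix.of fun p q : (l : Fin 2) × Fin (N l) =>
    ∑ k, ∑ k', borderWeight N l a p k *
      D.pEntry p.1 q.1 (borderIndex N l p k) (borderIndex N l q k') * borderWeight N l b q k')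

theorem pMinor_std_std_eq_borderDet (l : Fin 2) :
    D.pMinor N (stdIndex N) (stdIndex N) = D.borderDet N l ![1, 0] ![1, 0] := by
  rw [pMinor, borderDet]
  congr 1
  ext p q
  simp only [Matrix.of_apply, Fin.sum_univ_two, borderWeight, borderIndex, stdIndex]
  split_ifs <;> simp at *

theorem pMinor_std_shift_eq_borderDet (l : Fin 2) :
    D.pMinor N (stdIndex N) (shiftIndex N l) = D.borderDet N l ![1, 0] ![0, 1] := by
  rw [pMinor, borderDet]
  congr 1
  ext p q
  simp only [Matrix.of_apply, Fin.sum_univ_two, borderWeight, borderIndex, stdIndex, shiftIndex]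
  split_ifs <;> simp at *

theorem pMinor_shift_std_eq_borderDet (l : Fin 2) :
    D.pMinor N (shiftIndex N l) (stdIndex N) = D.borderDet N l ![0, 1] ![1, 0] := by
  rw [pMinor, borderDet]
  congr 1
  ext p q
  simp only [Matrix.of_apply, Fin.sum_univ_two, borderWeight, borderIndex, stdIndex, shiftIndex]
  split_ifs <;> simp at *

/-- Everything reduces to the `2 × 2` Schur complement `S` of the rows and columns `N_l`, `N_l + 1`
(counted from 1) over the remaining ones: `P_0 = |K| S₀₀`, `Δ = S₀₁ / S₀₀`, `Δ^* = S₁₀ / S₀₀`. The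
quadratic relation between three sizes says `det S = |C_{ll}|² S₀₀²`, which is what completes `ab
S₀₀ + a S₀₁ + b S₁₀ + S₁₁` to the stated product. -/
theorem borderDet_eq {l : Fin 2} (hl : N l ≠ 0) (a b : ℂ) :
    D.borderDet N l ![a, 1] ![b, 1] = D.pMinor N (stdIndex N) (stdIndex N) *
      ((a + conj (D.shift N l)) * (b + D.shift N l) +
        conj (D.coupling l l) * D.coupling l l) := by
  -- Three consecutive sizes of block `l`: `N₀`, `N`, `N₂`. The matrix `K` of size `N₀` is the
  -- common core.
  set N₀ := Function.update N l (N l - 1) with hN₀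
  set N₂ := Function.update N l (N l + 1) with hN₂
  have h0 : N₀ l + 1 = N l := by rw [hN₀, Function.update_self]; omega
  have h1 : N l = N₀ l + 1 := h0.symm
  have h1' : ∀ a, a ≠ l → N a = N₀ a := fun a ha => by rw [hN₀, Function.update_of_ne ha]
  have h2 : N₂ l = N l + 1 := by rw [hN₂, Function.update_self]
  have h2' : ∀ a, a ≠ l → N₂ a = N a := fun a ha => by rw [hN₂, Function.update_of_ne ha]
  have h3 : N₂ l = N₀ l + 2 := by omega
  have h3' : ∀ a, a ≠ l → N₂ a = N₀ a := fun a ha => (h2' a ha).trans (h1' a ha)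
  set K := coeffMatrix N₀ (fun l m => cauchyKernel (D.conjSeries l) (D.chiSeries m)) with hK
  have hKdet : K.det ≠ 0 := by
    have := D.pMinor_std_ne_zero N₀
    rwa [pMinor_std_eq_kernelDet] at this
  let B : Matrix ((l : Fin 2) × Fin (N₀ l)) (Fin 2) ℂ :=
    Matrix.of fun p k => D.pEntry p.1 l p.2 (N₀ l + k)
  let C : Matrix (Fin 2) ((l : Fin 2) × Fin (N₀ l)) ℂ :=
    Matrix.of fun k q => D.pEntry l q.1 (N₀ l + k) q.2
  let E : Matrix (Fin 2) (Fin 2) ℂ :=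
    Matrix.of fun k k' => D.pEntry l l (N₀ l + k) (N₀ l + k')
  set S := E - C * K⁻¹ * B with hS
  have hlarge : kernelDet N₂ D.conjSeries D.chiSeries = K.det * S.det := by
    have hb := det_fromBlocks_border K B C E hKdet (1 : Matrix (Fin 2) (Fin 2) ℂ) 1
    simp only [Matrix.one_mul, Matrix.mul_one] at hb
    rw [hS, ← hb, kernelDet, ← Matrix.det_submatrix_equiv_self (appendEquiv h3 h3')]
    congr 1
    ext (x | x) (y | y)
    · rfl
    all_goals exact D.coeffTwo_cauchyKernel _ _ _ _
  -- Only the last index of block `l` is bordered, so the determinant is bilinear in `a`, `b` with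
  -- matrix `|K| S`.
  have hborder : ∀ a b : Fin 2 → ℂ, D.borderDet N l a b =
      K.det * ∑ k, ∑ k', a k * S k k' * b k' := by
    intro a b
    have hb := det_fromBlocks_border K B C E hKdet (Matrix.of fun _ : Fin 1 => a)
      (Matrix.of fun k (_ : Fin 1) => b k)
    have hinl : ∀ p : (l : Fin 2) × Fin (N₀ l),
        ¬((appendEquiv h1 h1' (Sum.inl p)).1 = l ∧
          ((appendEquiv h1 h1' (Sum.inl p)).2 : ℕ) + 1 = N (appendEquiv h1 h1' (Sum.inl p)).1) := by
      rintro p ⟨hp, hp'⟩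
      have e1 : (appendEquiv h1 h1' (Sum.inl p)).1 = p.1 := rfl
      have e2 : ((appendEquiv h1 h1' (Sum.inl p)).2 : ℕ) = p.2 := rfl
      rw [e1] at hp
      have e3 := congrArg N₀ hp
      have e4 := congrArg N hp
      have e5 := p.2.2
      have e6 : N (appendEquiv h1 h1' (Sum.inl p)).1 = N p.1 := rfl
      omega
    have hinr : ∀ p : Fin 1,
        ((appendEquiv h1 h1' (Sum.inr p)).1 = l ∧
          ((appendEquiv h1 h1' (Sum.inr p)).2 : ℕ) + 1 = N (appendEquiv h1 h1' (Sum.inr p)).1) := by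
      intro p
      refine ⟨rfl, ?_⟩
      have e2 : ((appendEquiv h1 h1' (Sum.inr p)).2 : ℕ) = N₀ l + p := rfl
      have e6 : N (appendEquiv h1 h1' (Sum.inr p)).1 = N l := rfl
      omega
    have wl : ∀ (c : Fin 2 → ℂ) p k, borderWeight N l c (appendEquiv h1 h1' (Sum.inl p)) k =
        if k = 0 then 1 else 0 := fun c p k => if_neg (hinl p)
    have wr : ∀ (c : Fin 2 → ℂ) p k, borderWeight N l c (appendEquiv h1 h1' (Sum.inr p)) k =
        c k := fun c p k => if_pos (hinr p)
    have il : ∀ p k, borderIndex N l (appendEquiv h1 h1' (Sum.inl p)) k = p.2 :=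
      fun p k => if_neg (hinl p)
    have ir : ∀ (p : Fin 1) (k : Fin 2),
        borderIndex N l (appendEquiv h1 h1' (Sum.inr p)) k = N₀ l + k := by
      intro p k
      rw [borderIndex, if_pos (hinr p)]
      have e2 : ((appendEquiv h1 h1' (Sum.inr p)).2 : ℕ) = N₀ l + p := rfl
      omega
    have hdet : (Matrix.of (fun _ : Fin 1 => a) * S * Matrix.of fun k (_ : Fin 1) => b k).det =
        ∑ k, ∑ k', a k * S k k' * b k' := by
      rw [Matrix.det_unique, Matrix.mul_apply, Finset.sum_comm]
      simp only [Matrix.mul_apply, Matrix.of_apply, Finset.sum_mul]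
    rw [← hdet, hS, ← hb, borderDet, ← Matrix.det_submatrix_equiv_self (appendEquiv h1 h1')]
    congr 1
    ext (x | x) (y | y)
    · simp only [Matrix.submatrix_apply, Matrix.of_apply, wl, il, Matrix.fromBlocks_apply₁₁]
      simp
      exact (D.coeffTwo_cauchyKernel _ _ _ _).symm
    · simp only [Matrix.submatrix_apply, Matrix.of_apply, wl, il, wr, ir,
        Matrix.fromBlocks_apply₁₂, Matrix.mul_apply]
      simp
      rfl
    · simp only [Matrix.submatrix_apply, Matrix.of_apply, wl, il, wr, ir,
        Matrix.fromBlocks_apply₂₁, Matrix.mul_apply]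
      simp
      rfl
    · simp only [Matrix.submatrix_apply, Matrix.of_apply, wr, ir,
        Matrix.fromBlocks_apply₂₂, Matrix.mul_apply, Finset.sum_mul]
      rw [Finset.sum_comm]
      rfl
  -- With `kernelDet N₂ = |K| det S` and `P_0 = |K| S₀₀` this is `det S = |C_{ll}|² S₀₀²`.
  have hsq := kernelDet_mul_kernelDet D.constantCoeff_conjSeries_ne h1 h1' h2 h2'
  rw [hlarge, constantCoeff_conjSeries, coeff_one_conjSeries] at hsq
  have hK' : kernelDet N₀ D.conjSeries D.chiSeries = K.det := rfl
  have hchi : PowerSeries.constantCoeff (D.chiSeries l) = D.chi l := rfl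
  have hchi1 : PowerSeries.coeff 1 (D.chiSeries l) = D.chiOne l := rfl
  have hcoup : conj (D.coupling l l) * D.coupling l l =
      conj (D.chiOne l) / (conj (D.chi l) - D.chi l) *
        (D.chiOne l / (D.chi l - conj (D.chi l))) := by
    rw [coupling, map_div₀, map_sub, Complex.conj_conj]
  rw [hchi, hchi1, ← hcoup, hK', ← pMinor_std_eq_kernelDet] at hsq
  have hP := D.pMinor_std_ne_zero N
  rw [conj_shift, shift]
  have e00 := D.pMinor_std_std_eq_borderDet N l
  have e01 := D.pMinor_std_shift_eq_borderDet N l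
  have e10 := D.pMinor_shift_std_eq_borderDet N l
  rw [hborder] at e00 e01 e10 ⊢
  rw [Matrix.det_fin_two] at hsq
  simp [Fin.sum_univ_two] at e00 e01 e10 ⊢
  field_simp
  rw [e01, e10]
  rw [e00] at hsq hP ⊢
  have hK0 : K.det ≠ 0 := hKdet
  have hS0 : S 0 0 ≠ 0 := right_ne_zero_of_mul hP
  linear_combination hsq
end SpectralData

end

end CNLS

namespace CNLS

noncomputable section

/-! ### Minors of matrices of Schur polynomials -/

section Minor

variable {R : Type*} [CommRing R] [Algebra ℚ R]

/-- The Schur polynomial `S_{2i+1-r}`, zero if `2i+1 < r`. -/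
def schurRow (x : ℕ → R) (i r : ℕ) : R :=
  if r ≤ 2 * i + 1 then schur x (2 * i + 1 - r) else 0

/-- The minor with columns `s` of the matrix `S_{2i+1-r}(x)`. -/
def schurMinor {n : ℕ} (x : ℕ → R) (s : Fin n → ℕ) : R :=
  Matrix.det (Matrix.of fun i j : Fin n => schurRow x i (s j))

theorem schurMinor_eq_zero_of_eq {n : ℕ} (x : ℕ → R) {s : Fin n → ℕ} {j j' : Fin n} (h : j ≠ j')
    (hs : s j = s j') : schurMinor x s = 0 :=
  Matrix.det_zero_of_column_eq h fun i => by simp [hs]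

theorem map_schurMinor {S : Type*} [CommRing S] [Algebra ℚ S] (f : R →+* S) {n : ℕ} (x : ℕ → R)
    (s : Fin n → ℕ) : f (schurMinor x s) = schurMinor (fun j => f (x j)) s := by
  rw [schurMinor, RingHom.map_det, schurMinor]
  congr 1
  ext i j
  simp only [RingHom.mapMatrix_apply, Matrix.map_apply, Matrix.of_apply, schurRow]
  split_ifs
  · exact map_schur f x _
  · exact map_zero f

/-- Homogeneity of degree `∑ (2i + 1) - ∑ s j`, written without subtraction: scale the columns on
one side and the rows on the other. -/
theorem schurMinor_scale {n : ℕ} (a : R) (x : ℕ → R) (s : Fin n → ℕ) :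
    a ^ (∑ j, s j) * schurMinor (fun j => a ^ j * x j) s =
      a ^ (∑ i : Fin n, (2 * (i : ℕ) + 1)) * schurMinor x s := by
  have h := Matrix.det_mul_row (fun j => a ^ s j)
    (Matrix.of fun i j : Fin n => schurRow (fun j => a ^ j * x j) i (s j))
  have h' := Matrix.det_mul_column (fun i : Fin n => a ^ (2 * (i : ℕ) + 1))
    (Matrix.of fun i j : Fin n => schurRow x i (s j))
  rw [Finset.prod_pow_eq_pow_sum] at h h'
  rw [schurMinor, schurMinor, ← h, ← h']
  congr 1
  ext i j
  simp only [Matrix.of_apply, schurRow]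
  split_ifs with hij
  · rw [schur_scale, ← mul_assoc, ← pow_add, Nat.add_sub_cancel' hij]
  · simp

/-- The odd variables. -/
def oddPart (x : ℕ → R) (j : ℕ) : R := if Odd j then x j else 0

/-- Factor the exponential into its even and odd variables. The even factor only has even powers of
`ε`, and moving by `2(i - k)` leads from row `i` to row `k`. -/
theorem schurRow_eq_sum_oddPart (n : ℕ) (x : ℕ → R) (i : Fin n) (r : ℕ) :
    schurRow x i r = ∑ k : Fin n, (if (k : ℕ) ≤ i then
      schur (fun j => if Odd j then 0 else x j) (2 * (i - k)) else 0) *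
        schurRow (oddPart x) k r := by
  set e : ℕ → R := fun j => if Odd j then 0 else x j with he
  have hx : x = fun j => e j + oddPart x j := by
    ext j
    by_cases h : Odd j <;> simp [he, oddPart, h]
  have hodd : ∀ j, Odd j → e j = 0 := fun j hj => if_pos hj
  rw [← Finset.sum_range (fun k => (if k ≤ (i : ℕ) then schur e (2 * (i - k)) else 0) *
    schurRow (oddPart x) k r)]
  have hsub : Finset.range ((i : ℕ) + 1) ⊆ Finset.range n := Finset.range_subset_range.mpr i.2
  rw [← Finset.sum_subset hsub]
  swap
  · intro a _ ha
    rw [if_neg (by simpa using ha), zero_mul]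
  by_cases hr : r ≤ 2 * (i : ℕ) + 1
  swap
  · rw [schurRow, if_neg hr, eq_comm]
    refine Finset.sum_eq_zero fun k hk => ?_
    have := Finset.mem_range.mp hk
    rw [schurRow, if_neg (show ¬r ≤ 2 * k + 1 by omega), mul_zero]
  rw [schurRow, if_pos hr]
  conv_lhs => rw [hx]
  rw [schur_add, Finset.Nat.sum_antidiagonal_eq_sum_range_succ_mk]
  have hext : ∑ u ∈ Finset.range (2 * (i : ℕ) + 1 - r).succ,
      schur e u * schur (oddPart x) (2 * (i : ℕ) + 1 - r - u) =
      ∑ u ∈ Finset.range (2 * (i : ℕ) + 2), schur e u *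
        if r + u ≤ 2 * (i : ℕ) + 1 then schur (oddPart x) (2 * (i : ℕ) + 1 - r - u) else 0 := by
    rw [← Finset.sum_subset (Finset.range_subset_range.mpr
      (show (2 * (i : ℕ) + 1 - r).succ ≤ 2 * (i : ℕ) + 2 by omega))]
    · refine Finset.sum_congr rfl fun u hu => ?_
      have := Finset.mem_range.mp hu
      rw [if_pos (by omega)]
    · intro u _ hu
      have : ¬u < (2 * (i : ℕ) + 1 - r).succ := fun h => hu (Finset.mem_range.mpr h)
      rw [if_neg (by omega), mul_zero]
  -- The even indices `u = 2(i - k)` are the image of the rows `k`; terms with odd `u` vanish.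
  refine hext.trans (Finset.sum_of_injOn (fun k => 2 * ((i : ℕ) - k)) ?_ ?_ ?_ ?_).symm
  · intro k hk k' hk' h
    have h1 := Finset.mem_range.mp hk
    have h2 := Finset.mem_range.mp hk'
    simp only at h
    omega
  · intro k hk
    have h1 := Finset.mem_range.mp hk
    exact Finset.mem_coe.mpr (Finset.mem_range.mpr (show 2 * ((i : ℕ) - k) < _ by omega))
  · intro u hu h
    have h1 := Finset.mem_range.mp hu
    rcases Nat.even_or_odd' u with ⟨w, rfl | rfl⟩
    · refine absurd ⟨(i : ℕ) - w, ?_, ?_⟩ h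
      · exact Finset.mem_coe.mpr (Finset.mem_range.mpr (by omega))
      · simp only
        omega
    · rw [schur_odd_eq_zero hodd ⟨w, rfl⟩, zero_mul]
  · intro k hk
    have h1 := Finset.mem_range.mp hk
    rw [if_pos (by omega), schurRow]
    congr 1
    by_cases hrk : r ≤ 2 * k + 1
    · rw [if_pos hrk, if_pos (by omega)]
      congr 1
      omega
    · rw [if_neg hrk, if_neg (by omega)]

/-- The even variables amount to unipotent row operations, made possible by the step 2 between rows.
Hence the even components of `x^+` and `h_3` play no role in the asymptotics. -/
theorem schurMinor_oddPart {n : ℕ} (x : ℕ → R) (s : Fin n → ℕ) :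
    schurMinor (oddPart x) s = schurMinor x s := by
  have h : (Matrix.of fun i j : Fin n => schurRow x i (s j)) =
      (Matrix.of fun i k : Fin n => if (k : ℕ) ≤ i then
        schur (fun j => if Odd j then 0 else x j) (2 * (i - k)) else 0) *
      (Matrix.of fun i j : Fin n => schurRow (oddPart x) i (s j)) := by
    ext i j
    rw [Matrix.mul_apply]
    exact schurRow_eq_sum_oddPart n x i (s j)
  have htri : (Matrix.of fun i k : Fin n => if (k : ℕ) ≤ i then
        schur (fun j => if Odd j then 0 else x j) (2 * (i - k)) else 0).det = 1 := by
    rw [Matrix.det_of_isLowerTriangular]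
    · simp [schur_zero]
    · intro i j hij
      have h : i < j := hij
      exact if_neg (by simpa using h)
  rw [schurMinor, schurMinor, h, Matrix.det_mul, htri, one_mul]

end Minor

/-- Cramer's rule for the columns of a rectangular matrix. -/
theorem eq_mul_cramer {n : ℕ} {κ : Type*} (Φ : Matrix (Fin n) κ ℂ) (s : Fin n → κ)
    (h : (Matrix.of fun i j => Φ i (s j)).det ≠ 0) :
    Φ = (Matrix.of fun i j => Φ i (s j)) * Matrix.of fun (j : Fin n) (r : κ) =>
      (Matrix.of fun i j' => Φ i (Function.update s j r j')).det /
        (Matrix.of fun i j => Φ i (s j)).det := by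
  ext i r
  set A : Matrix (Fin n) (Fin n) ℂ := Matrix.of fun i j => Φ i (s j) with hA
  have hc := congrFun (Matrix.mulVec_cramer A (fun i => Φ i r)) i
  have hu : ∀ j, (Matrix.of fun i j' => Φ i (Function.update s j r j')) =
      A.updateCol j (fun i => Φ i r) := by
    intro j
    ext i j'
    by_cases hj : j' = j
    · subst hj
      simp
    · simp [hj, hA]
  rw [Matrix.mul_apply]
  simp only [Matrix.of_apply, hu, ← Matrix.cramer_apply]
  rw [Matrix.mulVec, dotProduct, Pi.smul_apply, smul_eq_mul] at hc
  rw [← mul_right_inj' h, ← hc, Finset.mul_sum]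
  refine Finset.sum_congr rfl fun j _ => ?_
  field_simp

/-! ### Factorization of `τ^{(k)}` through `𝐏` -/

namespace SpectralData

variable (D : SpectralData)

/-- The matrix `𝐏_{ml}` in the factorization of `𝐏`. -/
def pFactor (l m : Fin 2) (v a : ℕ) : ℂ :=
  if v ≤ a then
    D.coupling l m ^ v * schur (fun s => D.hOne l m s + (v : ℂ) * D.hTwo l m s) (a - v)
  else 0

theorem pEntry_eq_sum_pFactor (l m : Fin 2) {a b M : ℕ} (hM : min a b < M) :
    D.pEntry l m a b = 1 / (conj (D.chi l) - D.chi m) *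
      ∑ v ∈ Finset.range M, conj (D.pFactor l m v a) * D.pFactor m l v b := by
  rw [pEntry]
  congr 1
  rw [← Finset.sum_subset (Finset.range_subset_range.mpr hM)]
  · refine Finset.sum_congr rfl fun v hv => ?_
    have hv' := Finset.mem_range.mp hv
    rw [pFactor, pFactor, if_pos (by omega), if_pos (by omega)]
  · intro v _ hv
    have hv' : ¬v < min a b + 1 := fun h => hv (Finset.mem_range.mpr h)
    rcases le_total a b with hab | hab
    · rw [pFactor, if_neg (by omega), map_zero, zero_mul]
    · rw [pFactor, pFactor, if_neg (show ¬v ≤ b by omega), mul_zero]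

/-- The addition formula: multiplying a row of Schur polynomials in `y` by a row `v` of `𝐏_{lm}`
adds `h_1 + v h_2` to `y`. -/
theorem sum_schurRow_mul_pFactor (l m : Fin 2) (y : ℕ → ℂ) {n i : ℕ} (hi : i < n) (v : ℕ) :
    ∑ a : Fin (2 * n), schurRow y i a * D.pFactor l m v a =
      if v ≤ 2 * i + 1 then D.coupling l m ^ v *
        schur (fun s => y s + D.hOne l m s + (v : ℂ) * D.hTwo l m s) (2 * i + 1 - v) else 0 := by
  rw [← Finset.sum_range (fun a => schurRow y i a * D.pFactor l m v a)]
  split_ifs with hv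
  · have e : (fun s => y s + D.hOne l m s + (v : ℂ) * D.hTwo l m s) =
        fun s => (D.hOne l m s + (v : ℂ) * D.hTwo l m s) + y s := by
      ext s
      ring
    have h2 : 2 * n = v + (2 * i + 1 - v + 1) + (2 * n - (2 * i + 2)) := by omega
    rw [e, schur_add, Finset.Nat.sum_antidiagonal_eq_sum_range_succ_mk, Finset.mul_sum, h2,
      Finset.sum_range_add, Finset.sum_range_add]
    rw [Finset.sum_eq_zero (s := Finset.range v), zero_add,
      Finset.sum_eq_zero (s := Finset.range (2 * n - (2 * i + 2))), add_zero]
    · refine Finset.sum_congr rfl fun a ha => ?_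
      have ha' := Finset.mem_range.mp ha
      rw [schurRow, if_pos (by omega), pFactor, if_pos (by omega), Nat.add_sub_cancel_left,
        show 2 * i + 1 - (v + a) = 2 * i + 1 - v - a by omega]
      ring
    · intro a _
      rw [schurRow, if_neg (by omega), zero_mul]
    · intro a ha
      have ha' := Finset.mem_range.mp ha
      rw [pFactor, if_neg (by omega), mul_zero]
  · refine Finset.sum_eq_zero fun a _ => ?_
    by_cases ha : a ≤ 2 * i + 1
    · rw [pFactor, if_neg (by omega), mul_zero]
    · rw [schurRow, if_neg ha, zero_mul]

variable (N : Fin 2 → ℕ) (d : Fin 2 → ℕ → ℂ) (k : Option (Fin 2)) (x t : ℝ)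

/-- The variables of `τ^{(k)}` that belong to the columns. -/
def plusVars (l : Fin 2) (s : ℕ) : ℂ := D.xPlus d l x t s + D.hThree l k s

/-- The complex conjugates of the variables of `τ^{(k)}` that belong to the rows. -/
def minusVars (l : Fin 2) (s : ℕ) : ℂ := D.xPlus d l x t s - D.hThree l k s

theorem tauEntry_eq_sum {l m : Fin 2} {i j : ℕ} (hi : i < N l) (hj : j < N m) :
    D.tauEntry d k x t l m (2 * i + 1) (2 * j + 1) =
      ∑ a : Fin (2 * N l), ∑ b : Fin (2 * N m),
        conj (schurRow (D.minusVars d k x t l) i a) * D.pEntry l m a b *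
          schurRow (D.plusVars d k x t m) j b := by
  -- The common range for `v`: an entry of row `2i + 1` with `i < N_l` needs only `v ≤ 2i + 1 < 2
  -- N_l`.
  set M := 2 * N l with hM
  have e1 : ∀ (a : Fin (2 * N l)) (b : Fin (2 * N m)), D.pEntry l m a b =
      1 / (conj (D.chi l) - D.chi m) *
      ∑ v ∈ Finset.range M, conj (D.pFactor l m v a) * D.pFactor m l v b :=
    fun a b => D.pEntry_eq_sum_pFactor l m (lt_of_le_of_lt (min_le_left _ _) a.2)
  calc D.tauEntry d k x t l m (2 * i + 1) (2 * j + 1)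
      = 1 / (conj (D.chi l) - D.chi m) * ∑ v ∈ Finset.range M,
          conj (∑ a : Fin (2 * N l), schurRow (D.minusVars d k x t l) i a * D.pFactor l m v a) *
          (∑ b : Fin (2 * N m), schurRow (D.plusVars d k x t m) j b * D.pFactor m l v b) := by
        rw [tauEntry]
        congr 1
        have hsub : Finset.range (min (2 * i + 1) (2 * j + 1) + 1) ⊆ Finset.range M :=
          Finset.range_subset_range.mpr (by omega)
        rw [← Finset.sum_subset hsub]
        · refine Finset.sum_congr rfl fun v hv => ?_
          have hv' := Finset.mem_range.mp hv
          rw [D.sum_schurRow_mul_pFactor l m _ hi, D.sum_schurRow_mul_pFactor m l _ hj,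
            if_pos (by omega), if_pos (by omega), map_mul, conj_schur, map_pow, mul_pow]
          have f1 : (fun s => conj (D.xPlus d l x t s) + conj (D.hOne l m s) +
                (v : ℂ) * conj (D.hTwo l m s) - conj (D.hThree l k s)) =
              fun s => conj (D.minusVars d k x t l s + D.hOne l m s + (v : ℂ) * D.hTwo l m s) := by
            ext s
            simp only [minusVars, map_add, map_sub, map_mul, map_natCast]
            ring
          have f2 : (fun s => D.xPlus d m x t s + D.hOne m l s +
                (v : ℂ) * D.hTwo m l s + D.hThree m k s) =
              fun s => D.plusVars d k x t m s + D.hOne m l s + (v : ℂ) * D.hTwo m l s := by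
            ext s
            simp only [plusVars]
            ring
          rw [f1, f2]
          ring
        · intro v _ hv
          have hv' : ¬v < min (2 * i + 1) (2 * j + 1) + 1 := fun h => hv (Finset.mem_range.mpr h)
          rw [D.sum_schurRow_mul_pFactor l m _ hi, D.sum_schurRow_mul_pFactor m l _ hj]
          rcases le_total i j with hij | hij
          · rw [if_neg (by omega), map_zero, zero_mul]
          · rw [if_neg (show ¬v ≤ 2 * j + 1 by omega), mul_zero]
    _ = _ := by
        simp only [e1, map_sum, map_mul, Finset.sum_mul, Finset.mul_sum]
        rw [Finset.sum_comm]
        conv_lhs => enter [2, b]; rw [Finset.sum_comm]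
        rw [Finset.sum_comm]
        refine Finset.sum_congr rfl fun a _ => Finset.sum_congr rfl fun b _ =>
          Finset.sum_congr rfl fun v _ => ?_
        ring

/-- The determinant `|Y^† 𝐏 Z|` for block diagonal `Y^†` and `Z`. -/
def sandwichDet (Y Z : (l : Fin 2) → Fin (N l) → ℕ → ℂ) : ℂ :=
  Matrix.det (Matrix.of fun p q : (l : Fin 2) × Fin (N l) =>
    ∑ a : Fin (2 * N p.1), ∑ b : Fin (2 * N q.1),
      conj (Y p.1 p.2 a) * D.pEntry p.1 q.1 a b * Z q.1 q.2 b)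

theorem tau_eq_sandwichDet : D.tau N d k x t =
    D.sandwichDet N (fun l i a => schurRow (D.minusVars d k x t l) i a)
      (fun l i a => schurRow (D.plusVars d k x t l) i a) := by
  rw [tau, sandwichDet]
  congr 1
  ext p q
  exact D.tauEntry_eq_sum N d k x t p.2.2 q.2.2

theorem sandwichDet_eq_det_mul (Y Z : (l : Fin 2) → Fin (N l) → ℕ → ℂ) :
    D.sandwichDet N Y Z =
      (Matrix.blockDiagonal' (fun l => Matrix.of fun (i : Fin (N l)) (a : Fin (2 * N l)) =>
          conj (Y l i a)) *
        (Matrix.of fun p q : (l : Fin 2) × Fin (2 * N l) => D.pEntry p.1 q.1 p.2 q.2) *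
        (Matrix.blockDiagonal' (fun l => Matrix.of fun (i : Fin (N l)) (a : Fin (2 * N l)) =>
          Z l i a)).transpose).det := by
  rw [sandwichDet]
  congr 1
  ext p q
  rw [mul_blockDiagonal'_transpose_apply]
  simp only [blockDiagonal'_mul_apply, Matrix.of_apply, Finset.mul_sum]
  rw [Finset.sum_comm]
  refine Finset.sum_congr rfl fun b _ => Finset.sum_congr rfl fun a _ => ?_
  ring

theorem sandwichDet_mul (A B : (l : Fin 2) → Matrix (Fin (N l)) (Fin (N l)) ℂ)
    (Y Z : (l : Fin 2) → Fin (N l) → ℕ → ℂ) :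
    D.sandwichDet N (fun l i a => ∑ j, A l i j * Y l j a) (fun l i a => ∑ j, B l i j * Z l j a) =
      (∏ l, conj (A l).det) * (∏ l, (B l).det) * D.sandwichDet N Y Z := by
  rw [sandwichDet_eq_det_mul, sandwichDet_eq_det_mul]
  have h1 : Matrix.blockDiagonal' (fun l => Matrix.of fun (i : Fin (N l)) (a : Fin (2 * N l)) =>
        conj (∑ j, A l i j * Y l j a)) =
      Matrix.blockDiagonal' (fun l => (starRingEnd ℂ).mapMatrix (A l)) *
        Matrix.blockDiagonal' (fun l => Matrix.of fun (i : Fin (N l)) (a : Fin (2 * N l)) =>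
          conj (Y l i a)) := by
    rw [← Matrix.blockDiagonal'_mul]
    congr 1
    ext l i a
    simp [Matrix.mul_apply]
  have h2 : Matrix.blockDiagonal' (fun l => Matrix.of fun (i : Fin (N l)) (a : Fin (2 * N l)) =>
        (∑ j, B l i j * Z l j a)) =
      Matrix.blockDiagonal' (fun l => B l) *
        Matrix.blockDiagonal' (fun l => Matrix.of fun (i : Fin (N l)) (a : Fin (2 * N l)) =>
          Z l i a) := by
    rw [← Matrix.blockDiagonal'_mul]
    congr 1
  rw [h1, h2, Matrix.transpose_mul, ← Matrix.mul_assoc, Matrix.det_mul, Matrix.mul_assoc,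
    Matrix.mul_assoc, Matrix.det_mul, ← Matrix.mul_assoc, det_blockDiagonal', Matrix.det_transpose,
    det_blockDiagonal']
  simp only [RingHom.map_det]
  ring

/-- The quotients of minors in Cramer's rule with the pivot columns `s`. -/
def cramerRow {n : ℕ} (y : ℕ → ℂ) (s : Fin n → ℕ) (j : Fin n) (r : ℕ) : ℂ :=
  schurMinor y (Function.update s j r) / schurMinor y s

/-- Each block of rows is its square pivot submatrix times the rows of Cramer's rule. The square
factors leave the determinant on both sides; what remains is bounded and has a limit in each regime.
-/
theorem tau_eq_mul_sandwichDet (s : (l : Fin 2) → Fin (N l) → ℕ)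
    (hminus : ∀ l, schurMinor (D.minusVars d k x t l) (s l) ≠ 0)
    (hplus : ∀ l, schurMinor (D.plusVars d k x t l) (s l) ≠ 0) :
    D.tau N d k x t =
      (∏ l, conj (schurMinor (D.minusVars d k x t l) (s l))) *
        (∏ l, schurMinor (D.plusVars d k x t l) (s l)) *
        D.sandwichDet N (fun l => cramerRow (D.minusVars d k x t l) (s l))
          (fun l => cramerRow (D.plusVars d k x t l) (s l)) := by
  have key : ∀ (y : Fin 2 → ℕ → ℂ), (∀ l, schurMinor (y l) (s l) ≠ 0) →
      (fun (l : Fin 2) (i : Fin (N l)) (a : ℕ) => schurRow (y l) i a) =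
        fun l i a => ∑ j, (Matrix.of fun i j : Fin (N l) => schurRow (y l) i (s l j)) i j *
          cramerRow (y l) (s l) j a := by
    intro y hy
    ext l i a
    have h := eq_mul_cramer (Matrix.of fun (i : Fin (N l)) (a : ℕ) => schurRow (y l) i a) (s l)
      (hy l)
    have h' := congrFun (congrFun h i) a
    rw [Matrix.mul_apply] at h'
    exact h'
  rw [tau_eq_sandwichDet, key _ hminus, key _ hplus, sandwichDet_mul]
  rfl

/-- The rows that are left in the limit: unit rows, except that the last row of the block `l` is a
combination of the unit rows with the indices `N_l` and `N_l + 1`. -/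
def limitRow (l : Fin 2) (c : Fin 2 → ℂ) (m : Fin 2) (i : Fin (N m)) (r : ℕ) : ℂ :=
  ∑ k, if r = borderIndex N l ⟨m, i⟩ k then borderWeight N l c ⟨m, i⟩ k else 0

/-- The shifted index, `N_l` when counted from 0, still lies among the `2 N_l` columns, since a
block that contains an index is nonempty. -/
theorem borderIndex_lt (l : Fin 2) (p : (l : Fin 2) × Fin (N l)) (k : Fin 2) :
    borderIndex N l p k < 2 * N p.1 := by
  have := p.2.2
  have := k.2
  rw [borderIndex]
  split_ifs <;> omega

theorem sandwichDet_limitRow (l : Fin 2) (c c' : Fin 2 → ℂ) :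
    D.sandwichDet N (limitRow N l c) (limitRow N l c') =
      D.borderDet N l (fun k => conj (c k)) c' := by
  have hsum : ∀ (c : Fin 2 → ℂ) (p : (l : Fin 2) × Fin (N l)) (g : ℕ → ℂ),
      ∑ a : Fin (2 * N p.1), limitRow N l c p.1 p.2 a * g a =
        ∑ k, borderWeight N l c p k * g (borderIndex N l p k) := by
    intro c p g
    simp only [limitRow, Finset.sum_mul]
    rw [Finset.sum_comm]
    refine Finset.sum_congr rfl fun k _ => ?_
    rw [Finset.sum_eq_single ⟨borderIndex N l p k, borderIndex_lt N l p k⟩]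
    · simp
    · intro b _ hb
      rw [if_neg, zero_mul]
      exact fun h => hb (Fin.ext h)
    · exact fun h => absurd (Finset.mem_univ _) h
  have hconj : ∀ m i r, conj (limitRow N l c m i r) = limitRow N l (fun k => conj (c k)) m i r := by
    intro m i r
    rw [limitRow, limitRow, map_sum]
    refine Finset.sum_congr rfl fun k _ => ?_
    simp only [borderWeight]
    split_ifs <;> simp
  rw [sandwichDet, borderDet]
  congr 1
  ext p q
  simp only [Matrix.of_apply]
  have h1 : ∀ a : Fin (2 * N p.1), ∑ b : Fin (2 * N q.1),
      conj (limitRow N l c p.1 p.2 a) * D.pEntry p.1 q.1 a b * limitRow N l c' q.1 q.2 b =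
      limitRow N l (fun k => conj (c k)) p.1 p.2 a *
        ∑ k', borderWeight N l c' q k' * D.pEntry p.1 q.1 a (borderIndex N l q k') := by
    intro a
    rw [← hsum c' q (fun b => D.pEntry p.1 q.1 a b), hconj, Finset.mul_sum]
    refine Finset.sum_congr rfl fun b _ => ?_
    ring
  rw [Finset.sum_congr rfl fun a _ => h1 a,
    hsum (fun k => conj (c k)) p (fun a => ∑ k', borderWeight N l c' q k' *
      D.pEntry p.1 q.1 a (borderIndex N l q k'))]
  refine Finset.sum_congr rfl fun k _ => ?_
  rw [Finset.mul_sum]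
  refine Finset.sum_congr rfl fun k' _ => ?_
  ring

end SpectralData

end

end CNLS

namespace CNLS

noncomputable section

/-! ### Bounded functions that agree up to a small error -/

section CloseTo

open Asymptotics

variable {Ω : Type*} {ℓ : Filter Ω} {δ : Ω → ℝ}

/-- Two bounded functions that differ by `O(δ)`. -/
structure CloseTo (ℓ : Filter Ω) (δ : Ω → ℝ) (f g : Ω → ℂ) : Prop where
  left : f =O[ℓ] (fun _ => (1 : ℝ))
  right : g =O[ℓ] (fun _ => (1 : ℝ))
  sub : (fun ω => f ω - g ω) =O[ℓ] δ

namespace CloseTo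

variable {f g f' g' : Ω → ℂ}

theorem self (hf : f =O[ℓ] (fun _ => (1 : ℝ))) : CloseTo ℓ δ f f :=
  ⟨hf, hf, by simpa using isBigO_zero δ ℓ⟩

theorem const (c : ℂ) : CloseTo ℓ δ (fun _ => c) (fun _ => c) :=
  self (isBigO_const_const c one_ne_zero ℓ)

theorem of_sub (hδ : δ =O[ℓ] (fun _ => (1 : ℝ))) (hg : g =O[ℓ] (fun _ => (1 : ℝ)))
    (h : (fun ω => f ω - g ω) =O[ℓ] δ) : CloseTo ℓ δ f g :=
  ⟨by simpa using (h.trans hδ).add hg, hg, h⟩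

theorem mono {δ' : Ω → ℝ} (h : CloseTo ℓ δ f g) (hδ : δ =O[ℓ] δ') : CloseTo ℓ δ' f g :=
  ⟨h.left, h.right, h.sub.trans hδ⟩

theorem congr_left (h : CloseTo ℓ δ f g) (hf : f =ᶠ[ℓ] f') : CloseTo ℓ δ f' g :=
  ⟨h.left.congr' hf EventuallyEq.rfl, h.right,
    h.sub.congr' (hf.mono fun ω hω => by simp only [hω]) EventuallyEq.rfl⟩

theorem congr_right (h : CloseTo ℓ δ f g) (hg : g =ᶠ[ℓ] g') : CloseTo ℓ δ f g' :=
  ⟨h.left, h.right.congr' hg EventuallyEq.rfl,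
    h.sub.congr' (hg.mono fun ω hω => by simp only [hω]) EventuallyEq.rfl⟩

theorem trans {k : Ω → ℂ} (h : CloseTo ℓ δ f g) (h' : CloseTo ℓ δ g k) : CloseTo ℓ δ f k :=
  ⟨h.left, h'.right, by simpa using h.sub.add h'.sub⟩

theorem add (h : CloseTo ℓ δ f g) (h' : CloseTo ℓ δ f' g') :
    CloseTo ℓ δ (fun ω => f ω + f' ω) (fun ω => g ω + g' ω) :=
  ⟨h.left.add h'.left, h.right.add h'.right,
    (h.sub.add h'.sub).congr_left fun ω => by ring⟩

theorem mul (h : CloseTo ℓ δ f g) (h' : CloseTo ℓ δ f' g') :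
    CloseTo ℓ δ (fun ω => f ω * f' ω) (fun ω => g ω * g' ω) := by
  refine ⟨by simpa using h.left.mul h'.left, by simpa using h.right.mul h'.right, ?_⟩
  have h1 : (fun ω => (f ω - g ω) * f' ω) =O[ℓ] δ := by simpa using h.sub.mul h'.left
  have h2 : (fun ω => g ω * (f' ω - g' ω)) =O[ℓ] δ := by simpa using h.right.mul h'.sub
  exact (h1.add h2).congr_left fun ω => by ring

theorem sum {ι : Type*} (s : Finset ι) {F G : ι → Ω → ℂ} (h : ∀ i ∈ s, CloseTo ℓ δ (F i) (G i)) :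
    CloseTo ℓ δ (fun ω => ∑ i ∈ s, F i ω) (fun ω => ∑ i ∈ s, G i ω) := by
  classical
  induction s using Finset.induction_on with
  | empty => simpa using const (ℓ := ℓ) (δ := δ) 0
  | insert a s ha ih =>
    simp only [Finset.sum_insert ha]
    exact (h a (Finset.mem_insert_self _ _)).add
      (ih fun i hi => h i (Finset.mem_insert_of_mem hi))

theorem prod {ι : Type*} (s : Finset ι) {F G : ι → Ω → ℂ} (h : ∀ i ∈ s, CloseTo ℓ δ (F i) (G i)) :
    CloseTo ℓ δ (fun ω => ∏ i ∈ s, F i ω) (fun ω => ∏ i ∈ s, G i ω) := by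
  classical
  induction s using Finset.induction_on with
  | empty => simpa using const (ℓ := ℓ) (δ := δ) 1
  | insert a s ha ih =>
    simp only [Finset.prod_insert ha]
    exact (h a (Finset.mem_insert_self _ _)).mul
      (ih fun i hi => h i (Finset.mem_insert_of_mem hi))

theorem det {n : Type*} [Fintype n] [DecidableEq n] {F G : n → n → Ω → ℂ}
    (h : ∀ i j, CloseTo ℓ δ (F i j) (G i j)) :
    CloseTo ℓ δ (fun ω => Matrix.det (Matrix.of fun i j => F i j ω))
      (fun ω => Matrix.det (Matrix.of fun i j => G i j ω)) := by
  simp only [Matrix.det_apply']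
  refine sum _ fun σ _ => (const _).mul (prod _ fun i _ => ?_)
  exact h (σ i) i

theorem starRingEnd (h : CloseTo ℓ δ f g) :
    CloseTo ℓ δ (fun ω => (_root_.starRingEnd ℂ) (f ω)) (fun ω => (_root_.starRingEnd ℂ) (g ω)) := by
  refine ⟨?_, ?_, ?_⟩
  · exact (IsBigO.of_norm_left (by simpa using h.left.norm_left))
  · exact (IsBigO.of_norm_left (by simpa using h.right.norm_left))
  · refine IsBigO.of_norm_left ?_
    simp only [← map_sub, RCLike.norm_conj]
    exact h.sub.norm_left

theorem eventually_le_norm (h : CloseTo ℓ δ f g) (hδ : Tendsto δ ℓ (nhds 0)) {c : ℝ} (hc : 0 < c)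
    (hg : ∀ᶠ ω in ℓ, c ≤ ‖g ω‖) : ∀ᶠ ω in ℓ, c / 2 ≤ ‖f ω‖ := by
  have h1 : Tendsto (fun ω => f ω - g ω) ℓ (nhds 0) := h.sub.trans_tendsto hδ
  have h2 := (tendsto_zero_iff_norm_tendsto_zero.mp h1).eventually (gt_mem_nhds (half_pos hc))
  filter_upwards [h2, hg] with ω h3 h4
  have h5 : ‖g ω‖ ≤ ‖f ω‖ + ‖f ω - g ω‖ := by
    rw [norm_sub_rev]
    simpa using norm_add_le (f ω) (g ω - f ω)
  linarith

theorem isBigO_inv {c : ℝ} (hc : 0 < c) (hg : ∀ᶠ ω in ℓ, c ≤ ‖g ω‖) :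
    (fun ω => (g ω)⁻¹) =O[ℓ] (fun _ => (1 : ℝ)) := by
  refine IsBigO.of_bound c⁻¹ (hg.mono fun ω h => ?_)
  rw [norm_inv, norm_one, mul_one]
  exact inv_anti₀ hc h

theorem inv (h : CloseTo ℓ δ f g) (hδ : Tendsto δ ℓ (nhds 0)) {c : ℝ} (hc : 0 < c)
    (hg : ∀ᶠ ω in ℓ, c ≤ ‖g ω‖) :
    CloseTo ℓ δ (fun ω => (f ω)⁻¹) (fun ω => (g ω)⁻¹) := by
  have hf := h.eventually_le_norm hδ hc hg
  have h1 := isBigO_inv (half_pos hc) hf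
  have h2 := isBigO_inv hc hg
  refine ⟨h1, h2, ?_⟩
  have h3 : (fun ω => (f ω - g ω) * ((f ω)⁻¹ * (g ω)⁻¹)) =O[ℓ] δ := by
    simpa using h.sub.mul (h1.mul h2)
  refine (h3.neg_left).congr' ?_ EventuallyEq.rfl
  filter_upwards [hf, hg] with ω hf' hg'
  have e1 : f ω ≠ 0 := norm_pos_iff.mp (by linarith)
  have e2 : g ω ≠ 0 := norm_pos_iff.mp (by linarith)
  field_simp
  ring

theorem div (h : CloseTo ℓ δ f g) (h' : CloseTo ℓ δ f' g') (hδ : Tendsto δ ℓ (nhds 0)) {c : ℝ}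
    (hc : 0 < c) (hg : ∀ᶠ ω in ℓ, c ≤ ‖g' ω‖) :
    CloseTo ℓ δ (fun ω => f ω / f' ω) (fun ω => g ω / g' ω) := by
  simp only [div_eq_mul_inv]
  exact h.mul (h'.inv hδ hc hg)

/-- Induction along the recurrence, so no explicit formula for Schur polynomials is needed. -/
theorem schur {y z : Ω → ℕ → ℂ} (h : ∀ j, 1 ≤ j → CloseTo ℓ δ (fun ω => y ω j) (fun ω => z ω j))
    (n : ℕ) : CloseTo ℓ δ (fun ω => CNLS.schur (y ω) n) (fun ω => CNLS.schur (z ω) n) := by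
  induction n using Nat.strong_induction_on with
  | _ n ih =>
    cases n with
    | zero =>
      simp only [schur_zero]
      exact const 1
    | succ n =>
      have e : ∀ y : ℕ → ℂ, CNLS.schur y (n + 1) = ((n : ℂ) + 1)⁻¹ *
          ∑ p ∈ Finset.HasAntidiagonal.antidiagonal n,
            ((p.1 : ℂ) + 1) * y (p.1 + 1) * CNLS.schur y p.2 := by
        intro y
        rw [← schur_succ, inv_mul_cancel_left₀ (Nat.cast_add_one_ne_zero n)]
      simp only [e]
      refine (const _).mul (sum _ fun p hp => ?_)
      refine ((const _).mul (h _ (Nat.succ_pos _))).mul (ih p.2 ?_)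
      have := Finset.HasAntidiagonal.mem_antidiagonal.mp hp
      omega

theorem schurMinor {y z : Ω → ℕ → ℂ}
    (h : ∀ j, 1 ≤ j → CloseTo ℓ δ (fun ω => y ω j) (fun ω => z ω j)) {n : ℕ} (s : Fin n → ℕ) :
    CloseTo ℓ δ (fun ω => CNLS.schurMinor (y ω) s) (fun ω => CNLS.schurMinor (z ω) s) := by
  refine det fun i j => ?_
  simp only [schurRow]
  split_ifs
  · exact schur h _
  · exact const 0

end CloseTo

end CloseTo

/-! ### From the asymptotics of Schur minors to those of `τ^{(k)}` -/

namespace SpectralData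

variable (D : SpectralData) {Ω : Type*} {ℓ : Filter Ω} {δ : Ω → ℝ}

theorem closeTo_sandwichDet (N : Fin 2 → ℕ) {Y Z Y' Z' : Ω → (l : Fin 2) → Fin (N l) → ℕ → ℂ}
    (hY : ∀ l i r, CloseTo ℓ δ (fun ω => Y ω l i r) (fun ω => Y' ω l i r))
    (hZ : ∀ l i r, CloseTo ℓ δ (fun ω => Z ω l i r) (fun ω => Z' ω l i r)) :
    CloseTo ℓ δ (fun ω => D.sandwichDet N (Y ω) (Z ω))
      (fun ω => D.sandwichDet N (Y' ω) (Z' ω)) := by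
  refine CloseTo.det fun p q => CloseTo.sum _ fun a _ => CloseTo.sum _ fun b _ => ?_
  exact ((hY _ _ _).starRingEnd.mul (CloseTo.const _)).mul (hZ _ _ _)

/-- The asymptotics of `τ^{(k)}`, from the asymptotics of the minors of the matrices of Schur
polynomials, with normalizing factors `c`. -/
theorem closeTo_tau (N : Fin 2 → ℕ) (d : Ω → Fin 2 → ℕ → ℂ) (k : Option (Fin 2)) (x t : Ω → ℝ)
    (s : (l : Fin 2) → Fin (N l) → ℕ) (c : Ω → Fin 2 → ℂ) (hδ : Tendsto δ ℓ (nhds 0))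
    (hc : ∀ᶠ ω in ℓ, ∀ l, c ω l ≠ 0)
    {L L' : Ω → (l : Fin 2) → Fin (N l) → ℕ → ℂ}
    (hm : ∀ l, CloseTo ℓ δ
      (fun ω => schurMinor (D.minusVars (d ω) k (x ω) (t ω) l) (s l) / c ω l) (fun _ => 1))
    (hp : ∀ l, CloseTo ℓ δ
      (fun ω => schurMinor (D.plusVars (d ω) k (x ω) (t ω) l) (s l) / c ω l) (fun _ => 1))
    (hm' : ∀ l j r, CloseTo ℓ δ
      (fun ω => schurMinor (D.minusVars (d ω) k (x ω) (t ω) l) (Function.update (s l) j r) / c ω l)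
      (fun ω => L ω l j r))
    (hp' : ∀ l j r, CloseTo ℓ δ
      (fun ω => schurMinor (D.plusVars (d ω) k (x ω) (t ω) l) (Function.update (s l) j r) / c ω l)
      (fun ω => L' ω l j r)) :
    CloseTo ℓ δ
      (fun ω => D.tau N (d ω) k (x ω) (t ω) / ((∏ l, conj (c ω l)) * ∏ l, c ω l))
      (fun ω => D.sandwichDet N (L ω) (L' ω)) := by
  have hone : ∀ᶠ ω in ℓ, (1 : ℝ) ≤ ‖(1 : ℂ)‖ := Eventually.of_forall fun _ => by simp
  have hm0 : ∀ l, ∀ᶠ ω in ℓ, schurMinor (D.minusVars (d ω) k (x ω) (t ω) l) (s l) ≠ 0 := by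
    intro l
    filter_upwards [(hm l).eventually_le_norm hδ one_pos hone] with ω h h0
    rw [h0, zero_div, norm_zero] at h
    norm_num at h
  have hp0 : ∀ l, ∀ᶠ ω in ℓ, schurMinor (D.plusVars (d ω) k (x ω) (t ω) l) (s l) ≠ 0 := by
    intro l
    filter_upwards [(hp l).eventually_le_norm hδ one_pos hone] with ω h h0
    rw [h0, zero_div, norm_zero] at h
    norm_num at h
  -- The normalizing factor cancels in the quotients of Cramer's rule, so the rows inherit the
  -- limits of the normalized minors.
  have hrow : ∀ l j r, CloseTo ℓ δ
      (fun ω => cramerRow (D.minusVars (d ω) k (x ω) (t ω) l) (s l) j r) (fun ω => L ω l j r) := by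
    intro l j r
    have h := (hm' l j r).div (hm l) hδ one_pos hone
    simp only [div_one] at h
    refine h.congr_left ?_
    filter_upwards [hc] with ω hω
    exact div_div_div_cancel_right₀ (hω l) _ _
  have hrow' : ∀ l j r, CloseTo ℓ δ
      (fun ω => cramerRow (D.plusVars (d ω) k (x ω) (t ω) l) (s l) j r) (fun ω => L' ω l j r) := by
    intro l j r
    have h := (hp' l j r).div (hp l) hδ one_pos hone
    simp only [div_one] at h
    refine h.congr_left ?_
    filter_upwards [hc] with ω hω
    exact div_div_div_cancel_right₀ (hω l) _ _
  have h1 := ((CloseTo.prod Finset.univ fun l _ => (hm l).starRingEnd).mul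
    (CloseTo.prod Finset.univ fun l _ => hp l)).mul (D.closeTo_sandwichDet N hrow hrow')
  simp only [map_one, Finset.prod_const_one, one_mul] at h1
  refine h1.congr_left ?_
  filter_upwards [eventually_all.mpr hm0, eventually_all.mpr hp0] with ω e1 e2
  rw [D.tau_eq_mul_sandwichDet N (d ω) k (x ω) (t ω) s e1 e2, Finset.prod_div_distrib,
    mul_div_assoc]
  simp only [map_div₀, Finset.prod_div_distrib]
  ring

end SpectralData

end

end CNLS

namespace CNLS

noncomputable section

/-! ### Adler-Moser polynomials -/

section AdlerMoser

open Polynomial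

theorem derivative_det {n : Type*} [Fintype n] [DecidableEq n] (M : Matrix n n ℂ[X]) :
    derivative M.det = ∑ j, (M.updateCol j fun i => derivative (M i j)).det := by
  simp only [Matrix.det_apply', derivative_sum]
  rw [Finset.sum_comm]
  refine Finset.sum_congr rfl fun σ _ => ?_
  rw [derivative_mul, derivative_intCast, zero_mul, zero_add, derivative_prod_finset,
    Finset.mul_sum]
  refine Finset.sum_congr rfl fun j _ => ?_
  rw [← Finset.mul_prod_erase _ _ (Finset.mem_univ j), Matrix.updateCol_self, mul_comm (∏ i ∈ _, _)]
  congr 2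
  refine Finset.prod_congr rfl fun i hi => ?_
  rw [Matrix.updateCol_ne (Finset.ne_of_mem_erase hi)]

variable (κ : ℕ → ℂ)

/-- Only the first variable contains `z`, so differentiation multiplies the generating function by
`ε`. The induction differentiates the recurrence. -/
theorem derivative_schur_adlerMoserVars (n : ℕ) :
    derivative (schur (adlerMoserVars κ) (n + 1)) = schur (adlerMoserVars κ) n := by
  induction n using Nat.strong_induction_on with
  | _ n ih =>
    have hz : ∀ i, derivative (adlerMoserVars κ (i + 1)) = if i = 0 then 1 else 0 := by
      intro i
      rw [adlerMoserVars]
      by_cases hi : i = 0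
      · simp [hi]
      · rw [if_neg (by omega), if_neg hi]
        split_ifs <;> simp
    have hs : ∀ j, j ≤ n → derivative (schur (adlerMoserVars κ) j) =
        if j = 0 then 0 else schur (adlerMoserVars κ) (j - 1) := by
      intro j hj
      cases j with
      | zero => simp [schur_zero]
      | succ j => simpa using ih j (by omega)
    have h := congrArg derivative (schur_succ (adlerMoserVars κ) n)
    have hd : derivative ((n : ℂ[X]) + 1) = 0 := by simp
    rw [derivative_mul, hd, zero_mul, zero_add, derivative_sum] at h
    apply natCast_succ_mul_cancel n
    rw [h]
    have hterm : ∀ p ∈ Finset.HasAntidiagonal.antidiagonal n,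
        derivative (((p.1 : ℂ[X]) + 1) * adlerMoserVars κ (p.1 + 1) *
          schur (adlerMoserVars κ) p.2) =
        (if p.1 = 0 then schur (adlerMoserVars κ) p.2 else 0) +
        ((p.1 : ℂ[X]) + 1) * adlerMoserVars κ (p.1 + 1) *
          (if p.2 = 0 then 0 else schur (adlerMoserVars κ) (p.2 - 1)) := by
      intro p hp
      have hp' := Finset.HasAntidiagonal.mem_antidiagonal.mp hp
      have hd : derivative ((p.1 : ℂ[X]) + 1) = 0 := by simp
      rw [derivative_mul, derivative_mul, hd, hz, hs p.2 (by omega)]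
      by_cases h0 : p.1 = 0
      · simp [h0]
      · simp [h0]
    rw [Finset.sum_congr rfl hterm, Finset.sum_add_distrib]
    have h1 : ∑ p ∈ Finset.HasAntidiagonal.antidiagonal n,
        (if p.1 = 0 then schur (adlerMoserVars κ) p.2 else 0) = schur (adlerMoserVars κ) n := by
      rw [Finset.sum_eq_single (0, n)]
      · simp
      · rintro ⟨a, b⟩ hp hne
        have hp' : a + b = n := Finset.HasAntidiagonal.mem_antidiagonal.mp hp
        rw [if_neg]
        intro h0
        have h0' : a = 0 := h0
        apply hne
        rw [← hp', h0', zero_add]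
      · intro h
        exact absurd (Finset.HasAntidiagonal.mem_antidiagonal.mpr (zero_add n)) h
    rw [h1]
    cases n with
    | zero => simp
    | succ n =>
      rw [Finset.Nat.sum_antidiagonal_succ']
      simp only [if_true, mul_zero, Nat.succ_ne_zero, if_false, Nat.add_sub_cancel, zero_add]
      rw [← schur_succ]
      push_cast
      ring

theorem derivative_schurRow (i r : ℕ) :
    derivative (schurRow (adlerMoserVars κ) i r) = schurRow (adlerMoserVars κ) i (r + 1) := by
  rw [schurRow, schurRow]
  split_ifs with h1 h2 h2
  · rw [show 2 * i + 1 - r = 2 * i + 1 - (r + 1) + 1 by omega, derivative_schur_adlerMoserVars]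
  · rw [show 2 * i + 1 - r = 0 by omega, schur_zero, derivative_one]
  · omega
  · exact derivative_zero

/-- The columns `0, …, N - 1`. -/
def stdColumns (n : ℕ) (j : Fin n) : ℕ := j

/-- The columns `0, …, N - 2, N`. -/
def shiftColumns (n : ℕ) (j : Fin n) : ℕ := if (j : ℕ) + 1 = n then j + 1 else j

/-- Differentiating a column raises its index by one. Unless it is the last column, it then
coincides with its right neighbour and the determinant vanishes. -/
theorem derivative_schurMinor_std (n : ℕ) (hn : n ≠ 0) :
    derivative (schurMinor (adlerMoserVars κ) (stdColumns n)) =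
      schurMinor (adlerMoserVars κ) (shiftColumns n) := by
  have hterm : ∀ j : Fin n, (Matrix.updateCol (Matrix.of fun i j : Fin n =>
      schurRow (adlerMoserVars κ) i (stdColumns n j)) j fun i =>
        derivative (schurRow (adlerMoserVars κ) i (stdColumns n j))).det =
      schurMinor (adlerMoserVars κ) (Function.update (stdColumns n) j (j + 1)) := by
    intro j
    rw [schurMinor]
    congr 1
    ext i j' : 2
    rw [Matrix.updateCol_apply]
    simp only [Matrix.of_apply]
    split_ifs with h
    · rw [h, Function.update_self, derivative_schurRow]
      rfl
    · rw [Function.update_of_ne h]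
  rw [schurMinor, derivative_det]
  refine (Finset.sum_congr rfl fun j _ => hterm j).trans ?_
  rw [Finset.sum_eq_single ⟨n - 1, by omega⟩]
  · congr 1
    ext j
    by_cases hj : j = ⟨n - 1, by omega⟩
    · subst hj
      rw [Function.update_self, shiftColumns, if_pos (by simp only; omega)]
    · have : (j : ℕ) ≠ n - 1 := fun h => hj (Fin.ext h)
      have := j.2
      rw [Function.update_of_ne hj, shiftColumns, if_neg (by omega)]
      rfl
  · intro j _ hj
    have h1 : (j : ℕ) ≠ n - 1 := fun h => hj (Fin.ext h)
    have h2 := j.2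
    refine schurMinor_eq_zero_of_eq _ (j := j) (j' := ⟨j + 1, by omega⟩) ?_ ?_
    · intro h
      have := congrArg Fin.val h
      simp at this
    · rw [Function.update_self, Function.update_of_ne]
      · rfl
      · intro h
        have := congrArg Fin.val h
        simp at this
  · exact fun h => absurd (Finset.mem_univ _) h

theorem natDegree_schur_le (n : ℕ) : (schur (adlerMoserVars κ) n).natDegree ≤ n ∧
    (schur (adlerMoserVars κ) n).coeff n = ((n.factorial : ℕ) : ℂ)⁻¹ := by
  induction n using Nat.strong_induction_on with
  | _ n ih =>
    cases n with
    | zero => simp [schur_zero]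
    | succ n =>
      have hz : ∀ i, (adlerMoserVars κ (i + 1)).natDegree ≤ if i = 0 then 1 else 0 := by
        intro i
        rw [adlerMoserVars]
        by_cases hi : i = 0
        · simp [hi]
        · rw [if_neg (by omega), if_neg hi]
          split_ifs <;> simp
      have e : schur (adlerMoserVars κ) (n + 1) = C (((n : ℂ) + 1)⁻¹) *
          ∑ p ∈ Finset.HasAntidiagonal.antidiagonal n,
            C ((p.1 : ℂ) + 1) * (adlerMoserVars κ (p.1 + 1) * schur (adlerMoserVars κ) p.2) := by
        have h := schur_succ (adlerMoserVars κ) n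
        have h2 : C (((n : ℂ) + 1)⁻¹) * ((n : ℂ[X]) + 1) = 1 := by
          have h3 : ((n : ℂ[X]) + 1) = C ((n : ℂ) + 1) := by simp
          rw [h3, ← C_mul, inv_mul_cancel₀ (Nat.cast_add_one_ne_zero n), C_1]
        rw [← one_mul (schur (adlerMoserVars κ) (n + 1)), ← h2, mul_assoc, h]
        congr 1
        refine Finset.sum_congr rfl fun p _ => ?_
        simp [mul_assoc]
      have hdeg : ∀ p ∈ Finset.HasAntidiagonal.antidiagonal n,
          (adlerMoserVars κ (p.1 + 1) * schur (adlerMoserVars κ) p.2).natDegree ≤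
            if p.1 = 0 then n + 1 else n := by
        intro p hp
        have hp' := Finset.HasAntidiagonal.mem_antidiagonal.mp hp
        refine natDegree_mul_le.trans ((add_le_add (hz p.1) (ih p.2 (by omega)).1).trans ?_)
        split_ifs <;> omega
      rw [e]
      constructor
      · refine (natDegree_C_mul_le _ _).trans (natDegree_sum_le_of_forall_le _ _ fun p hp => ?_)
        refine (natDegree_C_mul_le _ _).trans ((hdeg p hp).trans ?_)
        split_ifs <;> omega
      · rw [coeff_C_mul, finsetSum_coeff, Finset.sum_eq_single (0, n)]
        · have h1 : adlerMoserVars κ (0 + 1) = X := by simp [adlerMoserVars]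
          rw [coeff_C_mul]
          simp only [h1]
          rw [coeff_X_mul, (ih n (Nat.lt_succ_self n)).2, Nat.factorial_succ]
          push_cast
          field_simp
          simp
        · rintro ⟨a, b⟩ hp hne
          have hp' : a + b = n := Finset.HasAntidiagonal.mem_antidiagonal.mp hp
          have ha : a ≠ 0 := by
            rintro rfl
            apply hne
            rw [← hp', zero_add]
          have h2 := hdeg _ hp
          simp only [if_neg ha] at h2
          rw [coeff_C_mul, coeff_eq_zero_of_natDegree_lt (Nat.lt_succ_of_le h2), mul_zero]
        · intro h
          exact absurd (Finset.HasAntidiagonal.mem_antidiagonal.mpr (zero_add n)) h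

theorem coeff_prod_of_natDegree_le_fun {ι : Type*} (s : Finset ι) (f : ι → ℂ[X]) (d : ι → ℕ)
    (h : ∀ i ∈ s, (f i).natDegree ≤ d i) :
    (∏ i ∈ s, f i).natDegree ≤ ∑ i ∈ s, d i ∧
      (∏ i ∈ s, f i).coeff (∑ i ∈ s, d i) = ∏ i ∈ s, (f i).coeff (d i) := by
  classical
  induction s using Finset.induction_on with
  | empty => simp
  | insert a s ha ih =>
    have ih' := ih fun i hi => h i (Finset.mem_insert_of_mem hi)
    have h0 := h a (Finset.mem_insert_self _ _)
    rw [Finset.prod_insert ha, Finset.sum_insert ha, Finset.prod_insert ha]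
    refine ⟨natDegree_mul_le.trans (add_le_add h0 ih'.1), ?_⟩
    rw [coeff_mul_add_eq_of_natDegree_le h0 ih'.1, ih'.2]

/-- If the degree bounds depend on the row only, all permutation products share the same bound, and
the top coefficient can be taken entrywise. -/
theorem coeff_det_of_natDegree_le {n : ℕ} (M : Matrix (Fin n) (Fin n) ℂ[X]) (d : Fin n → ℕ)
    (h : ∀ i j, (M i j).natDegree ≤ d i) :
    M.det.natDegree ≤ ∑ i, d i ∧
      M.det.coeff (∑ i, d i) = (Matrix.of fun i j => (M i j).coeff (d i)).det := by
  have hσ : ∀ σ : Equiv.Perm (Fin n), ∑ i, d (σ i) = ∑ i, d i := fun σ => Equiv.sum_comp σ d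
  have hp := fun σ : Equiv.Perm (Fin n) => coeff_prod_of_natDegree_le_fun Finset.univ
    (fun i => M (σ i) i) (fun i => d (σ i)) fun i _ => h (σ i) i
  simp only [hσ] at hp
  have hC : ∀ σ : Equiv.Perm (Fin n), (((Equiv.Perm.sign σ : ℤˣ) : ℤ) : ℂ[X]) =
      C ((((Equiv.Perm.sign σ : ℤˣ) : ℤ) : ℂ)) := fun σ => by simp
  constructor
  · rw [Matrix.det_apply']
    refine natDegree_sum_le_of_forall_le _ _ fun σ _ => ?_
    rw [hC]
    exact (natDegree_C_mul_le _ _).trans (hp σ).1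
  · rw [Matrix.det_apply', Matrix.det_apply', finsetSum_coeff]
    refine Finset.sum_congr rfl fun σ _ => ?_
    rw [hC, coeff_C_mul, (hp σ).2]
    rfl

/-- Multiplying row `i` by `(2i + 1)!` gives descending factorials of `2i + 1`: monic polynomials of
degree `j` at distinct nodes, hence a Vandermonde determinant. -/
theorem det_inv_factorial_ne_zero (n : ℕ) :
    (Matrix.of fun i j : Fin n => if (j : ℕ) ≤ 2 * i + 1 then
      (((2 * (i : ℕ) + 1 - j).factorial : ℕ) : ℂ)⁻¹ else 0).det ≠ 0 := by
  have h := Matrix.det_mul_column (fun i : Fin n => (((2 * (i : ℕ) + 1).factorial : ℕ) : ℂ)⁻¹)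
    (Matrix.of fun i j : Fin n => (descPochhammer ℂ j).eval (((2 * (i : ℕ) + 1 : ℕ)) : ℂ))
  have hv := Matrix.det_eval_matrixOfPolynomials_eq_det_vandermonde
    (fun i : Fin n => (((2 * (i : ℕ) + 1 : ℕ)) : ℂ)) (fun j => descPochhammer ℂ j)
    (fun j => descPochhammer_natDegree ℂ j) (fun j => monic_descPochhammer ℂ j)
  rw [← hv] at h
  convert_to (Matrix.of fun i j : Fin n => (((2 * (i : ℕ) + 1).factorial : ℕ) : ℂ)⁻¹ *
    (Matrix.of fun i j : Fin n => (descPochhammer ℂ j).eval (((2 * (i : ℕ) + 1 : ℕ)) : ℂ)) i j).det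
      ≠ 0
  · congr 1
    ext i j
    simp only [Matrix.of_apply]
    rw [descPochhammer_eval_eq_descFactorial]
    split_ifs with hij
    · have := Nat.factorial_mul_descFactorial hij
      rw [← this]
      push_cast
      have h1 : (((2 * (i : ℕ) + 1 - j).factorial : ℕ) : ℂ) ≠ 0 :=
        Nat.cast_ne_zero.mpr (Nat.factorial_ne_zero _)
      have h2 : (((2 * (i : ℕ) + 1).descFactorial j : ℕ) : ℂ) ≠ 0 := by
        rw [Nat.cast_ne_zero, Ne, Nat.descFactorial_eq_zero_iff_lt]
        omega
      field_simp
    · rw [Nat.descFactorial_of_lt (by omega)]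
      simp
  · rw [h]
    refine mul_ne_zero (Finset.prod_ne_zero_iff.mpr fun i _ =>
      inv_ne_zero (Nat.cast_ne_zero.mpr (Nat.factorial_ne_zero _))) ?_
    rw [Matrix.det_vandermonde_ne_zero_iff]
    intro i j hij
    have : 2 * (i : ℕ) + 1 = 2 * j + 1 := Nat.cast_injective (R := ℂ) hij
    exact Fin.ext (by omega)

theorem sum_stdColumns_add (n : ℕ) :
    ∑ j, stdColumns n j + n * (n + 1) / 2 = ∑ i : Fin n, (2 * (i : ℕ) + 1) := by
  have h1 : ∑ j, stdColumns n j = ∑ j ∈ Finset.range n, j := (Finset.sum_range (fun j => j)).symm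
  have h2 : ∑ i : Fin n, (2 * (i : ℕ) + 1) = ∑ j ∈ Finset.range n, (2 * j + 1) :=
    (Finset.sum_range (fun j => 2 * j + 1)).symm
  rw [h1, h2]
  induction n with
  | zero => simp
  | succ n ih =>
    have ih' := ih (Finset.sum_range (fun j => j)).symm (Finset.sum_range (fun j => 2 * j + 1)).symm
    rw [Finset.sum_range_succ, Finset.sum_range_succ, ← ih']
    have h3 : (n + 1) * (n + 1 + 1) = n * (n + 1) + (n + 1) * 2 := by ring
    rw [h3, Nat.add_mul_div_right _ _ (by norm_num)]
    omega

theorem natDegree_schurMinor_std (n : ℕ) :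
    schurMinor (adlerMoserVars κ) (stdColumns n) ≠ 0 ∧
    (schurMinor (adlerMoserVars κ) (stdColumns n)).natDegree = n * (n + 1) / 2 := by
  set Θ := schurMinor (adlerMoserVars κ) (stdColumns n) with hΘ
  -- Column `j` is multiplied by `X ^ j` to make the degree bound `2i + 1` uniform along row `i`;
  -- the extra degree is subtracted at the end.
  have hmul := Matrix.det_mul_row (fun j => (X : ℂ[X]) ^ stdColumns n j)
    (Matrix.of fun i j : Fin n => schurRow (adlerMoserVars κ) i (stdColumns n j))
  rw [Finset.prod_pow_eq_pow_sum] at hmul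
  change _ = _ * Θ at hmul
  have hcoef := coeff_det_of_natDegree_le (Matrix.of fun i j => X ^ stdColumns n j *
    (Matrix.of fun i j : Fin n => schurRow (adlerMoserVars κ) i (stdColumns n j)) i j)
    (fun i => 2 * (i : ℕ) + 1) (by
      intro i j
      simp only [Matrix.of_apply, schurRow]
      split_ifs with h
      · refine natDegree_mul_le.trans ?_
        rw [natDegree_X_pow]
        have := (natDegree_schur_le κ (2 * (i : ℕ) + 1 - stdColumns n j)).1
        omega
      · simp)
  have htop : (Matrix.of fun i j : Fin n => ((Matrix.of fun i j => X ^ stdColumns n j *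
      (Matrix.of fun i j : Fin n => schurRow (adlerMoserVars κ) i (stdColumns n j)) i j) i j).coeff
        (2 * (i : ℕ) + 1)) = Matrix.of fun i j : Fin n => if (j : ℕ) ≤ 2 * i + 1 then
      (((2 * (i : ℕ) + 1 - j).factorial : ℕ) : ℂ)⁻¹ else 0 := by
    ext i j
    simp only [Matrix.of_apply, schurRow]
    by_cases h : (j : ℕ) ≤ 2 * i + 1
    · have h' : stdColumns n j ≤ 2 * i + 1 := h
      rw [if_pos h, if_pos h', coeff_X_pow_mul', if_pos h', (natDegree_schur_le κ _).2]
      rfl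
    · have h' : ¬stdColumns n j ≤ 2 * i + 1 := h
      rw [if_neg h, if_neg h', mul_zero, coeff_zero]
  rw [htop, hmul] at hcoef
  have hne : X ^ (∑ j, stdColumns n j) * Θ ≠ 0 := by
    intro h
    rw [h, coeff_zero] at hcoef
    exact det_inv_factorial_ne_zero n hcoef.2.symm
  have hΘ0 : Θ ≠ 0 := right_ne_zero_of_mul hne
  refine ⟨hΘ0, ?_⟩
  have hd : (X ^ (∑ j, stdColumns n j) * Θ).natDegree = ∑ i : Fin n, (2 * (i : ℕ) + 1) := by
    refine le_antisymm hcoef.1 (le_natDegree_of_ne_zero ?_)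
    rw [hcoef.2]
    exact det_inv_factorial_ne_zero n
  rw [natDegree_mul (pow_ne_zero _ X_ne_zero) hΘ0, natDegree_X_pow] at hd
  have := sum_stdColumns_add n
  omega

/-- The number `∏_{k=1}^{N} (2k-1)!!`. -/
def adlerMoserFactor (N : ℕ) : ℂ :=
  ∏ k ∈ Finset.range N, ((Nat.doubleFactorial (2 * k + 1) : ℕ) : ℂ)

theorem adlerMoserFactor_ne_zero (N : ℕ) : adlerMoserFactor N ≠ 0 :=
  Finset.prod_ne_zero_iff.mpr fun _ _ => Nat.cast_ne_zero.mpr (Nat.doubleFactorial_pos _).ne'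

theorem adlerMoser_eq (N : ℕ) : adlerMoser κ N =
    C (adlerMoserFactor N) * schurMinor (adlerMoserVars κ) (stdColumns N) := rfl

/-- The variables of the Adler-Moser polynomials, with a number in place of the polynomial
variable. -/
def adlerMoserPoint (z : ℂ) (i : ℕ) : ℂ := if i = 1 then z else if Odd i then κ (i / 2) else 0

theorem eval_schurMinor (z : ℂ) {n : ℕ} (s : Fin n → ℕ) :
    (schurMinor (adlerMoserVars κ) s).eval z = schurMinor (adlerMoserPoint κ z) s := by
  have h := map_schurMinor (evalRingHom z) (adlerMoserVars κ) s
  rw [coe_evalRingHom] at h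
  rw [h]
  congr 1
  ext i
  rw [adlerMoserVars, adlerMoserPoint]
  split_ifs <;> simp

theorem eval_adlerMoser (z : ℂ) (N : ℕ) : (adlerMoser κ N).eval z =
    adlerMoserFactor N * schurMinor (adlerMoserPoint κ z) (stdColumns N) := by
  rw [adlerMoser_eq, eval_mul, eval_C, eval_schurMinor]

theorem eval_derivative_adlerMoser (z : ℂ) {N : ℕ} (hN : N ≠ 0) :
    (derivative (adlerMoser κ N)).eval z =
      adlerMoserFactor N * schurMinor (adlerMoserPoint κ z) (shiftColumns N) := by
  rw [adlerMoser_eq, derivative_C_mul, derivative_schurMinor_std κ N hN, eval_mul, eval_C,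
    eval_schurMinor]

theorem adlerMoser_ne_zero (N : ℕ) : adlerMoser κ N ≠ 0 := by
  rw [adlerMoser_eq]
  exact mul_ne_zero (C_ne_zero.mpr (adlerMoserFactor_ne_zero N)) (natDegree_schurMinor_std κ N).1

theorem natDegree_adlerMoser (N : ℕ) : (adlerMoser κ N).natDegree = N * (N + 1) / 2 := by
  rw [adlerMoser_eq, natDegree_C_mul (adlerMoserFactor_ne_zero N), (natDegree_schurMinor_std κ N).2]

theorem mem_rootSet {N : ℕ} {z : ℂ} : z ∈ rootSet κ N ↔ (adlerMoser κ N).eval z = 0 := by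
  rw [rootSet, Multiset.mem_toFinset, mem_roots (adlerMoser_ne_zero κ N)]
  rfl

variable {κ}

theorem nodup_roots_adlerMoser {N : ℕ} (hsimple : ∀ z : ℂ, (adlerMoser κ N).eval z = 0 →
    (derivative (adlerMoser κ N)).eval z ≠ 0) : (adlerMoser κ N).roots.Nodup := by
  rw [Multiset.nodup_iff_count_le_one]
  intro z
  rw [count_roots]
  by_contra! h
  have h' := (one_lt_rootMultiplicity_iff_isRoot (adlerMoser_ne_zero κ N)).mp h
  exact hsimple z h'.1 h'.2

theorem card_rootSet {N : ℕ} (hsimple : ∀ z : ℂ, (adlerMoser κ N).eval z = 0 →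
    (derivative (adlerMoser κ N)).eval z ≠ 0) : (rootSet κ N).card = N * (N + 1) / 2 := by
  rw [rootSet, Multiset.toFinset_card_of_nodup (nodup_roots_adlerMoser hsimple),
    ← natDegree_adlerMoser κ N]
  exact (splits_iff_card_roots.mp (IsAlgClosed.splits _))

theorem norm_eval_adlerMoser {N : ℕ} (hsimple : ∀ z : ℂ, (adlerMoser κ N).eval z = 0 →
    (derivative (adlerMoser κ N)).eval z ≠ 0) (z : ℂ) : ‖(adlerMoser κ N).eval z‖ =
      ‖(adlerMoser κ N).leadingCoeff‖ * ∏ w ∈ rootSet κ N, ‖z - w‖ := by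
  have h := (IsAlgClosed.splits (adlerMoser κ N)).eq_prod_roots
  conv_lhs => rw [h]
  rw [eval_mul, eval_C, norm_mul, eval_multiset_prod, Multiset.map_map, rootSet]
  congr 1
  rw [Finset.prod_eq_multiset_prod, Multiset.toFinset_val,
    (nodup_roots_adlerMoser hsimple).dedup]
  have hn := map_multiset_prod (normHom : ℂ →*₀ ℝ)
    (Multiset.map (eval z ∘ fun x => X - C x) (adlerMoser κ N).roots)
  rw [Multiset.map_map] at hn
  refine hn.trans (congrArg _ (Multiset.map_congr rfl fun w _ => ?_))
  simp

end AdlerMoser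

/-! ### Lower bounds for a product of distances to finitely many points -/

theorem exists_pos_le_norm_sub (S : Finset ℂ) :
    ∃ d : ℝ, 0 < d ∧ d ≤ 1 ∧ ∀ w ∈ S, ∀ w' ∈ S, w ≠ w' → d ≤ ‖w - w'‖ := by
  have h : ∀ᶠ d : ℝ in nhdsWithin 0 (Set.Ioi 0), ∀ p ∈ S.offDiag, d ≤ ‖p.1 - p.2‖ := by
    rw [Filter.eventually_all_finset]
    intro p hp
    have : 0 < ‖p.1 - p.2‖ := norm_pos_iff.mpr (sub_ne_zero.mpr (Finset.mem_offDiag.mp hp).2.2)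
    exact (Filter.Eventually.filter_mono nhdsWithin_le_nhds (eventually_le_nhds this))
  have h1 : ∀ᶠ d : ℝ in nhdsWithin 0 (Set.Ioi 0), d ≤ 1 :=
    Filter.Eventually.filter_mono nhdsWithin_le_nhds (eventually_le_nhds one_pos)
  obtain ⟨d, ⟨hd, hd1⟩, hd0⟩ := ((h.and h1).and self_mem_nhdsWithin).exists
  exact ⟨d, hd0, hd1, fun w hw w' hw' hne => hd (w, w') (Finset.mem_offDiag.mpr ⟨hw, hw', hne⟩)⟩

/-- At most one point of `S` lies within half the minimal distance of `z`. Its factor is at least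
`r`, and every other factor is comparable to `1 + ‖z‖`. Thus `r` enters only to the first power,
which is where simplicity of the roots pays off. -/
theorem exists_le_prod_norm_sub (S : Finset ℂ) :
    ∃ c : ℝ, 0 < c ∧ ∀ (z : ℂ) (r : ℝ), 0 < r → r ≤ 1 → (∀ w ∈ S, r ≤ ‖z - w‖) →
      c * r * (1 + ‖z‖) ^ S.card ≤ ∏ w ∈ S, ‖z - w‖ := by
  obtain ⟨d, hd0, hd1, hd⟩ := exists_pos_le_norm_sub S
  -- Chosen so that points at distance at least `d / 2` satisfy `‖z - w‖ ≥ (1 + ‖z‖) / K`, while `(1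
  -- + ‖z‖) / K ≤ 1` as soon as some point is nearer than that.
  set K : ℝ := (1 + ∑ w ∈ S, ‖w‖) * 2 / d + 1 with hK
  have hsum : 0 ≤ ∑ w ∈ S, ‖w‖ := Finset.sum_nonneg fun _ _ => norm_nonneg _
  have hK0 : 0 < K := by positivity
  have hw : ∀ w ∈ S, ‖w‖ ≤ ∑ w ∈ S, ‖w‖ := fun w hw =>
    Finset.single_le_sum (f := fun w => ‖w‖) (fun _ _ => norm_nonneg _) hw
  have hz : ∀ z w : ℂ, ‖z‖ ≤ ‖w‖ + ‖z - w‖ := fun z w => by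
    simpa using norm_add_le w (z - w)
  have hfar : ∀ z, ∀ w ∈ S, d / 2 ≤ ‖z - w‖ → (1 + ‖z‖) / K ≤ ‖z - w‖ := by
    intro z w hwS h
    rw [div_le_iff₀ hK0]
    have h1 : (1 + ∑ w ∈ S, ‖w‖) ≤ ‖z - w‖ * ((1 + ∑ w ∈ S, ‖w‖) * 2 / d) := by
      have h2 : d / 2 * ((1 + ∑ w ∈ S, ‖w‖) * 2 / d) = 1 + ∑ w ∈ S, ‖w‖ := by field_simp
      exact h2.symm.le.trans (mul_le_mul_of_nonneg_right h (by positivity))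
    have h3 := hz z w
    have h4 := hw w hwS
    rw [hK, mul_add, mul_one]
    linarith
  have hnear : ∀ z, ∀ w ∈ S, ‖z - w‖ < d / 2 → (1 + ‖z‖) / K ≤ 1 := by
    intro z w hwS h
    rw [div_le_one hK0]
    have h3 := hz z w
    have h4 := hw w hwS
    have h5 : (1 + ∑ w ∈ S, ‖w‖) * 2 ≤ (1 + ∑ w ∈ S, ‖w‖) * 2 / d := by
      rw [le_div_iff₀ hd0]
      nlinarith
    rw [hK]
    linarith
  refine ⟨(K ^ S.card)⁻¹, by positivity, fun z r hr0 hr1 hr => ?_⟩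
  have hρ : 0 ≤ (1 + ‖z‖) / K := by positivity
  have hgoal : (K ^ S.card)⁻¹ * r * (1 + ‖z‖) ^ S.card = r * ((1 + ‖z‖) / K) ^ S.card := by
    rw [div_pow]
    ring
  rw [hgoal]
  by_cases hex : ∃ w ∈ S, ‖z - w‖ < d / 2
  · obtain ⟨w, hwS, hlt⟩ := hex
    rw [← Finset.mul_prod_erase _ _ hwS, ← Finset.card_erase_add_one hwS, pow_succ, mul_comm r,
      mul_assoc, mul_comm ‖z - w‖]
    have h1 : ((1 + ‖z‖) / K) ^ (S.erase w).card ≤ ∏ w' ∈ S.erase w, ‖z - w'‖ := by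
      rw [← Finset.prod_const]
      refine Finset.prod_le_prod (fun _ _ => hρ) fun w' hw' => ?_
      obtain ⟨hne, hw'S⟩ := Finset.mem_erase.mp hw'
      apply hfar z w' hw'S
      have h2 := hd w hwS w' hw'S hne.symm
      have h3 : ‖w - w'‖ ≤ ‖z - w‖ + ‖z - w'‖ := by
        have := norm_sub_le (z - w') (z - w)
        rw [sub_sub_sub_cancel_left] at this
        linarith
      linarith
    have h2 : (1 + ‖z‖) / K * r ≤ ‖z - w‖ :=
      (mul_le_of_le_one_left hr0.le (hnear z w hwS hlt)).trans (hr w hwS)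
    exact mul_le_mul h1 h2 (by positivity) (Finset.prod_nonneg fun _ _ => norm_nonneg _)
  · push Not at hex
    calc r * ((1 + ‖z‖) / K) ^ S.card ≤ ((1 + ‖z‖) / K) ^ S.card :=
          mul_le_of_le_one_left (by positivity) hr1
      _ ≤ _ := by
          rw [← Finset.prod_const]
          exact Finset.prod_le_prod (fun _ _ => hρ) fun w hwS => hfar z w hwS (hex w hwS)

end

end CNLS

/-! ### Scaling of the variables, uniformly in the plane -/

namespace CNLS

noncomputable section

open Asymptotics

theorem sum_shiftColumns {n : ℕ} (hn : n ≠ 0) :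
    ∑ j, shiftColumns n j = ∑ j, stdColumns n j + 1 := by
  obtain ⟨m, rfl⟩ := Nat.exists_eq_succ_of_ne_zero hn
  rw [Fin.sum_univ_castSucc, Fin.sum_univ_castSucc]
  have h : ∀ j : Fin m, shiftColumns (m + 1) j.castSucc = stdColumns (m + 1) j.castSucc := by
    intro j
    have := j.2
    rw [shiftColumns, if_neg]
    · rfl
    · simp only [Fin.val_castSucc]
      omega
  rw [Finset.sum_congr rfl fun j _ => h j]
  simp [shiftColumns, stdColumns]
  ring

theorem sum_update {n : ℕ} (s : Fin n → ℕ) (j : Fin n) {r : ℕ} (h : s j ≤ r) :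
    ∑ i, Function.update s j r i = ∑ i, s i + (r - s j) := by
  rw [Finset.sum_update_of_mem (Finset.mem_univ j), ← Finset.add_sum_erase _ s (Finset.mem_univ j),
    Finset.sdiff_singleton_eq_erase]
  omega

/-- Rescaling of the odd variables in a minor. -/
theorem pow_mul_schurMinor {n : ℕ} (B : ℂ) (hB : B ≠ 0) (y : ℕ → ℂ) (s : Fin n → ℕ) :
    B ^ (∑ j, s j) * schurMinor y s = B ^ (∑ j, stdColumns n j) * (B ^ (n * (n + 1) / 2) *
      schurMinor (fun j => oddPart y j / B ^ j) s) := by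
  have h : oddPart y = fun j => B ^ j * (oddPart y j / B ^ j) := by
    ext j
    field_simp
  rw [← mul_assoc, ← pow_add, sum_stdColumns_add, ← schurMinor_scale, ← h, schurMinor_oddPart]

namespace SpectralData

variable (D : SpectralData) (κ : Fin 2 → ℕ → ℂ)

theorem alpha_one (l : Fin 2) : D.alpha l 1 = Complex.I * D.chiOne l := by
  rw [alpha, PowerSeries.coeff_C_mul, map_sub, lamSeries, map_add, PowerSeries.coeff_C_mul,
    PowerSeries.coeff_X_pow, PowerSeries.coeff_C]
  simp [chiOne]

theorem beta_one (l : Fin 2) : D.beta l 1 = D.chi l * D.chiOne l := by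
  have h1 : PowerSeries.coeff 1 (D.lamSeries l ^ 2) = 0 := by
    rw [pow_two, PowerSeries.coeff_mul, Finset.Nat.sum_antidiagonal_eq_sum_range_succ_mk]
    simp [Finset.sum_range_succ, lamSeries, PowerSeries.coeff_C, PowerSeries.coeff_X_pow]
  have h2 : PowerSeries.coeff 1 (D.chiSeries l ^ 2) = 2 * (D.chi l * D.chiOne l) := by
    rw [pow_two, PowerSeries.coeff_mul, Finset.Nat.sum_antidiagonal_eq_sum_range_succ_mk]
    simp [Finset.sum_range_succ, chi, chiOne]
    ring
  have h3 : PowerSeries.coeff 1 (2 : PowerSeries ℂ) = 0 := by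
    have : (2 : PowerSeries ℂ) = PowerSeries.C 2 := (map_ofNat PowerSeries.C 2).symm
    rw [this, PowerSeries.coeff_C, if_neg one_ne_zero]
  rw [beta, map_sub, map_sub, PowerSeries.coeff_C_mul, h1, h2, h3]
  ring

/-- The variables of the block `l`, with a constant perturbation. -/
def blockVars (A : ℝ) (l : Fin 2) (x t : ℝ) (e : ℕ → ℂ) (s : ℕ) : ℂ :=
  D.xPlus (largeParams κ A) l x t s + e s

theorem blockVars_one {A : ℝ} (hA : A ≠ 0) (l : Fin 2) (x t : ℝ) (e : ℕ → ℂ) :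
    D.blockVars κ A l x t e 1 = A * D.psi κ A l x t + e 1 := by
  have hA' : (A : ℂ) ≠ 0 := Complex.ofReal_ne_zero.mpr hA
  have h : largeParams κ A l 1 = κ l 0 * A := by simp [largeParams]
  rw [blockVars, xPlus, alpha_one, beta_one, h, psi]
  field_simp
  ring

/-- As `χ_l` is not real, `x + χ_l t` determines `x` and `t` linearly. -/
theorem exists_abs_add_abs_le (l : Fin 2) : ∃ C : ℝ, 0 < C ∧ ∀ x t : ℝ,
    |x| + |t| ≤ C * ‖(x : ℂ) + D.chi l * t‖ := by
  have him := abs_pos.mpr (D.chi_im_ne_zero l)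
  set c := ‖D.chi l‖ with hc
  refine ⟨1 + (c + 1) / |(D.chi l).im|, by positivity, fun x t => ?_⟩
  set w := (x : ℂ) + D.chi l * t with hw
  have h1 : |t| * |(D.chi l).im| ≤ ‖w‖ := by
    have : w.im = (D.chi l).im * t := by simp [hw]
    rw [mul_comm, ← abs_mul, ← this]
    exact Complex.abs_im_le_norm w
  have h2 : |t| ≤ ‖w‖ / |(D.chi l).im| := (le_div_iff₀ him).mpr h1
  have h3 : |x| ≤ ‖w‖ + c * |t| := by
    have e1 : (x : ℂ) = w - D.chi l * t := by rw [hw]; ring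
    have e2 : |x| = ‖(x : ℂ)‖ := by simp
    rw [e2, e1]
    refine (norm_sub_le _ _).trans ?_
    rw [norm_mul, Complex.norm_real, Real.norm_eq_abs]
  calc |x| + |t| ≤ ‖w‖ + (c + 1) * |t| := by linarith
    _ ≤ ‖w‖ + (c + 1) * (‖w‖ / |(D.chi l).im|) := by gcongr
    _ = _ := by ring

theorem exists_abs_add_abs_le_psi (l : Fin 2) : ∃ C : ℝ, 0 < C ∧ ∀ A x t : ℝ, 1 ≤ A →
    |x| + |t| ≤ C * (A * (1 + ‖D.psi κ A l x t‖)) := by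
  obtain ⟨C, hC, h⟩ := D.exists_abs_add_abs_le l
  have h1 : 0 < ‖D.chiOne l‖ := norm_pos_iff.mpr (D.chiOne_ne_zero l)
  refine ⟨C * ((1 + ‖κ l 0‖) / ‖D.chiOne l‖), by positivity, fun A x t hA => (h x t).trans ?_⟩
  have hA0 : 0 < A := by linarith
  rw [mul_assoc]
  refine mul_le_mul_of_nonneg_left ?_ hC.le
  rw [div_mul_eq_mul_div, le_div_iff₀ h1]
  have e : ((x : ℂ) + D.chi l * t) * D.chiOne l * Complex.I = A * (D.psi κ A l x t - κ l 0) := by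
    have hA' : (A : ℂ) ≠ 0 := Complex.ofReal_ne_zero.mpr hA0.ne'
    rw [psi]
    field_simp
    ring
  have e2 : ‖(x : ℂ) + D.chi l * t‖ * ‖D.chiOne l‖ = A * ‖D.psi κ A l x t - κ l 0‖ := by
    have := congrArg norm e
    rw [norm_mul, norm_mul, norm_mul, Complex.norm_I, mul_one, Complex.norm_real,
      Real.norm_eq_abs, abs_of_pos hA0] at this
    exact this
  rw [e2]
  have h3 := norm_sub_le (D.psi κ A l x t) (κ l 0)
  have h4 := norm_nonneg (κ l 0)
  have h5 := norm_nonneg (D.psi κ A l x t)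
  calc A * ‖D.psi κ A l x t - κ l 0‖ ≤ A * (‖D.psi κ A l x t‖ + ‖κ l 0‖) := by gcongr
    _ ≤ A * ((1 + ‖κ l 0‖) * (1 + ‖D.psi κ A l x t‖)) := by
        refine mul_le_mul_of_nonneg_left ?_ hA0.le
        nlinarith
    _ = _ := by ring

/-- Apart from the large parameter, a variable is affine in `x`, `t`, and these are `O(A(1 + |ψ|))`
on the whole plane. -/
theorem exists_blockVars_sub_le (l : Fin 2) (e : ℕ → ℂ) {j : ℕ} (hj : Odd j) :
    ∃ C : ℝ, 0 ≤ C ∧ ∀ A x t : ℝ, 1 ≤ A →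
      ‖D.blockVars κ A l x t e j - κ l (j / 2) * (A : ℂ) ^ j‖ ≤
        C * (A * (1 + ‖D.psi κ A l x t‖)) := by
  obtain ⟨C, hC, h⟩ := D.exists_abs_add_abs_le_psi κ l
  refine ⟨(‖D.alpha l j‖ + ‖D.beta l j‖) * C + ‖e j‖, by positivity, fun A x t hA => ?_⟩
  have hx := h A x t hA
  have e1 : D.blockVars κ A l x t e j - κ l (j / 2) * (A : ℂ) ^ j =
      D.alpha l j * x + D.beta l j * Complex.I * t + e j := by
    rw [blockVars, xPlus, largeParams, if_pos hj]
    ring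
  have h1 : 1 ≤ A * (1 + ‖D.psi κ A l x t‖) := by
    nlinarith [norm_nonneg (D.psi κ A l x t)]
  rw [e1]
  refine (norm_add₃_le).trans ?_
  rw [norm_mul, norm_mul, norm_mul, Complex.norm_I, mul_one, Complex.norm_real, Complex.norm_real,
    Real.norm_eq_abs, Real.norm_eq_abs]
  have hx1 : |x| ≤ C * (A * (1 + ‖D.psi κ A l x t‖)) := by linarith [abs_nonneg t]
  have hx2 : |t| ≤ C * (A * (1 + ‖D.psi κ A l x t‖)) := by linarith [abs_nonneg x]
  have h2 := mul_le_mul_of_nonneg_left hx1 (norm_nonneg (D.alpha l j))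
  have h3 := mul_le_mul_of_nonneg_left hx2 (norm_nonneg (D.beta l j))
  have h4 := mul_le_mul_of_nonneg_left h1 (norm_nonneg (e j))
  nlinarith

section Regime

variable {Ω : Type*} {ℓ : Filter Ω} {δ A x t : Ω → ℝ}

/-- The scale `A(1 + |ψ|)` keeps all variables bounded however far `(x, t)` is from the origin. In
index 1 the error is a constant over the scale; in higher odd indices it is of the size of the scale
itself, divided by at least its square. -/
theorem closeTo_scaledVars (hA : Tendsto A ℓ atTop) (l : Fin 2) (e : ℕ → ℂ) (j : ℕ) :
    CloseTo ℓ (fun ω => (A ω)⁻¹)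
      (fun ω => oddPart (D.blockVars κ (A ω) l (x ω) (t ω) e) j /
        ((A ω : ℂ) * ((1 + ‖D.psi κ (A ω) l (x ω) (t ω)‖ : ℝ) : ℂ)) ^ j)
      (fun ω => oddPart (adlerMoserPoint (κ l) (D.psi κ (A ω) l (x ω) (t ω))) j /
        ((1 + ‖D.psi κ (A ω) l (x ω) (t ω)‖ : ℝ) : ℂ) ^ j) := by
  have hA1 : ∀ᶠ ω in ℓ, 1 ≤ A ω := hA.eventually_ge_atTop 1
  have hδ : (fun ω => (A ω)⁻¹) =O[ℓ] (fun _ => (1 : ℝ)) := by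
    refine IsBigO.of_bound 1 (hA1.mono fun ω h => ?_)
    rw [Real.norm_eq_abs, abs_of_nonneg (by positivity), norm_one, mul_one]
    exact inv_le_one_of_one_le₀ h
  by_cases hj : Odd j
  swap
  · simp only [oddPart, if_neg hj, zero_div]
    exact CloseTo.const 0
  simp only [oddPart, if_pos hj, adlerMoserPoint]
  by_cases h1 : j = 1
  · subst h1
    simp only [if_true, pow_one]
    refine CloseTo.of_sub hδ ?_ ?_
    · refine IsBigO.of_bound 1 (Eventually.of_forall fun ω => ?_)
      rw [norm_one, mul_one, norm_div, Complex.norm_real, Real.norm_eq_abs,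
        abs_of_pos (by positivity), div_le_one (by positivity)]
      linarith
    · refine IsBigO.of_bound ‖e 1‖ (hA1.mono fun ω h => ?_)
      have hA0 : (A ω : ℂ) ≠ 0 := Complex.ofReal_ne_zero.mpr (by linarith)
      set z := D.psi κ (A ω) l (x ω) (t ω)
      have hρ : ((1 + ‖z‖ : ℝ) : ℂ) ≠ 0 := Complex.ofReal_ne_zero.mpr (by positivity)
      have e1 : D.blockVars κ (A ω) l (x ω) (t ω) e 1 / ((A ω : ℂ) * ((1 + ‖z‖ : ℝ) : ℂ)) -
          z / ((1 + ‖z‖ : ℝ) : ℂ) = e 1 * ((A ω : ℂ) * ((1 + ‖z‖ : ℝ) : ℂ))⁻¹ := by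
        rw [blockVars_one _ _ (by linarith)]
        field_simp
        ring
      rw [e1, norm_mul, norm_inv, norm_mul, Complex.norm_real, Complex.norm_real, norm_inv]
      refine mul_le_mul_of_nonneg_left ?_ (norm_nonneg _)
      have : (1 : ℝ) ≤ ‖(1 + ‖z‖)‖ := by
        rw [Real.norm_eq_abs, abs_of_pos (by positivity)]
        linarith [norm_nonneg z]
      exact inv_anti₀ (norm_pos_iff.mpr (by linarith))
        (le_mul_of_one_le_right (norm_nonneg (A ω)) this)
  · simp only [if_neg h1]
    obtain ⟨C, hC, hbound⟩ := D.exists_blockVars_sub_le κ l e hj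
    refine CloseTo.of_sub hδ ?_ ?_
    · refine IsBigO.of_bound ‖κ l (j / 2)‖ (Eventually.of_forall fun ω => ?_)
      rw [norm_one, mul_one, norm_div, norm_pow, Complex.norm_real, Real.norm_eq_abs,
        abs_of_pos (by positivity)]
      refine div_le_self (norm_nonneg _) (one_le_pow₀ ?_)
      linarith [norm_nonneg (D.psi κ (A ω) l (x ω) (t ω))]
    · refine IsBigO.of_bound C (hA1.mono fun ω h => ?_)
      have hA0 : (A ω : ℂ) ≠ 0 := Complex.ofReal_ne_zero.mpr (by linarith)
      have hb := hbound (A ω) (x ω) (t ω) h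
      set z := D.psi κ (A ω) l (x ω) (t ω)
      have hρ : ((1 + ‖z‖ : ℝ) : ℂ) ≠ 0 := Complex.ofReal_ne_zero.mpr (by positivity)
      have e1 : D.blockVars κ (A ω) l (x ω) (t ω) e j / ((A ω : ℂ) * ((1 + ‖z‖ : ℝ) : ℂ)) ^ j -
          κ l (j / 2) / ((1 + ‖z‖ : ℝ) : ℂ) ^ j =
          (D.blockVars κ (A ω) l (x ω) (t ω) e j - κ l (j / 2) * (A ω : ℂ) ^ j) /
            ((A ω : ℂ) * ((1 + ‖z‖ : ℝ) : ℂ)) ^ j := by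
        rw [mul_pow]
        field_simp
      have hB1 : 1 ≤ A ω * (1 + ‖z‖) := by nlinarith [norm_nonneg z]
      have hBA : A ω ≤ A ω * (1 + ‖z‖) := by nlinarith [norm_nonneg z]
      have hn : ‖((A ω : ℂ) * ((1 + ‖z‖ : ℝ) : ℂ))‖ = A ω * (1 + ‖z‖) := by
        rw [norm_mul, Complex.norm_real, Complex.norm_real, Real.norm_eq_abs, Real.norm_eq_abs,
          abs_of_pos (by linarith), abs_of_pos (by positivity)]
      rw [e1, norm_div, norm_pow, hn, Real.norm_eq_abs, abs_of_pos (by positivity),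
        div_le_iff₀ (by positivity)]
      refine hb.trans ?_
      rw [mul_assoc]
      refine mul_le_mul_of_nonneg_left ?_ hC
      have hj2 : 2 ≤ j := by
        rcases hj with ⟨m, rfl⟩
        omega
      calc A ω * (1 + ‖z‖) = (A ω)⁻¹ * (A ω * (A ω * (1 + ‖z‖))) := by
            rw [inv_mul_cancel_left₀ (by linarith)]
        _ ≤ (A ω)⁻¹ * ((A ω * (1 + ‖z‖)) * (A ω * (1 + ‖z‖))) := by gcongr
        _ = (A ω)⁻¹ * (A ω * (1 + ‖z‖)) ^ 2 := by ring
        _ ≤ (A ω)⁻¹ * (A ω * (1 + ‖z‖)) ^ j := by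
            gcongr

/-- The minors of a block, where the Adler-Moser polynomial is large. -/
theorem closeTo_schurMinor_std (hA : Tendsto A ℓ atTop) (l : Fin 2) (e : ℕ → ℂ) {n : ℕ}
    (hδ : δ =O[ℓ] (fun _ => (1 : ℝ)))
    (hθ : ∀ᶠ ω in ℓ, schurMinor (adlerMoserPoint (κ l) (D.psi κ (A ω) l (x ω) (t ω)))
      (stdColumns n) ≠ 0)
    (hρ : (fun ω => (1 + ‖D.psi κ (A ω) l (x ω) (t ω)‖) ^ (n * (n + 1) / 2) / (A ω *
      ‖schurMinor (adlerMoserPoint (κ l) (D.psi κ (A ω) l (x ω) (t ω))) (stdColumns n)‖)) =O[ℓ] δ)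
    (j : Fin n) (r : ℕ) :
    CloseTo ℓ δ
      (fun ω => schurMinor (D.blockVars κ (A ω) l (x ω) (t ω) e)
          (Function.update (stdColumns n) j r) /
        ((A ω : ℂ) ^ (n * (n + 1) / 2) *
          schurMinor (adlerMoserPoint (κ l) (D.psi κ (A ω) l (x ω) (t ω))) (stdColumns n)))
      (fun _ => if r = j then 1 else 0) := by
  have hA1 : ∀ᶠ ω in ℓ, 1 ≤ A ω := hA.eventually_ge_atTop 1
  have hvars := fun s : Fin n → ℕ => CloseTo.schurMinor
    (fun i _ => D.closeTo_scaledVars (x := x) (t := t) κ hA l e i) s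
  refine CloseTo.of_sub hδ (isBigO_const_const _ one_ne_zero ℓ) ?_
  by_cases hrj : r = j
  · simp only [if_pos hrj]
    have hup : Function.update (stdColumns n) j r = stdColumns n := by
      rw [hrj]
      exact Function.update_eq_self j (stdColumns n)
    rw [hup]
    have hmul := (hvars (stdColumns n)).sub.norm_left.mul (isBigO_refl (fun ω =>
      (1 + ‖D.psi κ (A ω) l (x ω) (t ω)‖) ^ (n * (n + 1) / 2) /
      ‖schurMinor (adlerMoserPoint (κ l) (D.psi κ (A ω) l (x ω) (t ω))) (stdColumns n)‖) ℓ)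
    have h2 : (fun ω => (A ω)⁻¹ * ((1 + ‖D.psi κ (A ω) l (x ω) (t ω)‖) ^ (n * (n + 1) / 2) /
      ‖schurMinor (adlerMoserPoint (κ l) (D.psi κ (A ω) l (x ω) (t ω))) (stdColumns n)‖)) =O[ℓ] δ := by
      refine hρ.congr_left fun ω => ?_
      rw [inv_mul_eq_div, div_div, mul_comm (A ω)]
    refine IsBigO.trans (IsBigO.of_bound 1 ?_) (hmul.trans h2)
    filter_upwards [hA1, hθ] with ω h hθω
    have hA0 : (A ω : ℂ) ≠ 0 := Complex.ofReal_ne_zero.mpr (by linarith)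
    set z := D.psi κ (A ω) l (x ω) (t ω)
    have hρ0 : ((1 + ‖z‖ : ℝ) : ℂ) ≠ 0 := Complex.ofReal_ne_zero.mpr (by positivity)
    have e1 := pow_mul_schurMinor _ (mul_ne_zero hA0 hρ0) (D.blockVars κ (A ω) l (x ω) (t ω) e)
      (stdColumns n)
    have e2 := pow_mul_schurMinor _ hρ0 (adlerMoserPoint (κ l) z) (stdColumns n)
    rw [mul_right_inj' (pow_ne_zero _ (mul_ne_zero hA0 hρ0))] at e1
    rw [mul_right_inj' (pow_ne_zero _ hρ0)] at e2
    set Θ := schurMinor (adlerMoserPoint (κ l) z) (stdColumns n)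
    set a := schurMinor (fun j => oddPart (D.blockVars κ (A ω) l (x ω) (t ω) e) j /
      ((A ω : ℂ) * ((1 + ‖z‖ : ℝ) : ℂ)) ^ j) (stdColumns n)
    set b := schurMinor (fun j => oddPart (adlerMoserPoint (κ l) z) j /
      ((1 + ‖z‖ : ℝ) : ℂ) ^ j) (stdColumns n)
    have e3 : schurMinor (D.blockVars κ (A ω) l (x ω) (t ω) e) (stdColumns n) /
        ((A ω : ℂ) ^ (n * (n + 1) / 2) * Θ) - 1 =
        (a - b) * (((1 + ‖z‖ : ℝ) : ℂ) ^ (n * (n + 1) / 2) / Θ) := by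
      rw [e1]
      have hpow := pow_ne_zero (n * (n + 1) / 2) hA0
      field_simp
      linear_combination (-(A ω : ℂ) ^ (n * (n + 1) / 2)) * e2
    rw [e3, one_mul, norm_mul, norm_mul, norm_div, norm_pow, Complex.norm_real, norm_div, norm_pow,
      norm_norm, norm_norm]
  · simp only [if_neg hrj, sub_zero]
    -- For `r < n` the column `r` occurs twice and the minor is zero. For `r ≥ n` the weighted
    -- degree drops by `r - j ≥ 1`, which gains at least one factor `A(1 + |ψ|)`.
    by_cases hr : r < n
    · have hz : ∀ y : ℕ → ℂ, schurMinor y (Function.update (stdColumns n) j r) = 0 := by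
        intro y
        refine schurMinor_eq_zero_of_eq y (j := j) (j' := ⟨r, hr⟩) ?_ ?_
        · rintro rfl
          exact hrj rfl
        · rw [Function.update_self, Function.update_of_ne]
          · rfl
          · rintro rfl
            exact hrj rfl
      simp only [hz, zero_div]
      exact isBigO_zero _ _
    · have hjn := j.2
      have hsum := sum_update (stdColumns n) j (r := r) (by rw [stdColumns]; omega)
      have hmul := (hvars (Function.update (stdColumns n) j r)).left.norm_left.mul hρ
      simp only [one_mul] at hmul
      refine IsBigO.trans (IsBigO.of_bound 1 ?_) hmul
      filter_upwards [hA1, hθ] with ω h hθω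
      have hA0 : (A ω : ℂ) ≠ 0 := Complex.ofReal_ne_zero.mpr (by linarith)
      set z := D.psi κ (A ω) l (x ω) (t ω)
      have hρ0 : ((1 + ‖z‖ : ℝ) : ℂ) ≠ 0 := Complex.ofReal_ne_zero.mpr (by positivity)
      have e1 := pow_mul_schurMinor _ (mul_ne_zero hA0 hρ0) (D.blockVars κ (A ω) l (x ω) (t ω) e)
        (Function.update (stdColumns n) j r)
      rw [hsum, pow_add, mul_assoc,
        mul_right_inj' (pow_ne_zero _ (mul_ne_zero hA0 hρ0))] at e1
      set Θ := schurMinor (adlerMoserPoint (κ l) z) (stdColumns n)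
      set a := schurMinor (fun j => oddPart (D.blockVars κ (A ω) l (x ω) (t ω) e) j /
        ((A ω : ℂ) * ((1 + ‖z‖ : ℝ) : ℂ)) ^ j) (Function.update (stdColumns n) j r)
      set k := r - stdColumns n j with hk
      have hk0 : k ≠ 0 := by
        have : stdColumns n j = j := rfl
        omega
      have e3 : schurMinor (D.blockVars κ (A ω) l (x ω) (t ω) e)
          (Function.update (stdColumns n) j r) / ((A ω : ℂ) ^ (n * (n + 1) / 2) * Θ) =
          a * (((1 + ‖z‖ : ℝ) : ℂ) ^ (n * (n + 1) / 2) /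
            (((A ω : ℂ) * ((1 + ‖z‖ : ℝ) : ℂ)) ^ k * Θ)) := by
        have hpow := pow_ne_zero (n * (n + 1) / 2) hA0
        have hpow' := pow_ne_zero k (mul_ne_zero hA0 hρ0)
        rw [div_eq_iff (mul_ne_zero hpow hθω), ← mul_right_inj' hpow', e1, mul_pow]
        field_simp
      have hB : A ω ≤ ‖((A ω : ℂ) * ((1 + ‖z‖ : ℝ) : ℂ)) ^ k‖ := by
        rw [norm_pow, norm_mul, Complex.norm_real, Complex.norm_real, Real.norm_eq_abs,
          Real.norm_eq_abs, abs_of_pos (by linarith), abs_of_pos (by positivity)]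
        calc A ω ≤ A ω * (1 + ‖z‖) := by nlinarith [norm_nonneg z]
          _ ≤ _ := le_self_pow₀ (by nlinarith [norm_nonneg z]) hk0
      have hΘ0 : 0 < ‖Θ‖ := norm_pos_iff.mpr hθω
      have hAp : 0 < A ω := by linarith
      rw [e3, one_mul, norm_mul, norm_mul, norm_norm]
      refine mul_le_mul_of_nonneg_left ?_ (norm_nonneg _)
      rw [norm_div, norm_mul _ Θ, norm_div, norm_mul (A ω), norm_norm, Real.norm_of_nonneg hAp.le,
        norm_pow (((1 + ‖z‖ : ℝ) : ℂ)), Complex.norm_real, norm_pow (1 + ‖z‖)]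
      exact div_le_div_of_nonneg_left (by positivity) (by positivity)
        (mul_le_mul_of_nonneg_right hB hΘ0.le)

end Regime

end SpectralData

end

end CNLS

/-! ### Minors near a simple root of the Adler-Moser polynomial -/

namespace CNLS

noncomputable section

open Asymptotics

theorem CloseTo.polynomial_eval {Ω : Type*} {ℓ : Filter Ω} {δ : Ω → ℝ} {f g : Ω → ℂ}
    (h : CloseTo ℓ δ f g) (p : Polynomial ℂ) :
    CloseTo ℓ δ (fun ω => p.eval (f ω)) (fun ω => p.eval (g ω)) := by
  induction p using Polynomial.induction_on' with
  | add p q hp hq => simpa using hp.add hq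
  | monomial k a =>
    simp only [Polynomial.eval_monomial]
    refine (CloseTo.const a).mul ?_
    induction k with
    | zero => simpa using CloseTo.const 1
    | succ k ih => simpa [pow_succ] using ih.mul h

theorem shiftColumns_le {n : ℕ} (j : Fin n) : shiftColumns n j ≤ n := by
  have := j.2
  rw [shiftColumns]
  split_ifs <;> omega

theorem shiftColumns_of_lt {n r : ℕ} (h : r + 1 < n) :
    shiftColumns n ⟨r, by omega⟩ = r := by
  rw [shiftColumns, if_neg]
  simp only
  omega

theorem update_shiftColumns {n : ℕ} {j : Fin n} (hj : (j : ℕ) + 1 = n) :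
    Function.update (shiftColumns n) j j = stdColumns n := by
  ext i
  by_cases hi : i = j
  · rw [hi, Function.update_self, stdColumns]
  · rw [Function.update_of_ne hi, shiftColumns, if_neg, stdColumns]
    intro h
    exact hi (Fin.ext (by omega))

namespace SpectralData

variable (D : SpectralData) (κ : Fin 2 → ℕ → ℂ)

section Regime

variable {Ω : Type*} {ℓ : Filter Ω} {A x t : Ω → ℝ}

theorem isBigO_psi_sub (hA : Tendsto A ℓ atTop) (l : Fin 2) (z : ℂ)
    (hy : (fun ω => (A ω : ℂ) * (D.psi κ (A ω) l (x ω) (t ω) - z)) =O[ℓ] (fun _ => (1 : ℝ))) :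
    (fun ω => D.psi κ (A ω) l (x ω) (t ω) - z) =O[ℓ] (fun ω => (A ω)⁻¹) := by
  have h : (fun ω => (((A ω)⁻¹ : ℝ) : ℂ)) =O[ℓ] (fun ω => (A ω)⁻¹) :=
    IsBigO.of_bound 1 (Eventually.of_forall fun ω => by simp)
  have := h.mul hy
  simp only [mul_one] at this
  refine this.congr' ?_ EventuallyEq.rfl
  filter_upwards [hA.eventually_ge_atTop 1] with ω hω
  have hA0 : (A ω : ℂ) ≠ 0 := Complex.ofReal_ne_zero.mpr (by linarith)
  push_cast
  rw [inv_mul_cancel_left₀ hA0]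

theorem isBigO_inv_one (hA : Tendsto A ℓ atTop) :
    (fun ω => (A ω)⁻¹) =O[ℓ] (fun _ => (1 : ℝ)) := by
  refine IsBigO.of_bound 1 ((hA.eventually_ge_atTop 1).mono fun ω h => ?_)
  rw [Real.norm_eq_abs, abs_of_nonneg (by positivity), norm_one, mul_one]
  exact inv_le_one_of_one_le₀ h

/-- Near a point, the rescaled variables of a block are `O(A⁻²)`-close to the variables of an
Adler-Moser polynomial. -/
theorem closeTo_scaledVars_sq (hA : Tendsto A ℓ atTop) (l : Fin 2) (z : ℂ)
    (hy : (fun ω => (A ω : ℂ) * (D.psi κ (A ω) l (x ω) (t ω) - z)) =O[ℓ] (fun _ => (1 : ℝ)))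
    (e : ℕ → ℂ) (j : ℕ) :
    CloseTo ℓ (fun ω => (A ω)⁻¹ * (A ω)⁻¹)
      (fun ω => oddPart (D.blockVars κ (A ω) l (x ω) (t ω) e) j / (A ω : ℂ) ^ j)
      (fun ω => adlerMoserPoint (κ l) (D.psi κ (A ω) l (x ω) (t ω) + e 1 / A ω) j) := by
  have hA1 : ∀ᶠ ω in ℓ, 1 ≤ A ω := hA.eventually_ge_atTop 1
  have hinv := isBigO_inv_one hA
  have hpsi : (fun ω => D.psi κ (A ω) l (x ω) (t ω)) =O[ℓ] (fun _ => (1 : ℝ)) := by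
    have := ((D.isBigO_psi_sub κ hA l z hy).trans hinv).add
      (isBigO_const_const z one_ne_zero ℓ)
    simpa using this
  by_cases hj : Odd j
  swap
  · have h1 : j ≠ 1 := by
      rintro rfl
      simp at hj
    simp only [oddPart, if_neg hj, zero_div, adlerMoserPoint, if_neg h1]
    exact CloseTo.const 0
  simp only [oddPart, if_pos hj, adlerMoserPoint]
  by_cases h1 : j = 1
  · subst h1
    simp only [if_true, pow_one]
    refine (CloseTo.self ?_).congr_left ?_
    · refine hpsi.add ?_
      have : (fun ω => e 1 / (A ω : ℂ)) =O[ℓ] (fun ω => (A ω)⁻¹) :=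
        IsBigO.of_bound ‖e 1‖ (Eventually.of_forall fun ω => by
          rw [norm_div, Complex.norm_real, norm_inv, div_eq_mul_inv])
      exact this.trans hinv
    · filter_upwards [hA1] with ω hω
      have hA0 : (A ω : ℂ) ≠ 0 := Complex.ofReal_ne_zero.mpr (by linarith)
      rw [blockVars_one _ _ (by linarith)]
      field_simp
  · simp only [if_neg h1]
    obtain ⟨C, hC, hbound⟩ := D.exists_blockVars_sub_le κ l e hj
    obtain ⟨M, hM⟩ := hpsi.bound
    refine CloseTo.of_sub (by simpa using hinv.mul hinv)
      (isBigO_const_const _ one_ne_zero ℓ) (IsBigO.of_bound (C * (1 + M)) ?_)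
    filter_upwards [hA1, hM] with ω hω hMω
    have hA0 : (A ω : ℂ) ≠ 0 := Complex.ofReal_ne_zero.mpr (by linarith)
    have hAp : 0 < A ω := by linarith
    have hb := hbound (A ω) (x ω) (t ω) hω
    rw [norm_one, mul_one] at hMω
    have e1 : D.blockVars κ (A ω) l (x ω) (t ω) e j / (A ω : ℂ) ^ j - κ l (j / 2) =
        (D.blockVars κ (A ω) l (x ω) (t ω) e j - κ l (j / 2) * (A ω : ℂ) ^ j) / (A ω : ℂ) ^ j := by
      field_simp
    -- An error `O(A)` divided by `A ^ 3` gives the second order in `A⁻¹`. The variable of index 1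
    -- is matched exactly, since `e 1 / A` was included in the argument.
    have hj3 : 3 ≤ j := by
      rcases hj with ⟨m, rfl⟩
      omega
    rw [e1, norm_div, norm_pow, Complex.norm_real, Real.norm_of_nonneg hAp.le,
      Real.norm_of_nonneg (by positivity), div_le_iff₀ (by positivity)]
    have hM0 : 0 ≤ M := (norm_nonneg _).trans hMω
    calc _ ≤ C * (A ω * (1 + M)) := hb.trans (by gcongr)
      _ = C * (1 + M) * ((A ω)⁻¹ * (A ω)⁻¹) * A ω ^ 3 := by field_simp
      _ ≤ C * (1 + M) * ((A ω)⁻¹ * (A ω)⁻¹) * A ω ^ j := by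
          gcongr

/-- The minors of a block near a simple root of the Adler-Moser polynomial. -/
theorem closeTo_schurMinor_shift (hA : Tendsto A ℓ atTop) (l : Fin 2) (z : ℂ)
    (hy : (fun ω => (A ω : ℂ) * (D.psi κ (A ω) l (x ω) (t ω) - z)) =O[ℓ] (fun _ => (1 : ℝ)))
    (e : ℕ → ℂ) {n : ℕ} (hn : n ≠ 0) (hz : (adlerMoser (κ l) n).eval z = 0)
    (hz' : (Polynomial.derivative (adlerMoser (κ l) n)).eval z ≠ 0) (j : Fin n) (r : ℕ) :
    CloseTo ℓ (fun ω => (A ω)⁻¹)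
      (fun ω => schurMinor (D.blockVars κ (A ω) l (x ω) (t ω) e)
          (Function.update (shiftColumns n) j r) /
        ((A ω : ℂ) ^ (n * (n + 1) / 2) / A ω *
          schurMinor (adlerMoserPoint (κ l) z) (shiftColumns n)))
      (fun ω => if r = shiftColumns n j then 1 else
        if (j : ℕ) + 1 = n ∧ r = j then
          (A ω : ℂ) * (D.psi κ (A ω) l (x ω) (t ω) - z) + e 1 else 0) := by
  have hA1 : ∀ᶠ ω in ℓ, 1 ≤ A ω := hA.eventually_ge_atTop 1
  have hinv := isBigO_inv_one hA
  set dΘ := schurMinor (adlerMoserPoint (κ l) z) (shiftColumns n) with hdΘ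
  have hderiv := eval_derivative_adlerMoser (κ l) z hn
  have hf0 := adlerMoserFactor_ne_zero n
  have hd0 : dΘ ≠ 0 := by
    intro h0
    rw [← hdΘ, h0, mul_zero] at hderiv
    exact hz' hderiv
  have hw := fun i => D.closeTo_scaledVars_sq κ hA l z hy e i
  have hsq : (fun ω => (A ω)⁻¹ * (A ω)⁻¹) =O[ℓ] (fun ω => (A ω)⁻¹) := by
    simpa using (isBigO_refl (fun ω => (A ω)⁻¹) ℓ).mul hinv
  have hw1 : CloseTo ℓ (fun ω => (A ω)⁻¹)
      (fun ω => D.psi κ (A ω) l (x ω) (t ω) + e 1 / A ω) (fun _ => z) := by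
    refine CloseTo.of_sub hinv (isBigO_const_const _ one_ne_zero ℓ) ?_
    have : (fun ω => e 1 / (A ω : ℂ)) =O[ℓ] (fun ω => (A ω)⁻¹) :=
      IsBigO.of_bound ‖e 1‖ (Eventually.of_forall fun ω => by
        rw [norm_div, Complex.norm_real, norm_inv, div_eq_mul_inv])
    exact ((D.isBigO_psi_sub κ hA l z hy).add this).congr_left fun ω => by ring
  have hpoint : ∀ i, CloseTo ℓ (fun ω => (A ω)⁻¹)
      (fun ω => adlerMoserPoint (κ l) (D.psi κ (A ω) l (x ω) (t ω) + e 1 / A ω) i)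
      (fun _ => adlerMoserPoint (κ l) z i) := by
    intro i
    by_cases hi : i = 1
    · simpa only [adlerMoserPoint, if_pos hi] using hw1
    · simp only [adlerMoserPoint, if_neg hi]
      exact CloseTo.const _
  have hminor : ∀ s : Fin n → ℕ, CloseTo ℓ (fun ω => (A ω)⁻¹)
      (fun ω => schurMinor (fun i => oddPart (D.blockVars κ (A ω) l (x ω) (t ω) e) i /
        (A ω : ℂ) ^ i) s) (fun _ => schurMinor (adlerMoserPoint (κ l) z) s) := fun s =>
    CloseTo.schurMinor (fun i _ => ((hw i).mono hsq).trans (hpoint i)) s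
  have hpow : ∀ (ω : Ω) (s : Fin n → ℕ), 1 ≤ A ω →
      (A ω : ℂ) ^ (∑ j, s j) * schurMinor (D.blockVars κ (A ω) l (x ω) (t ω) e) s =
        (A ω : ℂ) ^ (∑ j, stdColumns n j) * ((A ω : ℂ) ^ (n * (n + 1) / 2) *
          schurMinor (fun i => oddPart (D.blockVars κ (A ω) l (x ω) (t ω) e) i /
            (A ω : ℂ) ^ i) s) := fun ω s h =>
    pow_mul_schurMinor _ (Complex.ofReal_ne_zero.mpr (by linarith)) _ s
  have hshift := sum_shiftColumns hn
  by_cases hr : r = shiftColumns n j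
  · simp only [if_pos hr]
    have hup : Function.update (shiftColumns n) j r = shiftColumns n := by
      rw [hr]
      exact Function.update_eq_self j (shiftColumns n)
    rw [hup]
    have h1 := (hminor (shiftColumns n)).mul (CloseTo.const dΘ⁻¹)
    simp only [← hdΘ, mul_inv_cancel₀ hd0] at h1
    refine h1.congr_left ?_
    filter_upwards [hA1] with ω hω
    have hA0 : (A ω : ℂ) ≠ 0 := Complex.ofReal_ne_zero.mpr (by linarith)
    have h2 := hpow ω (shiftColumns n) hω
    rw [hshift, pow_succ, mul_assoc, mul_right_inj' (pow_ne_zero _ hA0)] at h2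
    have hp := pow_ne_zero (n * (n + 1) / 2) hA0
    rw [eq_div_iff (mul_ne_zero (div_ne_zero hp hA0) hd0), ← mul_right_inj' hA0, h2]
    field_simp
  simp only [if_neg hr]
  -- Column `r` is already present among the shifted columns, in another place, so the minor has two
  -- equal columns.
  by_cases hlt : r + 1 < n
  · have hne : j ≠ ⟨r, by omega⟩ := by
      rintro rfl
      exact hr (shiftColumns_of_lt hlt).symm
    have hz : ∀ y : ℕ → ℂ, schurMinor y (Function.update (shiftColumns n) j r) = 0 := fun y =>
      schurMinor_eq_zero_of_eq y hne
        (by rw [Function.update_self, Function.update_of_ne hne.symm, shiftColumns_of_lt hlt])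
    have hcond : ¬ ((j : ℕ) + 1 = n ∧ r = j) := by omega
    simp only [hz, zero_div, if_neg hcond]
    exact CloseTo.const 0
  -- The critical case: the shifted last column is moved back and the minor is `Θ` itself, which is
  -- small near its root but larger by one power of `A` in its scaling.
  by_cases hstd : (j : ℕ) + 1 = n ∧ r = j
  · simp only [if_pos hstd]
    rw [hstd.2, update_shiftColumns hstd.1]
    -- Write `Θ = (X - z) q` with `q(z) = Θ'(z)`: at `ψ + e 1 / A`, the factor `A` times `X - z` is
    -- `A(ψ - z) + e 1`, which is bounded.
    obtain ⟨q, hq⟩ := Polynomial.dvd_iff_isRoot.mpr (show (adlerMoser (κ l) n).IsRoot z from hz)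
    have hqz : q.eval z = adlerMoserFactor n * dΘ := by
      rw [← hderiv, hq]
      simp
    have hQ := hw1.polynomial_eval q
    have hM : CloseTo ℓ (fun ω => (A ω)⁻¹ * (A ω)⁻¹)
        (fun ω => schurMinor (fun i => oddPart (D.blockVars κ (A ω) l (x ω) (t ω) e) i /
          (A ω : ℂ) ^ i) (stdColumns n))
        (fun ω => schurMinor (adlerMoserPoint (κ l)
          (D.psi κ (A ω) l (x ω) (t ω) + e 1 / A ω)) (stdColumns n)) :=
      CloseTo.schurMinor (fun i _ => hw i) (stdColumns n)
    -- The extra factor `A` costs one order; this is why the variables had to be known up to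
    -- `O(A⁻²)`.
    have hM' : (fun ω => (A ω : ℂ) *
        (schurMinor (fun i => oddPart (D.blockVars κ (A ω) l (x ω) (t ω) e) i /
          (A ω : ℂ) ^ i) (stdColumns n) - schurMinor (adlerMoserPoint (κ l)
          (D.psi κ (A ω) l (x ω) (t ω) + e 1 / A ω)) (stdColumns n))) =O[ℓ]
        (fun ω => (A ω)⁻¹) := by
      have h1 : (fun ω => (A ω : ℂ)) =O[ℓ] A :=
        IsBigO.of_bound 1 (Eventually.of_forall fun ω => by simp)
      refine (h1.mul hM.sub).congr' EventuallyEq.rfl ?_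
      filter_upwards [hA1] with ω hω
      rw [mul_inv_cancel_left₀ (by linarith)]
    have hbd : (fun ω => (A ω : ℂ) * (D.psi κ (A ω) l (x ω) (t ω) - z) + e 1) =O[ℓ]
        (fun _ => (1 : ℝ)) := hy.add (isBigO_const_const _ one_ne_zero ℓ)
    have hQ' := ((CloseTo.self hbd).mul hQ).mul
      (CloseTo.const (adlerMoserFactor n * dΘ)⁻¹ (ℓ := ℓ) (δ := fun ω => (A ω)⁻¹))
    simp only [hqz, mul_inv_cancel_right₀ (mul_ne_zero hf0 hd0)] at hQ'
    refine CloseTo.of_sub hinv hbd ?_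
    have hM'' := hM'.mul (isBigO_const_const dΘ⁻¹ (one_ne_zero (α := ℝ)) ℓ)
    simp only [mul_one] at hM''
    refine (hM''.add hQ'.sub).congr' ?_ EventuallyEq.rfl
    filter_upwards [hA1] with ω hω
    have hA0 : (A ω : ℂ) ≠ 0 := Complex.ofReal_ne_zero.mpr (by linarith)
    have h2 := hpow ω (stdColumns n) hω
    rw [mul_right_inj' (pow_ne_zero _ hA0)] at h2
    have hp := pow_ne_zero (n * (n + 1) / 2) hA0
    have h3 := eval_adlerMoser (κ l) (D.psi κ (A ω) l (x ω) (t ω) + e 1 / A ω) n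
    rw [hq, Polynomial.eval_mul, Polynomial.eval_sub, Polynomial.eval_X, Polynomial.eval_C] at h3
    rw [h2]
    set M := schurMinor (fun i => oddPart (D.blockVars κ (A ω) l (x ω) (t ω) e) i /
      (A ω : ℂ) ^ i) (stdColumns n)
    set T := schurMinor (adlerMoserPoint (κ l)
      (D.psi κ (A ω) l (x ω) (t ω) + e 1 / A ω)) (stdColumns n)
    set Q := q.eval (D.psi κ (A ω) l (x ω) (t ω) + e 1 / A ω)
    set ψ := D.psi κ (A ω) l (x ω) (t ω)
    have h4 : ((A ω : ℂ) * (ψ - z) + e 1) * Q = A ω * (adlerMoserFactor n * T) := by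
      rw [← h3]
      field_simp
      ring
    rw [h4]
    field_simp
    ring
  · simp only [if_neg hstd]
    -- All remaining `r` exceed the column they replace, so the minor has lower weighted degree and
    -- is smaller by `A ^ (k + 1)`.
    have hgt : shiftColumns n j < r := by
      have h1 := shiftColumns_le j
      rcases Nat.lt_or_ge r n with h | h
      · have hj : (j : ℕ) + 1 ≠ n := by omega
        rw [shiftColumns, if_neg hj] at hr ⊢
        omega
      · omega
    have hsum := sum_update (shiftColumns n) j hgt.le
    obtain ⟨k, hk⟩ : ∃ k, r - shiftColumns n j = k + 1 := ⟨r - shiftColumns n j - 1, by omega⟩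
    rw [hk, hshift] at hsum
    have hb := (hminor (Function.update (shiftColumns n) j r)).left
    refine CloseTo.of_sub hinv (isBigO_const_const _ one_ne_zero ℓ) ?_
    simp only [sub_zero]
    have hb' := ((isBigO_refl (fun ω => (A ω)⁻¹) ℓ).mul
      ((hb.mul (isBigO_const_const dΘ⁻¹ (one_ne_zero (α := ℝ)) ℓ)).norm_left))
    simp only [mul_one] at hb'
    refine IsBigO.trans (IsBigO.of_bound 1 ?_) hb'
    filter_upwards [hA1] with ω hω
    have hA0 : (A ω : ℂ) ≠ 0 := Complex.ofReal_ne_zero.mpr (by linarith)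
    have h2 := hpow ω (Function.update (shiftColumns n) j r) hω
    rw [hsum, add_assoc, pow_add, mul_assoc, mul_right_inj' (pow_ne_zero _ hA0)] at h2
    have hp := pow_ne_zero (n * (n + 1) / 2) hA0
    set a := schurMinor (fun i => oddPart (D.blockVars κ (A ω) l (x ω) (t ω) e) i /
      (A ω : ℂ) ^ i) (Function.update (shiftColumns n) j r)
    have e3 : schurMinor (D.blockVars κ (A ω) l (x ω) (t ω) e)
        (Function.update (shiftColumns n) j r) /
        ((A ω : ℂ) ^ (n * (n + 1) / 2) / A ω * dΘ) = ((A ω : ℂ) ^ (k + 1))⁻¹ * (a * dΘ⁻¹) := by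
      rw [div_eq_iff (mul_ne_zero (div_ne_zero hp hA0) hd0),
        ← mul_right_inj' (pow_ne_zero (1 + (k + 1)) hA0), h2]
      field_simp
      ring
    rw [e3, one_mul, norm_mul, norm_mul (A ω)⁻¹, norm_norm, norm_inv, norm_inv, norm_pow,
      Complex.norm_real]
    refine mul_le_mul_of_nonneg_right ?_ (norm_nonneg _)
    have hA2 : 1 ≤ ‖A ω‖ := by rwa [Real.norm_of_nonneg (by linarith)]
    exact inv_anti₀ (by linarith) (le_self_pow₀ hA2 (by omega))

end Regime

end SpectralData

end

end CNLS

/-! ### The far and the near regime for `τ^{(n)} / τ^{(0)}` -/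

namespace CNLS

noncomputable section

open Asymptotics

/-- `Θ_0` is a nonzero constant, so the existence of a root makes the block nonempty. -/
theorem adlerMoser_zero_ne {κ : ℕ → ℂ} {N : ℕ} {z : ℂ} (hz : (adlerMoser κ N).eval z = 0) :
    N ≠ 0 := by
  rintro rfl
  have h := natDegree_adlerMoser κ 0
  rw [Nat.zero_mul, Nat.zero_div, Polynomial.natDegree_eq_zero] at h
  obtain ⟨a, ha⟩ := h
  have h0 := adlerMoser_ne_zero κ 0
  rw [← ha, Polynomial.eval_C] at hz
  rw [← ha, hz, map_zero] at h0
  exact h0 rfl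

/-- Away from its roots, an Adler-Moser polynomial with simple roots is as large as its leading
term. -/
theorem exists_le_norm_schurMinor {κ : ℕ → ℂ} {n : ℕ}
    (hsimple : ∀ z : ℂ, (adlerMoser κ n).eval z = 0 →
      (Polynomial.derivative (adlerMoser κ n)).eval z ≠ 0) :
    ∃ c : ℝ, 0 < c ∧ ∀ (z : ℂ) (r : ℝ), 0 < r → r ≤ 1 → (∀ w ∈ rootSet κ n, r ≤ ‖z - w‖) →
      c * r * (1 + ‖z‖) ^ (n * (n + 1) / 2) ≤
        ‖schurMinor (adlerMoserPoint κ z) (stdColumns n)‖ := by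
  obtain ⟨c, hc, h⟩ := exists_le_prod_norm_sub (rootSet κ n)
  have hl : 0 < ‖(adlerMoser κ n).leadingCoeff‖ :=
    norm_pos_iff.mpr (Polynomial.leadingCoeff_ne_zero.mpr (adlerMoser_ne_zero κ n))
  have hf : 0 < ‖adlerMoserFactor n‖ := norm_pos_iff.mpr (adlerMoserFactor_ne_zero n)
  refine ⟨‖(adlerMoser κ n).leadingCoeff‖ * c / ‖adlerMoserFactor n‖, by positivity,
    fun z r hr hr1 hz => ?_⟩
  have h1 := h z r hr hr1 hz
  have h2 := norm_eval_adlerMoser hsimple z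
  rw [eval_adlerMoser, norm_mul] at h2
  rw [card_rootSet hsimple] at h1
  rw [div_mul_eq_mul_div, div_mul_eq_mul_div, div_le_iff₀ hf, mul_comm _ ‖adlerMoserFactor n‖, h2]
  calc _ = ‖(adlerMoser κ n).leadingCoeff‖ * (c * r * (1 + ‖z‖) ^ (n * (n + 1) / 2)) := by ring
    _ ≤ _ := by gcongr

namespace SpectralData

theorem limitRow_of_ne {N : Fin 2 → ℕ} {l m : Fin 2} (c : Fin 2 → ℂ) (hm : m ≠ l)
    (j : Fin (N m)) (r : ℕ) : limitRow N l c m j r = if r = j then 1 else 0 := by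
  simp [limitRow, borderIndex, borderWeight, hm]

theorem limitRow_one_zero (N : Fin 2 → ℕ) (l m : Fin 2) (j : Fin (N m)) (r : ℕ) :
    limitRow N l ![1, 0] m j r = if r = j then 1 else 0 := by
  rw [limitRow, Fin.sum_univ_two]
  simp only [borderIndex, borderWeight]
  split_ifs <;> simp_all

theorem limitRow_self (N : Fin 2 → ℕ) (l : Fin 2) (a : ℂ) (j : Fin (N l)) (r : ℕ) :
    limitRow N l ![a, 1] l j r = if r = shiftColumns (N l) j then 1 else
      if (j : ℕ) + 1 = N l ∧ r = j then a else 0 := by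
  rw [limitRow, Fin.sum_univ_two]
  simp only [borderIndex, borderWeight, shiftColumns]
  by_cases hj : (j : ℕ) + 1 = N l
  · have hne : (j : ℕ) ≠ N l := by omega
    by_cases h1 : r = j
    · simp [hj, h1, hne]
    · simp [hj, h1]
  · simp [hj]

variable (D : SpectralData) (κ : Fin 2 → ℕ → ℂ) {N : Fin 2 → ℕ}

theorem plusVars_eq_blockVars (A x t : ℝ) (l : Fin 2) (k : Option (Fin 2)) :
    D.plusVars (largeParams κ A) k x t l = D.blockVars κ A l x t (D.hThree l k) := rfl

theorem minusVars_eq_blockVars (A x t : ℝ) (l : Fin 2) (k : Option (Fin 2)) :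
    D.minusVars (largeParams κ A) k x t l = D.blockVars κ A l x t (fun s => -D.hThree l k s) := by
  ext s
  rw [minusVars, blockVars, sub_eq_add_neg]

section Regime

variable {Ω : Type*} {ℓ : Filter Ω} {R A x t : Ω → ℝ}

theorem eventually_schurMinor_ne_zero {l : Fin 2} {n : ℕ}
    (hR : ∀ᶠ ω in ℓ, 0 < R ω ∧ R ω ≤ A ω)
    (hfar : ∀ᶠ ω in ℓ, ∀ w ∈ rootSet (κ l) n, R ω ≤ A ω * ‖D.psi κ (A ω) l (x ω) (t ω) - w‖) :
    ∀ᶠ ω in ℓ, schurMinor (adlerMoserPoint (κ l) (D.psi κ (A ω) l (x ω) (t ω)))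
      (stdColumns n) ≠ 0 := by
  filter_upwards [hR, hfar] with ω h1 h2 h0
  have hz : (adlerMoser (κ l) n).eval (D.psi κ (A ω) l (x ω) (t ω)) = 0 := by
    rw [eval_adlerMoser, h0, mul_zero]
  have := h2 _ ((mem_rootSet (κ l)).mpr hz)
  simp only [sub_self, norm_zero, mul_zero] at this
  linarith

/-- The minors of a block at a large distance from the positions. -/
theorem closeTo_schurMinor_far (hA : Tendsto A ℓ atTop) {l : Fin 2} {n : ℕ}
    (hsimple : ∀ z : ℂ, (adlerMoser (κ l) n).eval z = 0 →
      (Polynomial.derivative (adlerMoser (κ l) n)).eval z ≠ 0)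
    (hR : ∀ᶠ ω in ℓ, 0 < R ω ∧ R ω ≤ A ω)
    (hδ : (fun ω => (R ω)⁻¹) =O[ℓ] (fun _ => (1 : ℝ)))
    (hfar : ∀ᶠ ω in ℓ, ∀ w ∈ rootSet (κ l) n, R ω ≤ A ω * ‖D.psi κ (A ω) l (x ω) (t ω) - w‖)
    (e : ℕ → ℂ) (j : Fin n) (r : ℕ) :
    CloseTo ℓ (fun ω => (R ω)⁻¹)
      (fun ω => schurMinor (D.blockVars κ (A ω) l (x ω) (t ω) e)
          (Function.update (stdColumns n) j r) /
        ((A ω : ℂ) ^ (n * (n + 1) / 2) *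
          schurMinor (adlerMoserPoint (κ l) (D.psi κ (A ω) l (x ω) (t ω))) (stdColumns n)))
      (fun _ => if r = j then 1 else 0) := by
  refine D.closeTo_schurMinor_std κ hA l e hδ (D.eventually_schurMinor_ne_zero κ hR hfar) ?_ j r
  obtain ⟨c, hc, h⟩ := exists_le_norm_schurMinor hsimple
  refine IsBigO.of_bound c⁻¹ ?_
  filter_upwards [hR, hfar, D.eventually_schurMinor_ne_zero κ hR hfar] with ω h1 h2 h3
  have hA0 : 0 < A ω := by linarith
  -- In the variable `ψ` the distance to the roots is at least `r = R / A`; the relative error `A⁻¹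
  -- / (c r)` is then `O(R⁻¹)`.
  have h4 := h (D.psi κ (A ω) l (x ω) (t ω)) (R ω / A ω) (div_pos h1.1 hA0)
    ((div_le_one hA0).mpr h1.2) fun w hw => by
      rw [div_le_iff₀ hA0, mul_comm]
      exact h2 w hw
  have h5 := norm_pos_iff.mpr h3
  rw [Real.norm_of_nonneg (by positivity), Real.norm_of_nonneg (by have := h1.1; positivity),
    div_le_iff₀ (by positivity)]
  have hR0 := h1.1
  calc _ = c⁻¹ * (R ω)⁻¹ * A ω * (c * (R ω / A ω) *
        (1 + ‖D.psi κ (A ω) l (x ω) (t ω)‖) ^ (n * (n + 1) / 2)) := by field_simp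
    _ ≤ c⁻¹ * (R ω)⁻¹ * A ω * ‖schurMinor (adlerMoserPoint (κ l)
        (D.psi κ (A ω) l (x ω) (t ω))) (stdColumns n)‖ := by gcongr
    _ = _ := by ring

/-- The pivot minor itself. -/
theorem closeTo_schurMinor_far_std (hA : Tendsto A ℓ atTop) {l : Fin 2} {n : ℕ}
    (hsimple : ∀ z : ℂ, (adlerMoser (κ l) n).eval z = 0 →
      (Polynomial.derivative (adlerMoser (κ l) n)).eval z ≠ 0)
    (hR : ∀ᶠ ω in ℓ, 0 < R ω ∧ R ω ≤ A ω)
    (hδ : (fun ω => (R ω)⁻¹) =O[ℓ] (fun _ => (1 : ℝ)))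
    (hfar : ∀ᶠ ω in ℓ, ∀ w ∈ rootSet (κ l) n, R ω ≤ A ω * ‖D.psi κ (A ω) l (x ω) (t ω) - w‖)
    (e : ℕ → ℂ) :
    CloseTo ℓ (fun ω => (R ω)⁻¹)
      (fun ω => schurMinor (D.blockVars κ (A ω) l (x ω) (t ω) e) (stdColumns n) /
        ((A ω : ℂ) ^ (n * (n + 1) / 2) *
          schurMinor (adlerMoserPoint (κ l) (D.psi κ (A ω) l (x ω) (t ω))) (stdColumns n)))
      (fun _ => 1) := by
  -- An empty block has no column to update, but its minor is 1.
  rcases Nat.eq_zero_or_pos n with rfl | hn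
  · simp only [schurMinor, Matrix.det_fin_zero, Nat.zero_mul, Nat.zero_div, pow_zero, mul_one,
      div_one]
    exact CloseTo.const 1
  · have h := D.closeTo_schurMinor_far κ hA hsimple hR hδ hfar e ⟨0, hn⟩ 0
    have hup : Function.update (stdColumns n) ⟨0, hn⟩ 0 = stdColumns n :=
      Function.update_eq_self _ (stdColumns n)
    simpa only [hup, if_true] using h

/-- Quotients of the functions `τ^{(k)}`. -/
theorem closeTo_tau_div {δ : Ω → ℝ} {d : Ω → Fin 2 → ℕ → ℂ} {c₀ : Ω → ℂ} {G G₀ : Ω → ℂ}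
    (hδ : Tendsto δ ℓ (nhds 0)) (hc : ∀ᶠ ω in ℓ, c₀ ω ≠ 0) {n : Fin 2}
    (h : CloseTo ℓ δ (fun ω => D.tau N (d ω) (some n) (x ω) (t ω) / c₀ ω) G)
    (h₀ : CloseTo ℓ δ (fun ω => D.tau N (d ω) none (x ω) (t ω) / c₀ ω) G₀)
    {b : ℝ} (hb : 0 < b) (hG : ∀ᶠ ω in ℓ, b ≤ ‖G₀ ω‖) :
    (∀ᶠ ω in ℓ, D.tau N (d ω) none (x ω) (t ω) ≠ 0) ∧
    CloseTo ℓ δ (fun ω => D.tau N (d ω) (some n) (x ω) (t ω) / D.tau N (d ω) none (x ω) (t ω))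
      (fun ω => G ω / G₀ ω) := by
  constructor
  · filter_upwards [h₀.eventually_le_norm hδ hb hG] with ω hω h0
    rw [h0, zero_div, norm_zero] at hω
    linarith
  · refine (h.div h₀ hδ hb hG).congr_left ?_
    filter_upwards [hc] with ω hω
    exact div_div_div_cancel_right₀ hω _ _

/-- The plane wave background at a large distance from all positions. -/
theorem closeTo_tau_div_far (hA : Tendsto A ℓ atTop)
    (hsimple : ∀ (l : Fin 2) (z : ℂ), (adlerMoser (κ l) (N l)).eval z = 0 →
      (Polynomial.derivative (adlerMoser (κ l) (N l))).eval z ≠ 0)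
    (hR : ∀ᶠ ω in ℓ, 0 < R ω ∧ R ω ≤ A ω) (hR' : Tendsto R ℓ atTop)
    (hfar : ∀ l, ∀ᶠ ω in ℓ, ∀ w ∈ rootSet (κ l) (N l),
      R ω ≤ A ω * ‖D.psi κ (A ω) l (x ω) (t ω) - w‖) (n : Fin 2) :
    (∀ᶠ ω in ℓ, D.tau N (largeParams κ (A ω)) none (x ω) (t ω) ≠ 0) ∧
    CloseTo ℓ (fun ω => (R ω)⁻¹) (fun ω => D.tau N (largeParams κ (A ω)) (some n) (x ω) (t ω) /
      D.tau N (largeParams κ (A ω)) none (x ω) (t ω)) (fun _ => 1) := by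
  have hδ : Tendsto (fun ω => (R ω)⁻¹) ℓ (nhds 0) := hR'.inv_tendsto_atTop
  have hP := D.pMinor_std_ne_zero N
  set c : Ω → Fin 2 → ℂ := fun ω l => (A ω : ℂ) ^ (N l * (N l + 1) / 2) *
    schurMinor (adlerMoserPoint (κ l) (D.psi κ (A ω) l (x ω) (t ω))) (stdColumns (N l)) with hc
  have hc0 : ∀ᶠ ω in ℓ, ∀ l, c ω l ≠ 0 := by
    filter_upwards [hR, eventually_all.mpr fun l =>
      D.eventually_schurMinor_ne_zero κ hR (hfar l)] with ω h1 h2 l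
    exact mul_ne_zero (pow_ne_zero _ (Complex.ofReal_ne_zero.mpr (by linarith))) (h2 l)
  have hO := isBigO_inv_one hR'
  have key : ∀ k, CloseTo ℓ (fun ω => (R ω)⁻¹)
      (fun ω => D.tau N (largeParams κ (A ω)) k (x ω) (t ω) /
        ((∏ l, conj (c ω l)) * ∏ l, c ω l))
      (fun _ => D.pMinor N (stdIndex N) (stdIndex N)) := by
    intro k
    -- The limit rows are plain unit rows; writing them as bordered rows of block 0 with weights
    -- `![1, 0]` makes the limit a `borderDet`. The limit and `c` do not depend on `k`.
    have h := D.closeTo_tau N (fun ω => largeParams κ (A ω)) k x t (fun l => stdColumns (N l)) c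
      (L := fun _ => limitRow N 0 ![1, 0]) (L' := fun _ => limitRow N 0 ![1, 0]) hδ hc0
      (fun l => by
        simp only [minusVars_eq_blockVars]
        exact D.closeTo_schurMinor_far_std κ hA (hsimple l) hR hO (hfar l) _)
      (fun l => by
        simp only [plusVars_eq_blockVars]
        exact D.closeTo_schurMinor_far_std κ hA (hsimple l) hR hO (hfar l) _)
      (fun l j r => by
        simp only [minusVars_eq_blockVars, limitRow_one_zero]
        exact D.closeTo_schurMinor_far κ hA (hsimple l) hR hO (hfar l) _ j r)
      (fun l j r => by
        simp only [plusVars_eq_blockVars, limitRow_one_zero]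
        exact D.closeTo_schurMinor_far κ hA (hsimple l) hR hO (hfar l) _ j r)
    have hconj : (fun k => conj ((![1, 0] : Fin 2 → ℂ) k)) = ![1, 0] := by
      ext k
      fin_cases k <;> simp
    rw [D.pMinor_std_std_eq_borderDet N 0]
    simpa only [sandwichDet_limitRow, hconj] using h
  have h := D.closeTo_tau_div hδ (hc0.mono fun ω hω => mul_ne_zero
    (Finset.prod_ne_zero_iff.mpr fun l _ => (map_ne_zero _).mpr (hω l))
    (Finset.prod_ne_zero_iff.mpr fun l _ => hω l)) (key (some n)) (key none)
    (norm_pos_iff.mpr hP) (Eventually.of_forall fun _ => le_rfl)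
  simpa only [div_self hP] using h

/-- The first-order rogue wave near a position. -/
theorem closeTo_tau_div_near (hA : Tendsto A ℓ atTop)
    (hsimple : ∀ (l : Fin 2) (z : ℂ), (adlerMoser (κ l) (N l)).eval z = 0 →
      (Polynomial.derivative (adlerMoser (κ l) (N l))).eval z ≠ 0)
    {l : Fin 2} {z : ℂ} (hz : (adlerMoser (κ l) (N l)).eval z = 0)
    (hy : (fun ω => (A ω : ℂ) * (D.psi κ (A ω) l (x ω) (t ω) - z)) =O[ℓ] (fun _ => (1 : ℝ)))
    {c₁ : ℝ} (hc₁ : 0 < c₁) (hc₁' : c₁ ≤ 1)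
    (hfar : ∀ m, m ≠ l → ∀ᶠ ω in ℓ, ∀ w ∈ rootSet (κ m) (N m),
      c₁ * A ω ≤ A ω * ‖D.psi κ (A ω) m (x ω) (t ω) - w‖) (n : Fin 2) :
    (∀ᶠ ω in ℓ, D.tau N (largeParams κ (A ω)) none (x ω) (t ω) ≠ 0) ∧
    CloseTo ℓ (fun ω => (A ω)⁻¹) (fun ω => D.tau N (largeParams κ (A ω)) (some n) (x ω) (t ω) /
      D.tau N (largeParams κ (A ω)) none (x ω) (t ω))
      (fun ω => (conj ((A ω : ℂ) * (D.psi κ (A ω) l (x ω) (t ω) - z) + D.shift N l -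
            D.hThree l (some n) 1) *
          ((A ω : ℂ) * (D.psi κ (A ω) l (x ω) (t ω) - z) + D.shift N l + D.hThree l (some n) 1) +
          conj (D.coupling l l) * D.coupling l l) /
        (conj ((A ω : ℂ) * (D.psi κ (A ω) l (x ω) (t ω) - z) + D.shift N l) *
          ((A ω : ℂ) * (D.psi κ (A ω) l (x ω) (t ω) - z) + D.shift N l) +
          conj (D.coupling l l) * D.coupling l l)) := by
  have hδ : Tendsto (fun ω => (A ω)⁻¹) ℓ (nhds 0) := hA.inv_tendsto_atTop
  have hO := isBigO_inv_one hA
  have hP := D.pMinor_std_ne_zero N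
  have hNl : N l ≠ 0 := adlerMoser_zero_ne hz
  have hA1 : ∀ᶠ ω in ℓ, 1 ≤ A ω := hA.eventually_ge_atTop 1
  set y : Ω → ℂ := fun ω => (A ω : ℂ) * (D.psi κ (A ω) l (x ω) (t ω) - z) with hydef
  have hd0 : schurMinor (adlerMoserPoint (κ l) z) (shiftColumns (N l)) ≠ 0 := by
    intro h0
    have := hsimple l z hz
    rw [eval_derivative_adlerMoser _ _ hNl, h0, mul_zero] at this
    exact this rfl
  -- Shifted pivot columns in the block of the root, where the standard minor may vanish, and
  -- standard ones in the other block, which is far from its own roots.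
  set s : (m : Fin 2) → Fin (N m) → ℕ := fun m =>
    if m = l then shiftColumns (N m) else stdColumns (N m) with hs
  set c : Ω → Fin 2 → ℂ := fun ω m => if m = l then
      (A ω : ℂ) ^ (N m * (N m + 1) / 2) / A ω *
        schurMinor (adlerMoserPoint (κ m) z) (shiftColumns (N m))
    else (A ω : ℂ) ^ (N m * (N m + 1) / 2) *
      schurMinor (adlerMoserPoint (κ m) (D.psi κ (A ω) m (x ω) (t ω))) (stdColumns (N m)) with hc
  have hR : ∀ᶠ ω in ℓ, 0 < c₁ * A ω ∧ c₁ * A ω ≤ A ω := by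
    filter_upwards [hA1] with ω h
    exact ⟨by positivity, mul_le_of_le_one_left (by linarith) hc₁'⟩
  have hmono : (fun ω => (c₁ * A ω)⁻¹) =O[ℓ] (fun ω => (A ω)⁻¹) := by
    refine IsBigO.of_bound c₁⁻¹ (Eventually.of_forall fun ω => ?_)
    rw [mul_inv, norm_mul, Real.norm_of_nonneg (inv_nonneg.mpr hc₁.le)]
  have hc0 : ∀ᶠ ω in ℓ, ∀ m, c ω m ≠ 0 := by
    refine eventually_all.mpr fun m => ?_
    by_cases hm : m = l
    · subst hm
      filter_upwards [hA1] with ω h1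
      have hA0 : (A ω : ℂ) ≠ 0 := Complex.ofReal_ne_zero.mpr (by linarith)
      simp only [hc, if_true]
      exact mul_ne_zero (div_ne_zero (pow_ne_zero _ hA0) hA0) hd0
    · filter_upwards [hA1, D.eventually_schurMinor_ne_zero κ hR (hfar m hm)] with ω h1 h2
      have hA0 : (A ω : ℂ) ≠ 0 := Complex.ofReal_ne_zero.mpr (by linarith)
      simp only [hc, if_neg hm]
      exact mul_ne_zero (pow_ne_zero _ hA0) h2
  have hrow : ∀ (e : Fin 2 → ℕ → ℂ) (m : Fin 2) (j : Fin (N m)) (r : ℕ),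
      CloseTo ℓ (fun ω => (A ω)⁻¹)
        (fun ω => schurMinor (D.blockVars κ (A ω) m (x ω) (t ω) (e m))
          (Function.update (s m) j r) / c ω m)
        (fun ω => limitRow N l ![y ω + e l 1, 1] m j r) := by
    intro e m j r
    -- In block `l` the last limit row is the unit row of the shifted index plus `y + e_1` times the
    -- unit row of the original one; `e_1` is `± h_3` in index 1.
    by_cases hm : m = l
    · subst hm
      simp only [hs, hc, if_true, limitRow_self]
      exact D.closeTo_schurMinor_shift κ hA m z hy (e m) hNl hz (hsimple m z hz) j r
    · simp only [hs, hc, if_neg hm, limitRow_of_ne _ hm]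
      exact (D.closeTo_schurMinor_far κ hA (hsimple m) hR (hmono.trans hO) (hfar m hm) (e m) j
        r).mono hmono
  have hpivot : ∀ (e : Fin 2 → ℕ → ℂ) (m : Fin 2), CloseTo ℓ (fun ω => (A ω)⁻¹)
      (fun ω => schurMinor (D.blockVars κ (A ω) m (x ω) (t ω) (e m)) (s m) / c ω m)
      (fun _ => 1) := by
    intro e m
    by_cases hm : m = l
    · subst hm
      have h := D.closeTo_schurMinor_shift κ hA m z hy (e m) hNl hz (hsimple m z hz)
        ⟨0, Nat.pos_of_ne_zero hNl⟩ (shiftColumns (N m) ⟨0, Nat.pos_of_ne_zero hNl⟩)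
      simpa only [Function.update_eq_self, if_true, hs, hc] using h
    · simp only [hs, hc, if_neg hm]
      exact (D.closeTo_schurMinor_far_std κ hA (hsimple m) hR (hmono.trans hO) (hfar m hm)
        (e m)).mono hmono
  have key : ∀ k, CloseTo ℓ (fun ω => (A ω)⁻¹)
      (fun ω => D.tau N (largeParams κ (A ω)) k (x ω) (t ω) /
        ((∏ l, conj (c ω l)) * ∏ l, c ω l))
      (fun ω => D.pMinor N (stdIndex N) (stdIndex N) *
        (conj (y ω + D.shift N l - D.hThree l k 1) * (y ω + D.shift N l + D.hThree l k 1) +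
          conj (D.coupling l l) * D.coupling l l)) := by
    intro k
    have h := D.closeTo_tau N (fun ω => largeParams κ (A ω)) k x t s c
      (L := fun ω => limitRow N l ![y ω + -D.hThree l k 1, 1])
      (L' := fun ω => limitRow N l ![y ω + D.hThree l k 1, 1]) hδ hc0
      (fun m => by
        simp only [minusVars_eq_blockVars]
        exact hpivot (fun m s => -D.hThree m k s) m)
      (fun m => by
        simp only [plusVars_eq_blockVars]
        exact hpivot (fun m => D.hThree m k) m)
      (fun m j r => by
        simp only [minusVars_eq_blockVars]
        exact hrow (fun m s => -D.hThree m k s) m j r)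
      (fun m j r => by
        simp only [plusVars_eq_blockVars]
        exact hrow (fun m => D.hThree m k) m j r)
    have hconj : ∀ a : ℂ, (fun k => conj ((![a, 1] : Fin 2 → ℂ) k)) = ![conj a, 1] := by
      intro a
      ext k
      fin_cases k <;> simp
    simp only [sandwichDet_limitRow, hconj, D.borderDet_eq N hNl] at h
    refine h.congr_right (Eventually.of_forall fun ω => ?_)
    simp only [map_add, map_sub, map_neg]
    ring
  have hC : 0 < ‖D.coupling l l‖ ^ 2 := by
    have : D.coupling l l ≠ 0 :=
      div_ne_zero (D.chiOne_ne_zero l) (sub_ne_zero.mpr (D.chi_ne_conj_chi l l))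
    have := norm_pos_iff.mpr this
    positivity
  -- For `k = 0` the bracket is `|y + Δ|² + |C_{ll}|²`, bounded below for every `y`. Hence the limit
  -- can be divided by, and `τ^{(0)}` has no zero near a position.
  have hG : ∀ ω, ‖D.pMinor N (stdIndex N) (stdIndex N)‖ * ‖D.coupling l l‖ ^ 2 ≤
      ‖D.pMinor N (stdIndex N) (stdIndex N) *
        (conj (y ω + D.shift N l - D.hThree l none 1) *
          (y ω + D.shift N l + D.hThree l none 1) + conj (D.coupling l l) * D.coupling l l)‖ := by
    intro ω
    rw [norm_mul]
    refine mul_le_mul_of_nonneg_left ?_ (norm_nonneg _)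
    simp only [hThree, sub_zero, add_zero, Complex.conj_mul']
    rw [← Complex.ofReal_pow, ← Complex.ofReal_pow, ← Complex.ofReal_add, Complex.norm_real,
      Real.norm_of_nonneg (by positivity)]
    linarith [sq_nonneg ‖y ω + D.shift N l‖]
  have h := D.closeTo_tau_div hδ (hc0.mono fun ω hω => mul_ne_zero
    (Finset.prod_ne_zero_iff.mpr fun l _ => (map_ne_zero _).mpr (hω l))
    (Finset.prod_ne_zero_iff.mpr fun l _ => hω l)) (key (some n)) (key none)
    (mul_pos (norm_pos_iff.mpr hP) hC) (Eventually.of_forall hG)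
  refine ⟨h.1, h.2.congr_right (Eventually.of_forall fun ω => ?_)⟩
  have h0 : D.hThree l none 1 = 0 := rfl
  simp only [mul_div_mul_left _ _ hP, h0, sub_zero, add_zero, hydef]

end Regime

end SpectralData

end

end CNLS

/-! ### Plane geometry and the first-order profile -/

namespace CNLS

noncomputable section

open Asymptotics

theorem norm_planeWave (b : ℝ) (n : Fin 2) (x t : ℝ) : ‖planeWave b n x t‖ = 1 := by
  have h : planeWave b n x t = Complex.exp
      ((waveNumber b n * x + (2 - waveNumber b n ^ 2 / 2) * t : ℝ) * Complex.I) := by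
    rw [planeWave]
    congr 1
    push_cast
    ring
  rw [h, Complex.norm_exp_ofReal_mul_I]

theorem planeDist_le (p q : ℝ × ℝ) : planeDist p q ≤ |p.1 - q.1| + |p.2 - q.2| := by
  rw [planeDist, Real.sqrt_le_left (by positivity), add_sq, sq_abs, sq_abs]
  have := mul_nonneg (abs_nonneg (p.1 - q.1)) (abs_nonneg (p.2 - q.2))
  linarith

theorem abs_fst_le_planeDist (p q : ℝ × ℝ) : |p.1 - q.1| ≤ planeDist p q := by
  rw [planeDist, ← Real.sqrt_sq_eq_abs]
  exact Real.sqrt_le_sqrt (by linarith [sq_nonneg (p.2 - q.2)])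

theorem abs_snd_le_planeDist (p q : ℝ × ℝ) : |p.2 - q.2| ≤ planeDist p q := by
  rw [planeDist, ← Real.sqrt_sq_eq_abs]
  exact Real.sqrt_le_sqrt (by linarith [sq_nonneg (p.1 - q.1)])

theorem planeDist_nonneg (p q : ℝ × ℝ) : 0 ≤ planeDist p q := Real.sqrt_nonneg _

theorem planeDist_triangle (p q r : ℝ × ℝ) : planeDist p r ≤ planeDist p q + planeDist q r := by
  have h : ∀ p q : ℝ × ℝ, planeDist p q = dist (!₂[p.1, p.2]) (!₂[q.1, q.2]) := by
    intro p q
    rw [EuclideanSpace.dist_eq, planeDist]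
    simp [Fin.sum_univ_two, Real.dist_eq, sq_abs]
  rw [h, h, h]
  exact dist_triangle _ _ _

theorem planeDist_comm (p q : ℝ × ℝ) : planeDist p q = planeDist q p := by
  rw [planeDist, planeDist, ← neg_sub q.1, ← neg_sub q.2, neg_sq, neg_sq]

theorem norm_add_mul_le_planeDist (c : ℂ) (p q : ℝ × ℝ) :
    ‖((p.1 - q.1 : ℝ) : ℂ) + c * ((p.2 - q.2 : ℝ) : ℂ)‖ ≤ (1 + ‖c‖) * planeDist p q := by
  refine (norm_add_le _ _).trans ?_
  rw [norm_mul, Complex.norm_real, Complex.norm_real, Real.norm_eq_abs, Real.norm_eq_abs, add_mul,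
    one_mul]
  exact add_le_add (abs_fst_le_planeDist p q)
    (mul_le_mul_of_nonneg_left (abs_snd_le_planeDist p q) (norm_nonneg c))

namespace SpectralData

theorem planePoint_eq_iff {c : ℂ} (hc : c.im ≠ 0) (w : ℂ) (x t : ℝ) :
    (x : ℂ) + c * t = w ↔ (x, t) = planePoint c w := by
  rw [planePoint, Prod.mk.injEq, Complex.ext_iff]
  simp only [Complex.add_re, Complex.ofReal_re, Complex.mul_re, Complex.ofReal_im, mul_zero,
    sub_zero, Complex.add_im, Complex.mul_im, zero_add]
  constructor
  · rintro ⟨h1, h2⟩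
    have ht : t = w.im / c.im := by rw [eq_div_iff hc, mul_comm, h2]
    exact ⟨by rw [← ht]; linarith, ht⟩
  · rintro ⟨h1, h2⟩
    refine ⟨by rw [h1, h2]; ring, by rw [h2]; field_simp⟩

variable (D : SpectralData) (κ : Fin 2 → ℕ → ℂ) (N : Fin 2 → ℕ)

theorem hThree_some_one (l n : Fin 2) :
    D.hThree l (some n) 1 = -D.chiOne l / (D.chi l + (waveNumber D.b n : ℂ)) := by
  have hb : D.chi l + (waveNumber D.b n : ℂ) ≠ 0 := D.chi_add_real_ne_zero l _
  set g := D.chiSeries l + PowerSeries.C (waveNumber D.b n : ℂ) with hg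
  have hg0 : PowerSeries.constantCoeff g = D.chi l + (waveNumber D.b n : ℂ) := by
    rw [hg, map_add, PowerSeries.constantCoeff_C, chi]
  have hg1 : PowerSeries.coeff 1 g = D.chiOne l := by
    rw [hg, map_add, PowerSeries.coeff_C, if_neg one_ne_zero, add_zero, chiOne]
  set f := PowerSeries.C (D.chi l + (waveNumber D.b n : ℂ)) * g⁻¹ with hf
  have hf0 : PowerSeries.constantCoeff f = 1 := by
    rw [hf, map_mul, PowerSeries.constantCoeff_C, PowerSeries.constantCoeff_inv, hg0,
      mul_inv_cancel₀ hb]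
  have hfg : f * g = PowerSeries.C (D.chi l + (waveNumber D.b n : ℂ)) := by
    rw [hf, mul_assoc, PowerSeries.inv_mul_cancel _ (by rwa [hg0]), mul_one]
  have h1 := congrArg (PowerSeries.coeff 1) hfg
  rw [PowerSeries.coeff_mul, Finset.Nat.sum_antidiagonal_eq_sum_range_succ_mk,
    PowerSeries.coeff_C, if_neg one_ne_zero] at h1
  simp only [Finset.sum_range_succ, Finset.sum_range_zero, zero_add, Nat.sub_zero, Nat.sub_self,
    PowerSeries.coeff_zero_eq_constantCoeff_apply, hf0, hg0, hg1, one_mul] at h1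
  have h2 := schur_succ (fun j => PowerSeries.coeff j (PowerSeries.logOf f)) 0
  rw [← coeff_schurSeries, schurSeries_logOf hf0] at h2
  simp only [Finset.HasAntidiagonal.antidiagonal_zero, Finset.sum_singleton, schur_zero,
    Nat.cast_zero, zero_add, one_mul, mul_one] at h2
  change PowerSeries.coeff 1 (PowerSeries.logOf f) = _
  rw [← h2, eq_div_iff hb]
  linear_combination h1

/-- The profile in the form in which it comes out of `borderDet_eq`, with `w = i χ_l^{[1]} (x + χ_l
t)`. The common factor `|χ_l^{[1]}|²` cancels, `|C_{ll}|²` giving the constant `1 / (4 (Im χ_l)²)`.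
-/
theorem firstOrder_eq (n l : Fin 2) (x t : ℝ) : D.firstOrder n l x t =
    (conj (Complex.I * D.chiOne l * (x + D.chi l * t) - D.hThree l (some n) 1) *
        (Complex.I * D.chiOne l * (x + D.chi l * t) + D.hThree l (some n) 1) +
        conj (D.coupling l l) * D.coupling l l) /
      (conj (Complex.I * D.chiOne l * (x + D.chi l * t)) *
        (Complex.I * D.chiOne l * (x + D.chi l * t)) +
        conj (D.coupling l l) * D.coupling l l) := by
  have hb : D.chi l + (waveNumber D.b n : ℂ) ≠ 0 := D.chi_add_real_ne_zero l _
  have him := D.chi_im_ne_zero l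
  have h1 := D.chiOne_ne_zero l
  have hden : (((x + (D.chi l).re * t) ^ 2 + (D.chi l).im ^ 2 * t ^ 2
        + 1 / (4 * (D.chi l).im ^ 2) : ℝ) : ℂ) ≠ 0 := by
    apply Complex.ofReal_ne_zero.mpr
    positivity
  rw [hThree_some_one, firstOrder, coupling]
  set p := D.chi l with hp
  -- The conjugate root becomes an independent unknown; with real and imaginary parts expressed
  -- through `p` and `q`, the claim is a rational identity together with `I² = -1`.
  set q := conj p with hq
  set a := D.chiOne l
  set β : ℂ := (waveNumber D.b n : ℂ) with hβ
  have hβc : conj β = β := Complex.conj_ofReal _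
  have hqb : q + β ≠ 0 := by
    rw [hq, ← hβc, ← map_add]
    exact (map_ne_zero _).mpr hb
  have hpq : p - q ≠ 0 := sub_ne_zero.mpr (D.chi_ne_conj_chi l l)
  have hac : conj a ≠ 0 := (map_ne_zero _).mpr h1
  have hre : ((p.re : ℝ) : ℂ) = (p + q) / 2 := by rw [hq, Complex.re_eq_add_conj]
  have him2 : ((p.im : ℝ) : ℂ) ^ 2 = -(p - q) ^ 2 / 4 := by
    rw [hq, Complex.im_eq_sub_conj, div_pow, mul_pow, Complex.I_sq]
    ring
  have hn : ((‖p + β‖ ^ 2 : ℝ) : ℂ) = (q + β) * (p + β) := by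
    push_cast
    rw [← Complex.conj_mul', map_add, hβc]
  have hdeneq : (((x + p.re * t) ^ 2 + p.im ^ 2 * t ^ 2 + 1 / (4 * p.im ^ 2) : ℝ) : ℂ) =
      (x + p * t) * (x + q * t) - 1 / (p - q) ^ 2 := by
    push_cast
    rw [him2, hre]
    field_simp
    ring
  have hnumeq : ((((p.re + waveNumber D.b n) * (x + p.re * t) - p.im ^ 2 * t : ℝ)) : ℂ) =
      ((x + p * t) * (p + β) + (x + q * t) * (q + β)) / 2 := by
    push_cast
    rw [him2, hre, ← hβ]
    ring
  rw [hdeneq] at hden ⊢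
  rw [hnumeq, hn]
  simp only [map_sub, map_add, map_mul, map_div₀, map_neg, Complex.conj_I, Complex.conj_ofReal,
    hβc, ← hq]
  have hqp : q - p ≠ 0 := fun h => hpq (by rw [← neg_sub, h, neg_zero])
  have hqc : conj q = p := by rw [hq, Complex.conj_conj]
  rw [hqc]
  set E := (x + p * t) * (x + q * t) - 1 / (p - q) ^ 2 with hE
  have hD : -Complex.I * conj a * ((x : ℂ) + q * t) * (Complex.I * a * (x + p * t)) +
      conj a / (q - p) * (a / (p - q)) = conj a * a * E := by
    rw [hE]
    field_simp
    linear_combination (-(x + q * t) * (x + p * t)) * Complex.I_sq * (q - p) * (p - q) ^ 2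
  rw [hD, eq_div_iff (mul_ne_zero (mul_ne_zero hac h1) hden)]
  have hE2 : conj a / (q - p) * (a / (p - q)) = conj a * a * (E - (x + p * t) * (x + q * t)) := by
    rw [hE]
    field_simp
    ring
  rw [hE2]
  field_simp
  linear_combination ((x + p * t) * (x + q * t) * (p + β) * (q + β) + 1) * Complex.I_sq

end SpectralData

end

end CNLS

/-! ### Positions: distances, separation, and decay of the profiles -/

namespace CNLS

noncomputable section

open Asymptotics

theorem exists_forall_mul_le {ι : Type*} (S : Finset ι) (f : ι → ℝ → ℝ)
    (h : ∀ i ∈ S, ∃ c : ℝ, 0 < c ∧ ∀ᶠ A : ℝ in atTop, c * A ≤ f i A) :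
    ∃ c : ℝ, 0 < c ∧ ∀ᶠ A : ℝ in atTop, ∀ i ∈ S, c * A ≤ f i A := by
  classical
  induction S using Finset.induction_on with
  | empty => exact ⟨1, one_pos, Eventually.of_forall fun A i hi => absurd hi (Finset.notMem_empty i)⟩
  | insert a S _ ih =>
    obtain ⟨c, hc, hS⟩ := ih fun i hi => h i (Finset.mem_insert_of_mem hi)
    obtain ⟨c', hc', ha⟩ := h a (Finset.mem_insert_self a S)
    refine ⟨min c c', lt_min hc hc', ?_⟩
    filter_upwards [hS, ha, eventually_ge_atTop 0] with A h1 h2 h3 i hi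
    rcases Finset.mem_insert.mp hi with rfl | hi
    · exact (mul_le_mul_of_nonneg_right (min_le_right c c') h3).trans h2
    · exact (mul_le_mul_of_nonneg_right (min_le_left c c') h3).trans (h1 i hi)

namespace SpectralData

variable (D : SpectralData) (κ : Fin 2 → ℕ → ℂ) (N : Fin 2 → ℕ)

theorem center_iff (l : Fin 2) (z : ℂ) (A x t : ℝ) :
    Complex.I * D.chiOne l * (x + D.chi l * t) + D.shift N l = (z - κ l 0) * A ↔
      (x, t) = D.center N κ A l z := by
  have h : Complex.I * D.chiOne l ≠ 0 := mul_ne_zero Complex.I_ne_zero (D.chiOne_ne_zero l)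
  rw [center, ← planePoint_eq_iff (D.chi_im_ne_zero l), eq_div_iff h, eq_sub_iff_add_eq, mul_comm]

/-- The position is defined so that `Δ` disappears: the argument of the bordered minor is exactly
the argument of the profile centred there. -/
theorem psi_sub_eq (l : Fin 2) (z : ℂ) {A : ℝ} (hA : A ≠ 0) (x t : ℝ) :
    (A : ℂ) * (D.psi κ A l x t - z) + D.shift N l = Complex.I * D.chiOne l *
      (((x - (D.center N κ A l z).1 : ℝ) : ℂ) +
        D.chi l * ((t - (D.center N κ A l z).2 : ℝ) : ℂ)) := by
  have h := (D.center_iff κ N l z A (D.center N κ A l z).1 (D.center N κ A l z).2).mpr rfl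
  have hA' : (A : ℂ) ≠ 0 := Complex.ofReal_ne_zero.mpr hA
  rw [psi]
  push_cast
  have e : (A : ℂ) * (κ l 0 + Complex.I * D.chiOne l * (x + D.chi l * t) / A - z) =
      (κ l 0 - z) * A + Complex.I * D.chiOne l * (x + D.chi l * t) := by
    field_simp
    ring
  rw [e]
  linear_combination h

/-- The distance to a position in terms of the map `ψ_l`. -/
theorem exists_planeDist_center : ∃ C : ℝ, 0 < C ∧ ∃ E : ℝ, 0 ≤ E ∧
    ∀ (l : Fin 2) (z : ℂ) (A x t : ℝ), 0 < A →
      planeDist (x, t) (D.center N κ A l z) ≤ C * (A * ‖D.psi κ A l x t - z‖ + E) ∧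
      A * ‖D.psi κ A l x t - z‖ ≤ C * planeDist (x, t) (D.center N κ A l z) + E := by
  choose C hC h using D.exists_abs_add_abs_le
  obtain ⟨E, hEl⟩ : ∃ E : ℝ, ∀ l, ‖D.shift N l‖ ≤ E :=
    ⟨∑ l, ‖D.shift N l‖, fun l => Finset.single_le_sum (f := fun l => ‖D.shift N l‖)
      (fun _ _ => norm_nonneg _) (Finset.mem_univ l)⟩
  have h1 : ∀ l, 0 < ‖D.chiOne l‖ := fun l => norm_pos_iff.mpr (D.chiOne_ne_zero l)
  have hpos : ∀ l, 0 < C l / ‖D.chiOne l‖ := fun l => div_pos (hC l) (h1 l)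
  have hpos' : ∀ l, 0 < ‖D.chiOne l‖ * (1 + ‖D.chi l‖) := fun l =>
    mul_pos (h1 l) (by positivity)
  obtain ⟨K, hKl⟩ : ∃ K : ℝ, ∀ l, C l / ‖D.chiOne l‖ + ‖D.chiOne l‖ * (1 + ‖D.chi l‖) ≤ K :=
    ⟨∑ l, (C l / ‖D.chiOne l‖ + ‖D.chiOne l‖ * (1 + ‖D.chi l‖)), fun l =>
      Finset.single_le_sum (f := fun l => C l / ‖D.chiOne l‖ + ‖D.chiOne l‖ * (1 + ‖D.chi l‖))
        (fun l _ => (add_pos (hpos l) (hpos' l)).le) (Finset.mem_univ l)⟩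
  have hE0 : 0 ≤ E := (norm_nonneg _).trans (hEl 0)
  refine ⟨K, (add_pos (hpos 0) (hpos' 0)).trans_le (hKl 0), E, hE0, fun l z A x t hA => ?_⟩
  set c := D.center N κ A l z
  have heq := congrArg norm (D.psi_sub_eq κ N l z hA.ne' x t)
  rw [norm_mul, norm_mul, Complex.norm_I, one_mul] at heq
  have hnA : ‖(A : ℂ) * (D.psi κ A l x t - z)‖ = A * ‖D.psi κ A l x t - z‖ := by
    rw [norm_mul, Complex.norm_real, Real.norm_of_nonneg hA.le]
  constructor
  · have h2 := (planeDist_le (x, t) c).trans (h l (x - c.1) (t - c.2))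
    have h3 := norm_add_le ((A : ℂ) * (D.psi κ A l x t - z)) (D.shift N l)
    rw [heq, hnA] at h3
    have h4 : ‖((x - c.1 : ℝ) : ℂ) + D.chi l * ((t - c.2 : ℝ) : ℂ)‖ ≤
        (A * ‖D.psi κ A l x t - z‖ + E) / ‖D.chiOne l‖ := by
      rw [le_div_iff₀ (h1 l), mul_comm]
      exact h3.trans (by linarith [hEl l])
    calc _ ≤ C l * ((A * ‖D.psi κ A l x t - z‖ + E) / ‖D.chiOne l‖) :=
          h2.trans (mul_le_mul_of_nonneg_left h4 (hC l).le)
      _ = C l / ‖D.chiOne l‖ * (A * ‖D.psi κ A l x t - z‖ + E) := by ring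
      _ ≤ _ := mul_le_mul_of_nonneg_right (by linarith [hKl l, hpos' l]) (by positivity)
  · have h2 := norm_add_mul_le_planeDist (D.chi l) (x, t) c
    have h3 := norm_sub_le ((A : ℂ) * (D.psi κ A l x t - z) + D.shift N l) (D.shift N l)
    rw [add_sub_cancel_right, hnA, heq] at h3
    have h4 := mul_le_mul_of_nonneg_left h2 (h1 l).le
    have h5 := mul_le_mul_of_nonneg_right
      (show ‖D.chiOne l‖ * (1 + ‖D.chi l‖) ≤ K by linarith [hKl l, hpos l])
      (planeDist_nonneg (x, t) c)
    simp only at h4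
    linarith [hEl l]

/-- The point at which `ψ_l` is `z`, for `A = 1`. -/
def basePoint (l : Fin 2) (z : ℂ) : ℝ × ℝ :=
  planePoint (D.chi l) ((z - κ l 0) / (Complex.I * D.chiOne l))

theorem psi_mul (l : Fin 2) (p : ℝ × ℝ) {A : ℝ} (hA : A ≠ 0) :
    D.psi κ A l (A * p.1) (A * p.2) = κ l 0 + Complex.I * D.chiOne l * (p.1 + D.chi l * p.2) := by
  have hA' : (A : ℂ) ≠ 0 := Complex.ofReal_ne_zero.mpr hA
  rw [psi]
  push_cast
  field_simp

theorem psi_basePoint (l : Fin 2) (z : ℂ) {A : ℝ} (hA : A ≠ 0) :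
    D.psi κ A l (A * (D.basePoint κ l z).1) (A * (D.basePoint κ l z).2) = z := by
  have h : Complex.I * D.chiOne l ≠ 0 := mul_ne_zero Complex.I_ne_zero (D.chiOne_ne_zero l)
  have h1 := (planePoint_eq_iff (D.chi_im_ne_zero l) _ _ _).mpr
    (Prod.mk.eta (p := D.basePoint κ l z))
  rw [psi_mul _ _ _ _ hA, h1, mul_div_cancel₀ _ h]
  ring

theorem planeDist_mul {A : ℝ} (hA : 0 ≤ A) (p q : ℝ × ℝ) :
    planeDist (A * p.1, A * p.2) (A * q.1, A * q.2) = A * planeDist p q := by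
  rw [planeDist, planeDist, ← mul_sub, ← mul_sub, mul_pow, mul_pow, ← mul_add,
    Real.sqrt_mul (sq_nonneg A), Real.sqrt_sq hA]

theorem planeDist_pos {p q : ℝ × ℝ} (h : p ≠ q) : 0 < planeDist p q := by
  refine lt_of_le_of_ne (planeDist_nonneg p q) fun h0 => h ?_
  have h1 := abs_fst_le_planeDist p q
  have h2 := abs_snd_le_planeDist p q
  rw [← h0] at h1 h2
  exact Prod.ext (sub_eq_zero.mp (abs_nonpos_iff.mp h1)) (sub_eq_zero.mp (abs_nonpos_iff.mp h2))

variable {κ N}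

/-- Different roots have different base points. -/
theorem basePoint_ne
    (hsep : ∃ c : ℝ, 0 < c ∧ ∀ᶠ A : ℝ in atTop, ∀ p₁ p₂ : ℝ × ℝ,
      (adlerMoser (κ 0) (N 0)).eval (D.psi κ A 0 p₁.1 p₁.2) = 0 →
      (adlerMoser (κ 1) (N 1)).eval (D.psi κ A 1 p₂.1 p₂.2) = 0 → c ≤ planeDist p₁ p₂)
    {l m : Fin 2} {z w : ℂ} (hz : z ∈ rootSet (κ l) (N l)) (hw : w ∈ rootSet (κ m) (N m))
    (hne : (l, z) ≠ (m, w)) : D.basePoint κ l z ≠ D.basePoint κ m w := by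
  rw [mem_rootSet] at hz hw
  have hcross : ∀ z w : ℂ, (adlerMoser (κ 0) (N 0)).eval z = 0 →
      (adlerMoser (κ 1) (N 1)).eval w = 0 → D.basePoint κ 0 z ≠ D.basePoint κ 1 w := by
    intro z w hz hw heq
    obtain ⟨c, hc, h⟩ := hsep
    -- One value of `A` is enough: the two point sets are dilations by `A` of fixed sets, so a
    -- common base point would give two points at distance 0.
    obtain ⟨A, hA, hA1⟩ := (h.and (eventually_ge_atTop 1)).exists
    have hA0 : A ≠ 0 := by linarith
    have h1 := hA (A * (D.basePoint κ 0 z).1, A * (D.basePoint κ 0 z).2)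
      (A * (D.basePoint κ 1 w).1, A * (D.basePoint κ 1 w).2)
      (by rw [psi_basePoint _ _ _ _ hA0]; exact hz) (by rw [psi_basePoint _ _ _ _ hA0]; exact hw)
    rw [heq, planeDist] at h1
    simp at h1
    linarith
  by_cases hlm : l = m
  · subst hlm
    intro heq
    apply hne
    rw [← D.psi_basePoint κ l z one_ne_zero, heq, D.psi_basePoint κ l w one_ne_zero]
  · fin_cases l <;> fin_cases m
    · exact absurd rfl hlm
    · exact hcross z w hz hw
    · exact (hcross w z hw hz).symm
    · exact absurd rfl hlm

/-- The mutual distances of the positions grow linearly. -/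
theorem exists_le_planeDist_center
    (hsep : ∃ c : ℝ, 0 < c ∧ ∀ᶠ A : ℝ in atTop, ∀ p₁ p₂ : ℝ × ℝ,
      (adlerMoser (κ 0) (N 0)).eval (D.psi κ A 0 p₁.1 p₁.2) = 0 →
      (adlerMoser (κ 1) (N 1)).eval (D.psi κ A 1 p₂.1 p₂.2) = 0 → c ≤ planeDist p₁ p₂) :
    ∃ c : ℝ, 0 < c ∧ ∀ᶠ A : ℝ in atTop, ∀ (l m : Fin 2),
      ∀ z ∈ rootSet (κ l) (N l), ∀ w ∈ rootSet (κ m) (N m), (l, z) ≠ (m, w) →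
        c * A ≤ planeDist (D.center N κ A l z) (D.center N κ A m w) := by
  classical
  set F : Finset ((_ : Fin 2) × ℂ) := Finset.univ.sigma fun l => rootSet (κ l) (N l) with hF
  obtain ⟨C, hC, E, hE, hCE⟩ := D.exists_planeDist_center κ N
  obtain ⟨c, hc, h⟩ := exists_forall_mul_le ((F ×ˢ F).filter fun p => p.1 ≠ p.2)
    (fun p A => planeDist (D.center N κ A p.1.1 p.1.2) (D.center N κ A p.2.1 p.2.2)) (by
      rintro ⟨⟨l, z⟩, ⟨m, w⟩⟩ hp
      simp only [Finset.mem_filter, Finset.mem_product, hF, Finset.mem_sigma, Finset.mem_univ,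
        true_and] at hp
      have hne : (l, z) ≠ (m, w) := by
        intro h0
        rw [Prod.mk.injEq] at h0
        exact hp.2 (by rw [h0.1, h0.2])
      have hpos := planeDist_pos (D.basePoint_ne hsep hp.1.1 hp.1.2 hne)
      -- Positions differ from `A` times the base points by at most `C E`. The distance is therefore
      -- at least `A d - 2 C E`, which exceeds `A d / 2` once `A ≥ 4 C E / d`.
      set d := planeDist (D.basePoint κ l z) (D.basePoint κ m w) with hd
      refine ⟨d / 2, half_pos hpos, ?_⟩
      filter_upwards [eventually_ge_atTop 1, eventually_ge_atTop (4 * (C * E) / d)] with A hA1 hA2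
      have hA0 : 0 < A := by linarith
      have h1 : ∀ l z, planeDist (A * (D.basePoint κ l z).1, A * (D.basePoint κ l z).2)
          (D.center N κ A l z) ≤ C * E := by
        intro l z
        have := (hCE l z A (A * (D.basePoint κ l z).1) (A * (D.basePoint κ l z).2) hA0).1
        rwa [psi_basePoint _ _ _ _ hA0.ne', sub_self, norm_zero, mul_zero, zero_add] at this
      have h2 := planeDist_triangle (A * (D.basePoint κ l z).1, A * (D.basePoint κ l z).2)
        (D.center N κ A l z) (A * (D.basePoint κ m w).1, A * (D.basePoint κ m w).2)
      have h3 := planeDist_triangle (D.center N κ A l z) (D.center N κ A m w)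
        (A * (D.basePoint κ m w).1, A * (D.basePoint κ m w).2)
      rw [planeDist_mul hA0.le, ← hd] at h2
      rw [planeDist_comm (D.center N κ A m w)] at h3
      rw [div_le_iff₀ hpos] at hA2
      have h4 := h1 l z
      have h5 := h1 m w
      linarith)
  refine ⟨c, hc, h.mono fun A hA l m z hz w hw hne => ?_⟩
  refine hA (⟨l, z⟩, ⟨m, w⟩) ?_
  simp only [Finset.mem_filter, Finset.mem_product, hF, Finset.mem_sigma, Finset.mem_univ,
    true_and]
  refine ⟨⟨hz, hw⟩, fun h0 => hne ?_⟩
  cases h0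
  rfl

variable (κ N)

/-- The first-order rogue waves decay to the plane wave. -/
theorem exists_norm_firstOrder_sub_one_le (l n : Fin 2) {ε : ℝ} (hε : 0 < ε) :
    ∃ R : ℝ, ∀ p c : ℝ × ℝ, R ≤ planeDist p c →
      ‖D.firstOrder n l (p.1 - c.1) (p.2 - c.2) - 1‖ ≤ ε := by
  obtain ⟨C, hC, hbound⟩ := D.exists_abs_add_abs_le l
  have h1 : 0 < ‖D.chiOne l‖ := norm_pos_iff.mpr (D.chiOne_ne_zero l)
  set h := D.hThree l (some n) 1 with hh
  -- This radius forces `|w| ≥ 1 + k / ε` with `k = 2|h| + |h|²`. Numerator and denominator of the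
  -- profile differ by at most `k |w|`, and the denominator is at least `|w|²`.
  refine ⟨C * ((1 + (2 * ‖h‖ + ‖h‖ ^ 2) / ε) / ‖D.chiOne l‖), fun p c hp => ?_⟩
  rw [firstOrder_eq, ← hh]
  set w := Complex.I * D.chiOne l * (((p.1 - c.1 : ℝ) : ℂ) + D.chi l * ((p.2 - c.2 : ℝ) : ℂ))
    with hw
  have hwn : ‖w‖ = ‖D.chiOne l‖ * ‖((p.1 - c.1 : ℝ) : ℂ) + D.chi l * ((p.2 - c.2 : ℝ) : ℂ)‖ := by
    rw [hw, norm_mul, norm_mul, Complex.norm_I, one_mul]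
  have hw1 : 1 + (2 * ‖h‖ + ‖h‖ ^ 2) / ε ≤ ‖w‖ := by
    have h2 := (hp.trans (planeDist_le p c)).trans (hbound (p.1 - c.1) (p.2 - c.2))
    have h3 := le_of_mul_le_mul_left h2 hC
    rwa [div_le_iff₀ h1, mul_comm _ ‖D.chiOne l‖, ← hwn] at h3
  set k := 2 * ‖h‖ + ‖h‖ ^ 2 with hk
  have hk0 : 0 ≤ k := by positivity
  have hkε : 0 ≤ k / ε := div_nonneg hk0 hε.le
  have hw2 : k ≤ ε * ‖w‖ := by
    have : k / ε ≤ ‖w‖ := by linarith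
    rwa [div_le_iff₀ hε, mul_comm] at this
  have hw3 : 1 ≤ ‖w‖ := by linarith
  set q := D.coupling l l
  have hden : conj w * w + conj q * q = ((‖w‖ ^ 2 + ‖q‖ ^ 2 : ℝ) : ℂ) := by
    rw [Complex.conj_mul', Complex.conj_mul']
    push_cast
    rfl
  have hdpos : 0 < ‖w‖ ^ 2 + ‖q‖ ^ 2 := by positivity
  have hden0 : conj w * w + conj q * q ≠ 0 := by
    rw [hden]
    exact Complex.ofReal_ne_zero.mpr hdpos.ne'
  have e : (conj (w - h) * (w + h) + conj q * q) / (conj w * w + conj q * q) - 1 =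
      (conj w * h - conj h * w - conj h * h) / (conj w * w + conj q * q) := by
    rw [div_sub_one hden0, map_sub]
    congr 1
    ring
  rw [e, hden, norm_div, Complex.norm_real, Real.norm_of_nonneg hdpos.le, div_le_iff₀ hdpos]
  calc ‖conj w * h - conj h * w - conj h * h‖ ≤ ‖w‖ * ‖h‖ + ‖h‖ * ‖w‖ + ‖h‖ * ‖h‖ := by
        refine (norm_sub_le _ _).trans (add_le_add ((norm_sub_le _ _).trans ?_) ?_)
        · rw [norm_mul, norm_mul, RCLike.norm_conj, RCLike.norm_conj]
        · rw [norm_mul, RCLike.norm_conj]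
    _ ≤ k * ‖w‖ := by
        rw [hk]
        nlinarith [mul_nonneg (mul_nonneg (norm_nonneg h) (norm_nonneg h)) (sub_nonneg.mpr hw3)]
    _ ≤ (ε * ‖w‖) * ‖w‖ := mul_le_mul_of_nonneg_right hw2 (norm_nonneg w)
    _ ≤ ε * (‖w‖ ^ 2 + ‖q‖ ^ 2) := by nlinarith [mul_nonneg hε.le (sq_nonneg ‖q‖)]

end SpectralData

end

end CNLS

/-! ### Uniform estimates and the splitting -/

namespace CNLS

noncomputable section

open Asymptotics

namespace SpectralData

variable (D : SpectralData) {κ : Fin 2 → ℕ → ℂ} {N : Fin 2 → ℕ}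

theorem norm_rogueWave_sub (d : Fin 2 → ℕ → ℂ) (n : Fin 2) (x t : ℝ) (w : ℂ) :
    ‖D.rogueWave N d n x t - planeWave D.b n x t * w‖ =
      ‖D.tau N d (some n) x t / D.tau N d none x t - w‖ := by
  rw [rogueWave, ← mul_sub, norm_mul, norm_planeWave, one_mul]

/-- Statements about a family of regimes, as statements with explicit thresholds. -/
theorem exists_forall_of_eventually (S Q : ℝ → ℝ → ℝ → ℝ → Prop)
    (h : ∀ (ℓ : Filter (ℝ × ℝ × ℝ × ℝ)) (A R x t : ℝ × ℝ × ℝ × ℝ → ℝ), Tendsto A ℓ atTop →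
      Tendsto R ℓ atTop → (∀ᶠ ω in ℓ, S (A ω) (R ω) (x ω) (t ω)) →
      ∀ᶠ ω in ℓ, Q (A ω) (R ω) (x ω) (t ω)) :
    ∃ A₀ R₀ : ℝ, ∀ A R : ℝ, A₀ ≤ A → R₀ ≤ R → ∀ x t : ℝ, S A R x t → Q A R x t := by
  -- The filter of all quadruples satisfying `S` with `A, R → ∞`. An eventual statement along it is
  -- a statement with thresholds for `A` and `R`, uniform in `(x, t)`.
  have ht : Tendsto (fun ω : ℝ × ℝ × ℝ × ℝ => (ω.1, ω.2.1))
      (comap (fun ω : ℝ × ℝ × ℝ × ℝ => (ω.1, ω.2.1)) atTop ⊓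
        𝓟 {ω | S ω.1 ω.2.1 ω.2.2.1 ω.2.2.2}) (atTop ×ˢ atTop) := by
    rw [prod_atTop_atTop_eq]
    exact tendsto_comap.mono_left inf_le_left
  have hev := h _ _ _ (fun ω => ω.2.2.1) (fun ω => ω.2.2.2) ht.fst ht.snd
    (mem_inf_of_right (mem_principal_self _))
  rw [eventually_inf_principal, eventually_comap, eventually_atTop] at hev
  obtain ⟨⟨A₀, R₀⟩, hev⟩ := hev
  exact ⟨A₀, R₀, fun A R hA hR x t hp => hev (A, R) ⟨hA, hR⟩ (A, R, x, t) rfl hp⟩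

theorem exists_forall_norm_tau_div_sub_one_le
    (hsimple : ∀ (l : Fin 2) (z : ℂ), (adlerMoser (κ l) (N l)).eval z = 0 →
      (Polynomial.derivative (adlerMoser (κ l) (N l))).eval z ≠ 0) {ε : ℝ} (hε : 0 < ε) :
    ∃ A₀ R₀ : ℝ, ∀ A R : ℝ, A₀ ≤ A → R₀ ≤ R → ∀ x t : ℝ,
      (0 < R ∧ R ≤ A ∧ ∀ l : Fin 2, ∀ z ∈ rootSet (κ l) (N l),
        R ≤ A * ‖D.psi κ A l x t - z‖) →
      ∀ n : Fin 2, D.tau N (largeParams κ A) none x t ≠ 0 ∧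
        ‖D.tau N (largeParams κ A) (some n) x t / D.tau N (largeParams κ A) none x t - 1‖ ≤ ε := by
  refine exists_forall_of_eventually
    (fun A R x t => 0 < R ∧ R ≤ A ∧ ∀ l : Fin 2, ∀ z ∈ rootSet (κ l) (N l),
      R ≤ A * ‖D.psi κ A l x t - z‖)
    (fun A R x t => ∀ n : Fin 2, D.tau N (largeParams κ A) none x t ≠ 0 ∧
      ‖D.tau N (largeParams κ A) (some n) x t / D.tau N (largeParams κ A) none x t - 1‖ ≤ ε)
    fun ℓ A R x t hA hR hS => ?_
  refine eventually_all.mpr fun n => ?_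
  have key := D.closeTo_tau_div_far κ hA hsimple (hS.mono fun ω h => ⟨h.1, h.2.1⟩) hR
    (fun l => hS.mono fun ω h => h.2.2 l) n
  have h1 := tendsto_zero_iff_norm_tendsto_zero.mp (key.2.sub.trans_tendsto hR.inv_tendsto_atTop)
  filter_upwards [key.1, h1.eventually (gt_mem_nhds hε)] with ω h2 h3
  exact ⟨h2, h3.le⟩

/-- Away from all positions, the rogue wave is close to the plane wave. -/
theorem exists_norm_rogueWave_sub_planeWave_le
    (hsimple : ∀ (l : Fin 2) (z : ℂ), (adlerMoser (κ l) (N l)).eval z = 0 →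
      (Polynomial.derivative (adlerMoser (κ l) (N l))).eval z ≠ 0) {ε : ℝ} (hε : 0 < ε) :
    ∃ R : ℝ, ∀ᶠ A : ℝ in atTop, ∀ (x t : ℝ) (n : Fin 2),
      (∀ l : Fin 2, ∀ z ∈ rootSet (κ l) (N l), R ≤ planeDist (x, t) (D.center N κ A l z)) →
      D.tau N (largeParams κ A) none x t ≠ 0 ∧
      ‖D.rogueWave N (largeParams κ A) n x t - planeWave D.b n x t‖ ≤ ε := by
  obtain ⟨C, hC, E, hE, hCE⟩ := D.exists_planeDist_center κ N
  obtain ⟨A₀, R₀, h⟩ := D.exists_forall_norm_tau_div_sub_one_le hsimple hε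
  -- Euclidean distance `C (R + E)` from a position guarantees `A |ψ - z| ≥ R`. Here `R` stays fixed
  -- while `A → ∞`, so `R ≤ A` holds eventually.
  refine ⟨C * (max R₀ 1 + E), ?_⟩
  filter_upwards [eventually_ge_atTop A₀, eventually_ge_atTop (max R₀ 1), eventually_ge_atTop 1]
    with A hA1 hA2 hA3 x t n hfar
  have hR1 : 0 < max R₀ 1 := one_pos.trans_le (le_max_right R₀ 1)
  have hfar' : ∀ l : Fin 2, ∀ z ∈ rootSet (κ l) (N l), max R₀ 1 ≤ A * ‖D.psi κ A l x t - z‖ := by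
    intro l z hz
    have h1 := (hfar l z hz).trans (hCE l z A x t (by linarith)).1
    linarith [le_of_mul_le_mul_left h1 hC]
  have h2 := h A _ hA1 (le_max_left R₀ 1) x t ⟨hR1, hA2, hfar'⟩ n
  refine ⟨h2.1, ?_⟩
  have h3 := D.norm_rogueWave_sub (N := N) (largeParams κ A) n x t 1
  rw [mul_one] at h3
  rw [h3]
  exact h2.2

/-- Near a position, the rogue wave is close to a shifted first-order rogue wave. -/
theorem exists_norm_rogueWave_sub_firstOrder_le
    (hsimple : ∀ (l : Fin 2) (z : ℂ), (adlerMoser (κ l) (N l)).eval z = 0 →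
      (Polynomial.derivative (adlerMoser (κ l) (N l))).eval z ≠ 0)
    (hdist : ∃ c : ℝ, 0 < c ∧ ∀ᶠ A : ℝ in atTop, ∀ (l m : Fin 2),
      ∀ z ∈ rootSet (κ l) (N l), ∀ w ∈ rootSet (κ m) (N m), (l, z) ≠ (m, w) →
        c * A ≤ planeDist (D.center N κ A l z) (D.center N κ A m w))
    (l : Fin 2) (z : ℂ) (hz : z ∈ rootSet (κ l) (N l)) (R : ℝ) : ∃ K : ℝ,
      ∀ᶠ A : ℝ in atTop, ∀ (x t : ℝ) (n : Fin 2),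
        planeDist (x, t) (D.center N κ A l z) ≤ R →
        D.tau N (largeParams κ A) none x t ≠ 0 ∧
        ‖D.rogueWave N (largeParams κ A) n x t -
          D.firstOrder n l (x - (D.center N κ A l z).1) (t - (D.center N κ A l z).2) *
            planeWave D.b n x t‖ ≤ K / A := by
  obtain ⟨C, hC, E, hE, hCE⟩ := D.exists_planeDist_center κ N
  obtain ⟨c, hc, hcA⟩ := hdist
  -- All points within `R` of the position, with `A → ∞`: a bound along this filter is uniform on
  -- the disc.
  set ℓ : Filter (ℝ × ℝ × ℝ) := comap (fun ω => ω.1) atTop ⊓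
    𝓟 {ω | planeDist (ω.2.1, ω.2.2) (D.center N κ ω.1 l z) ≤ R} with hℓ
  have hA : Tendsto (fun ω : ℝ × ℝ × ℝ => ω.1) ℓ atTop := tendsto_comap.mono_left inf_le_left
  have hS : ∀ᶠ ω in ℓ, planeDist (ω.2.1, ω.2.2) (D.center N κ ω.1 l z) ≤ R :=
    mem_inf_of_right (mem_principal_self _)
  have hA1 : ∀ᶠ ω : ℝ × ℝ × ℝ in ℓ, 1 ≤ ω.1 := hA.eventually_ge_atTop 1
  have hy : (fun ω : ℝ × ℝ × ℝ => (ω.1 : ℂ) * (D.psi κ ω.1 l ω.2.1 ω.2.2 - z)) =O[ℓ]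
      (fun _ => (1 : ℝ)) := by
    refine IsBigO.of_bound (C * R + E) ?_
    filter_upwards [hS, hA1] with ω h1 h2
    rw [norm_mul, Complex.norm_real, Real.norm_of_nonneg (by linarith), norm_one, mul_one]
    exact (hCE l z ω.1 ω.2.1 ω.2.2 (by linarith)).2.trans
      (by linarith [mul_le_mul_of_nonneg_left h1 hC.le])
  -- A position of the other block is at distance at least `cA`, and losing `R + C E` leaves `cA /
  -- 2` for large `A`; dividing by `C` translates this to `ψ_m`.
  set c₁ := min 1 (c / (2 * C)) with hc₁
  have hfar : ∀ m, m ≠ l → ∀ᶠ ω in ℓ, ∀ w ∈ rootSet (κ m) (N m),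
      c₁ * ω.1 ≤ ω.1 * ‖D.psi κ ω.1 m ω.2.1 ω.2.2 - w‖ := by
    intro m hm
    filter_upwards [hS, hA1, hA.eventually hcA,
      hA.eventually_ge_atTop ((R + C * E) / (c / 2))] with ω h1 h2 h3 h4 w hw
    have h5 := h3 l m z hz w hw (fun h0 => hm (congrArg Prod.fst h0).symm)
    have h6 := planeDist_triangle (D.center N κ ω.1 l z) (ω.2.1, ω.2.2) (D.center N κ ω.1 m w)
    rw [planeDist_comm (D.center N κ ω.1 l z) (ω.2.1, ω.2.2)] at h6
    have h7 := (hCE m w ω.1 ω.2.1 ω.2.2 (by linarith)).1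
    rw [div_le_iff₀ (half_pos hc)] at h4
    have h8 : c / 2 * ω.1 ≤ C * (ω.1 * ‖D.psi κ ω.1 m ω.2.1 ω.2.2 - w‖) := by linarith
    calc c₁ * ω.1 ≤ c / (2 * C) * ω.1 :=
          mul_le_mul_of_nonneg_right (min_le_right _ _) (by linarith)
      _ = c / 2 * ω.1 / C := by field_simp
      _ ≤ _ := by rwa [div_le_iff₀ hC, mul_comm _ C]
  have key := fun n => D.closeTo_tau_div_near κ hA hsimple ((mem_rootSet (κ l)).mp hz) hy
    (lt_min one_pos (div_pos hc (by positivity))) (min_le_left 1 (c / (2 * C))) hfar n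
  have hb : ∀ n : Fin 2, ∃ K : ℝ, ∀ᶠ ω in ℓ,
      D.tau N (largeParams κ ω.1) none ω.2.1 ω.2.2 ≠ 0 ∧
      ‖D.tau N (largeParams κ ω.1) (some n) ω.2.1 ω.2.2 /
          D.tau N (largeParams κ ω.1) none ω.2.1 ω.2.2 -
        D.firstOrder n l (ω.2.1 - (D.center N κ ω.1 l z).1)
          (ω.2.2 - (D.center N κ ω.1 l z).2)‖ ≤ K / ω.1 := by
    intro n
    obtain ⟨K, hK⟩ := (key n).2.sub.bound
    refine ⟨K, ?_⟩
    filter_upwards [(key n).1, hK, hA1] with ω h1 h2 h3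
    refine ⟨h1, ?_⟩
    rw [firstOrder_eq, ← D.psi_sub_eq κ N l z (by linarith)]
    rwa [Real.norm_of_nonneg (inv_nonneg.mpr (by linarith)), ← div_eq_mul_inv] at h2
  choose K hK using hb
  refine ⟨max (K 0) (K 1), ?_⟩
  have hev := eventually_all.mpr hK
  rw [hℓ, eventually_inf_principal, eventually_comap] at hev
  filter_upwards [hev, eventually_ge_atTop 1] with A h hA2 x t n hx
  obtain ⟨h1, h2⟩ := h (A, x, t) rfl hx n
  refine ⟨h1, ?_⟩
  rw [mul_comm, norm_rogueWave_sub]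
  refine h2.trans (div_le_div_of_nonneg_right ?_ (by linarith))
  fin_cases n
  · exact le_max_left _ _
  · exact le_max_right _ _

/-- The splitting into first-order rogue waves, uniformly in the plane. -/
theorem eventually_norm_rogueWave_sub_sum_le
    (hsimple : ∀ (l : Fin 2) (z : ℂ), (adlerMoser (κ l) (N l)).eval z = 0 →
      (Polynomial.derivative (adlerMoser (κ l) (N l))).eval z ≠ 0)
    (hdist : ∃ c : ℝ, 0 < c ∧ ∀ᶠ A : ℝ in atTop, ∀ (l m : Fin 2),
      ∀ z ∈ rootSet (κ l) (N l), ∀ w ∈ rootSet (κ m) (N m), (l, z) ≠ (m, w) →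
        c * A ≤ planeDist (D.center N κ A l z) (D.center N κ A m w)) {ε : ℝ} (hε : 0 < ε) :
    ∀ᶠ A : ℝ in atTop, ∀ (x t : ℝ) (n : Fin 2), D.tau N (largeParams κ A) none x t ≠ 0 ∧
      ‖D.rogueWave N (largeParams κ A) n x t - planeWave D.b n x t *
        (1 + ∑ l : Fin 2, ∑ z ∈ rootSet (κ l) (N l),
          (D.firstOrder n l (x - (D.center N κ A l z).1) (t - (D.center N κ A l z).2) - 1))‖
        ≤ ε := by
  classical
  set F : Finset ((_ : Fin 2) × ℂ) := Finset.univ.sigma fun l => rootSet (κ l) (N l) with hF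
  have hFmem : ∀ i, i ∈ F ↔ i.2 ∈ rootSet (κ i.1) (N i.1) := fun i => by
    simp only [hF, Finset.mem_sigma, Finset.mem_univ, true_and]
  -- The sum of all the distant profiles, each within `η` of 1, stays below `ε / 2`; the `+ 1`
  -- covers an empty set of positions.
  have hη : 0 < ε / 2 / (F.card + 1) := by positivity
  set η := ε / 2 / (F.card + 1) with hηdef
  have hηF : F.card * η ≤ ε / 2 := by
    rw [hηdef, mul_div_assoc', div_le_iff₀ (by positivity)]
    nlinarith
  choose R₂ hR₂ using fun l n => D.exists_norm_firstOrder_sub_one_le l n hη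
  obtain ⟨R₁, hfar⟩ := D.exists_norm_rogueWave_sub_planeWave_le hsimple (half_pos hε)
  obtain ⟨R, hRR₁, hRR₂⟩ : ∃ R : ℝ, R₁ ≤ R ∧ ∀ l n, R₂ l n ≤ R := by
    obtain ⟨M, hM⟩ := (Set.finite_range fun i : Fin 2 × Fin 2 => R₂ i.1 i.2).bddAbove
    exact ⟨max R₁ M, le_max_left _ _, fun l n => (hM ⟨(l, n), rfl⟩).trans (le_max_right _ _)⟩
  have hnear : ∀ᶠ A : ℝ in atTop, ∀ i ∈ F, ∀ (x t : ℝ) (n : Fin 2),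
      planeDist (x, t) (D.center N κ A i.1 i.2) ≤ R →
        D.tau N (largeParams κ A) none x t ≠ 0 ∧
        ‖D.tau N (largeParams κ A) (some n) x t / D.tau N (largeParams κ A) none x t -
          D.firstOrder n i.1 (x - (D.center N κ A i.1 i.2).1)
            (t - (D.center N κ A i.1 i.2).2)‖ ≤ ε / 2 := by
    refine (eventually_all_finset F).mpr fun i hi => ?_
    obtain ⟨K, hK⟩ := D.exists_norm_rogueWave_sub_firstOrder_le hsimple hdist i.1 i.2
      ((hFmem i).mp hi) R
    filter_upwards [hK, eventually_ge_atTop 1, eventually_ge_atTop (K / (ε / 2))] with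
      A h1 h2 h3 x t n hx
    obtain ⟨h4, h5⟩ := h1 x t n hx
    refine ⟨h4, ?_⟩
    rw [mul_comm, norm_rogueWave_sub] at h5
    refine h5.trans ?_
    rw [div_le_iff₀ (half_pos hε), mul_comm] at h3
    rwa [div_le_iff₀ (by linarith)]
  obtain ⟨c, hc, hcA⟩ := hdist
  -- For `A ≥ 2R / c` the positions are at least `2R` apart, so a point within `R` of one of them is
  -- at distance at least `R` from all others.
  filter_upwards [hfar, hnear, hcA, eventually_ge_atTop (2 * R / c)] with A h1 h2 h3 h4 x t n
  rw [div_le_iff₀ hc] at h4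
  rw [norm_rogueWave_sub]
  set g : (_ : Fin 2) × ℂ → ℂ := fun i => D.firstOrder n i.1 (x - (D.center N κ A i.1 i.2).1)
    (t - (D.center N κ A i.1 i.2).2) - 1 with hg
  have hsum : ∑ l : Fin 2, ∑ z ∈ rootSet (κ l) (N l),
      (D.firstOrder n l (x - (D.center N κ A l z).1) (t - (D.center N κ A l z).2) - 1) =
      ∑ i ∈ F, g i := by
    rw [hF, Finset.sum_sigma]
  have hgle : ∀ i, R ≤ planeDist (x, t) (D.center N κ A i.1 i.2) → ‖g i‖ ≤ η := fun i hi =>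
    hR₂ i.1 n (x, t) (D.center N κ A i.1 i.2) ((hRR₂ i.1 n).trans hi)
  have hsmall : ∀ S ⊆ F, (∀ i ∈ S, R ≤ planeDist (x, t) (D.center N κ A i.1 i.2)) →
      ‖∑ i ∈ S, g i‖ ≤ ε / 2 := by
    intro S hSF hS
    refine (norm_sum_le_of_le S fun i hi => hgle i (hS i hi)).trans ?_
    rw [Finset.sum_const, nsmul_eq_mul]
    refine le_trans (mul_le_mul_of_nonneg_right ?_ hη.le) hηF
    exact_mod_cast Finset.card_le_card hSF
  rw [hsum]
  by_cases hall : ∀ i ∈ F, R ≤ planeDist (x, t) (D.center N κ A i.1 i.2)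
  · obtain ⟨h5, h6⟩ := h1 x t n fun l z hz => hRR₁.trans (hall ⟨l, z⟩ ((hFmem _).mpr hz))
    refine ⟨h5, ?_⟩
    have h7 := D.norm_rogueWave_sub (N := N) (largeParams κ A) n x t 1
    rw [mul_one] at h7
    rw [h7] at h6
    have h8 := hsmall F subset_rfl hall
    rw [← sub_sub]
    exact (norm_sub_le _ _).trans (by linarith)
  · push Not at hall
    obtain ⟨i, hi, hlt⟩ := hall
    obtain ⟨h5, h6⟩ := h2 i hi x t n hlt.le
    refine ⟨h5, ?_⟩
    have h8 := hsmall (F.erase i) (Finset.erase_subset i F) fun k hk => by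
      have hki := Finset.ne_of_mem_erase hk
      have h9 := h3 i.1 k.1 i.2 ((hFmem i).mp hi) k.2
        ((hFmem k).mp (Finset.mem_of_mem_erase hk)) (fun h0 => hki (by
          rw [Prod.mk.injEq] at h0
          exact (Sigma.ext h0.1 (heq_of_eq h0.2)).symm))
      have h10 := planeDist_triangle (D.center N κ A i.1 i.2) (x, t) (D.center N κ A k.1 k.2)
      rw [planeDist_comm (D.center N κ A i.1 i.2) (x, t)] at h10
      linarith
    -- The nearest profile is compared with the solution directly; the rest of the sum is small.
    have e : ∀ q : ℂ, q - (1 + ∑ i ∈ F, g i) = (q - D.firstOrder n i.1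
        (x - (D.center N κ A i.1 i.2).1) (t - (D.center N κ A i.1 i.2).2)) -
        ∑ k ∈ F.erase i, g k := by
      intro q
      rw [← Finset.add_sum_erase F g hi, hg]
      ring
    rw [e]
    exact (norm_sub_le _ _).trans (by linarith)

end SpectralData

end

end CNLS

theorem theorem2 (D : CNLS.SpectralData) (N : Fin 2 → ℕ) (κ : Fin 2 → ℕ → ℂ)
    -- all roots of both Adler-Moser polynomials are simple
    (hsimple : ∀ (l : Fin 2) (z : ℂ), (CNLS.adlerMoser (κ l) (N l)).eval z = 0 →
      (Polynomial.derivative (CNLS.adlerMoser (κ l) (N l))).eval z ≠ 0)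
    -- the two point sets in the plane are uniformly separated
    (hsep : ∃ c : ℝ, 0 < c ∧ ∀ᶠ A : ℝ in Filter.atTop, ∀ p₁ p₂ : ℝ × ℝ,
      (CNLS.adlerMoser (κ 0) (N 0)).eval (D.psi κ A 0 p₁.1 p₁.2) = 0 →
      (CNLS.adlerMoser (κ 1) (N 1)).eval (D.psi κ A 1 p₂.1 p₂.2) = 0 →
      c ≤ CNLS.planeDist p₁ p₂) :
    -- (1) number, positions and mutual separation of the first-order rogue waves, and the
    -- splitting of both components, uniformly in the plane
    (((∀ l : Fin 2, (CNLS.rootSet (κ l) (N l)).card = N l * (N l + 1) / 2) ∧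
      D.pMinor N (CNLS.SpectralData.stdIndex N) (CNLS.SpectralData.stdIndex N) ≠ 0 ∧
      (∀ (l : Fin 2) (z : ℂ) (A x t : ℝ),
        Complex.I * D.chiOne l * (x + D.chi l * t) + D.shift N l = (z - κ l 0) * A ↔
          (x, t) = D.center N κ A l z) ∧
      (∃ c : ℝ, 0 < c ∧ ∀ᶠ A : ℝ in Filter.atTop, ∀ (l m : Fin 2),
        ∀ z ∈ CNLS.rootSet (κ l) (N l), ∀ w ∈ CNLS.rootSet (κ m) (N m), (l, z) ≠ (m, w) →
          c * A ≤ CNLS.planeDist (D.center N κ A l z) (D.center N κ A m w)) ∧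
      (∀ ε : ℝ, 0 < ε → ∀ᶠ A : ℝ in Filter.atTop, ∀ (x t : ℝ) (n : Fin 2),
        D.tau N (CNLS.largeParams κ A) none x t ≠ 0 ∧
        ‖D.rogueWave N (CNLS.largeParams κ A) n x t -
          CNLS.planeWave D.b n x t *
            (1 + ∑ l : Fin 2, ∑ z ∈ CNLS.rootSet (κ l) (N l),
              (D.firstOrder n l (x - (D.center N κ A l z).1) (t - (D.center N κ A l z).2) - 1))‖
          ≤ ε))) ∧
    -- (2) near each position: the shifted first-order rogue wave up to `O(1/A)`
    (∀ l : Fin 2, ∀ z ∈ CNLS.rootSet (κ l) (N l), ∀ R : ℝ, ∃ K : ℝ,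
      ∀ᶠ A : ℝ in Filter.atTop, ∀ (x t : ℝ) (n : Fin 2),
        CNLS.planeDist (x, t) (D.center N κ A l z) ≤ R →
        D.tau N (CNLS.largeParams κ A) none x t ≠ 0 ∧
        ‖D.rogueWave N (CNLS.largeParams κ A) n x t -
          D.firstOrder n l (x - (D.center N κ A l z).1) (t - (D.center N κ A l z).2) *
            CNLS.planeWave D.b n x t‖ ≤ K / A) ∧
    -- (3) away from all positions: the plane wave background
    (∀ ε : ℝ, 0 < ε → ∃ R : ℝ, ∀ᶠ A : ℝ in Filter.atTop, ∀ (x t : ℝ) (n : Fin 2),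
      (∀ l : Fin 2, ∀ z ∈ CNLS.rootSet (κ l) (N l),
        R ≤ CNLS.planeDist (x, t) (D.center N κ A l z)) →
      D.tau N (CNLS.largeParams κ A) none x t ≠ 0 ∧
      ‖D.rogueWave N (CNLS.largeParams κ A) n x t - CNLS.planeWave D.b n x t‖ ≤ ε) := by
  have hdist := D.exists_le_planeDist_center hsep
  exact ⟨⟨fun l => CNLS.card_rootSet (hsimple l), D.pMinor_std_ne_zero N,
      fun l z A x t => D.center_iff κ N l z A x t, hdist,
      fun ε hε => D.eventually_norm_rogueWave_sub_sum_le hsimple hdist hε⟩,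
    fun l z hz R => D.exists_norm_rogueWave_sub_firstOrder_le hsimple hdist l z hz R,
    fun ε hε => D.exists_norm_rogueWave_sub_planeWave_le hsimple hε⟩
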